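/- \textbf{Setting.} Let $K$ be a field (for instance $\mathbb C$ or $\mathbb C(q)$) and $q\in K$ with $q\neq 0$, $q^4\neq 1$. Write $[n]_p=\frac{p^n-p^{-n}}{p-p^{-1}}$, $[n]=[n]_q$ and $\{x\}_p=\frac{x-x^{-1}}{p-p^{-1}}$. Let $(a_{ij})_{1\le i,j\le 4}$ be the Cartan matrix of $F_4$ with $a_{23}=-1$, $a_{32}=-2$, $a_{12}=a_{21}=a_{34}=a_{43}=-1$, and let $d_1=d_2=2$, $d_3=d_4=1$. $U_q(F_4)$ is the $K$-algebra with generators $e_i,f_i,t_i^{\pm1}$ $(1\le i\le 4)$ and relations $t_it_j=t_jt_i$, $t_it_i^{-1}=t_i^{-1}t_i=1$, $t_ie_jt_i^{-1}=q^{d_ia_{ij}}e_j$, $t_if_jt_i^{-1}=q^{-d_ia_{ij}}f_j$, $[e_i,f_j]=\delta_{ij}\{t_i\}_{q^{d_i}}$, and for $i\ne j$ the quantum Serre relations $$\sum_{v=0}^{1-a_{ij}}(-1)^v\begin{bmatrix}1-a_{ij}\\ v\end{bmatrix}_{q^{d_i}}e_i^{1-a_{ij}-v}e_je_i^v=0$$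 and the same with $f$ in place of $e$; here the Gaussian binomial coefficient is the value of the corresponding Laurent polynomial. $\bar U_q'(B_3)$ is the algebra with generators $\mathcal E_i,\mathcal T_i^{\pm1}$ $(1\le i\le 4)$ and $\mathcal F_1,\mathcal F_2,\mathcal F_3$ and those of these relations that do not involve $f_4$. $W$ is the algebra generated by $x^{\pm1},z^{\pm1}$ with $xz=qzx$, and $x_k,z_k$ are the generators of the $k$-th factor of $W^{\otimes15}$. \textbf{The procedure.} With free integer variables $j_1,\dots,j_{15}$ and symbols $f_i^{(j)}$ (divided powers) let $$y_4=f_4^{(j_1)}f_3^{(j_2)}f_2^{(j_3)}f_1^{(j_4)}f_3^{(j_5)}f_2^{(j_6)}f_3^{(j_7)}f_4^{(j_8)}f_3^{(j_9)}f_2^{(j_{10})}f_1^{(j_{11})}f_3^{(j_{12})}f_2^{(j_{13})}f_3^{(j_{14})}f_4^{(j_{15})}=f_{i_1}^{(j_1)}\cdots f_{i_{15}}^{(j_{15})}.$$ For a generator $s\in\{e_i,f_i,t_i^{\pm1}\}$ denote by $\mathrm{rel}(sy_4)$ a formal $K$-linear combination of expressions $q^{r_1j_1+\cdots+r_{15}j_{15}}f_{i_1}^{(j_1+\alpha_1)}\cdots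 f_{i_{15}}^{(j_{15}+\alpha_{15})}s'$, with $r_k,\alpha_k\in\mathbb Z$ and $s'=1$ or $s'$ a single generator, which is obtained by moving $s$ from the left to the right through $y_4$ using exclusively the following rules: \begin{enumerate} \item[(i)] $f_if_i^{(a)}=[a+1]_{q^{d_i}}f_i^{(a+1)}$; \item[(ii)] if $a_{ik}=a_{ki}=-1$: $f_if_k^{(a)}f_i^{(b)}=[-a+b+1]_{q^{d_i}}f_k^{(a)}f_i^{(b+1)}+f_k^{(a-1)}f_i^{(b+1)}f_k$; \item[(iii)] if $a_{ki}=-2$, $a_{ik}=-1$: $f_if_k^{(a)}f_i^{(b)}f_k^{(c)}=[-b+c+1]_{q^2}f_k^{(a-2)}f_i^{(b+1)}f_k^{(c+2)}+[-a+c+2]f_k^{(a-1)}f_i^{(b+1)}f_k^{(c+1)}+[-a+b+1]_{q^2}f_k^{(a)}f_i^{(b+1)}f_k^{(c)}+f_k^{(a-2)}f_i^{(b)}f_k^{(c+2)}f_i$; \item[(iv)] $e_if_i^{(a)}=f_i^{(a)}e_i+f_i^{(a-1)}\{q^{d_i(1-a)}t_i\}_{q^{d_i}}$; \item[(v)] $t_i^{\pm1}f_k^{(a)}=q^{\mp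 a\,a_{ik}d_i}f_k^{(a)}t_i^{\pm1}$; \item[(vi)] $f_if_k^{(a)}=f_k^{(a)}f_i$ and $f_i^{(a)}f_k^{(b)}=f_k^{(b)}f_i^{(a)}$ if $a_{ik}=0$; $e_if_k^{(a)}=f_k^{(a)}e_i$ if $i\ne k$; \item[(vii)] writing $\langle\beta_1,\dots,\beta_{11}\rangle$ for $f_4^{(a_1+\beta_1)}f_3^{(a_2+\beta_2)}f_2^{(a_3+\beta_3)}f_1^{(a_4+\beta_4)}f_3^{(a_5+\beta_5)}f_2^{(a_6+\beta_6)}f_3^{(a_7+\beta_7)}f_4^{(a_8+\beta_8)}f_3^{(a_9+\beta_9)}f_2^{(a_{10}+\beta_{10})}f_3^{(a_{11}+\beta_{11})}$, \begin{align*} f_3\langle0,\dots,0\rangle={}&\langle-1,1,0,0,-1,-1,-1,0,1,1,1\rangle f_4+[a_{11}+a_9-a_8+1]\langle-1,1,0,0,-1,-1,-1,1,1,1,1\rangle\\ &+[2a_{10}-a_7-a_9+1]\langle-1,1,0,0,-1,-1,0,1,1,1,0\rangle+[a_{11}-a_7+1]\langle-1,1,0,0,-1,-1,0,1,0,1,1\rangle\\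 &+[-2a_6+a_7+a_9+1]\langle-1,1,0,0,-1,0,0,1,1,0,0\rangle+[-a_5+a_9+1]\langle-1,1,0,0,0,0,-1,1,1,0,0\rangle\\ &+[-a_5-a_7+a_8+1]\langle-1,1,0,0,0,0,0,1,0,0,0\rangle+[-a_1+a_2+1]\langle0,1,0,0,0,0,0,0,0,0,0\rangle. \end{align*} \end{enumerate} Let $\Omega$ be the $K$-linear map with $\Omega\big(q^{r_1j_1+\cdots+r_{15}j_{15}}f_{i_1}^{(j_1+\alpha_1)}\cdots f_{i_{15}}^{(j_{15}+\alpha_{15})}s'\big)=x_1^{\alpha_1}z_1^{-r_1}\cdots x_{15}^{\alpha_{15}}z_{15}^{-r_{15}}\otimes S'$, where $S'=1,\mathcal E_m,\mathcal F_m,\mathcal T_m^{\pm1}$ if $s'=1,e_m,f_m,t_m^{\pm1}$. \textbf{Theorem.} \begin{enumerate} \item[(1)] For every generator $s$ of $U_q(F_4)$ the expression $\mathrm{rel}(sy_4)$ exists, it is unique, and $f_4$ does not occur in it as a right-hand factor $s'$. There is exactly one algebra homomorphism $\rho:U_q(F_4)\to W^{\otimes15}\otimes\bar U_q'(B_3)$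 with $\rho(s)=\Omega(\mathrm{rel}(sy_4))$ for all generators $s=e_i,f_i,t_i^{\pm1}$. \item[(2)] Let $q=\varepsilon$ be a primitive $N$-th root of unity. For $g,h\in(K^\times)^{15}$ let $\sigma_{gh}$ be the representation of $W^{\otimes15}$ on $(K^N)^{\otimes15}$ for which $x_k$ acts in the $k$-th factor by $g_k$ times the cyclic shift matrix (entries $1$ at the places $(a,a+1)$, indices modulo $N$), and $z_k$ by $h_k\,\mathrm{diag}(1,\varepsilon,\dots,\varepsilon^{N-1})$. Then $\pi=(\sigma_{gh}\otimes\mathrm{id})\circ\rho$ is an algebra homomorphism. For every representation $\bar\rho'$ of $\bar U_\varepsilon'(B_3)$ on a $K$-vector space $V$, $\pi'=(\sigma_{gh}\otimes\bar\rho')\circ\rho$ is a representation of $U_\varepsilon(F_4)$ on $(K^N)^{\otimes15}\otimes V$, of dimension $N^{15}\cdot\dim V$. \item[(3)] In addition to those of $\bar\rho'$, the representation $\pi'$ has the $30$ free parameters $g_1,\dots,g_{15},h_1,\dots,h_{15}\in K^\times$: these can be chosen arbitrarily, and if $V\neq0$ the map $(g,h,\bar\rho')\mapsto\pi'$, for $g,h\in(K^\times)^{15}$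 and $\bar\rho'$ a representation on the fixed space $V$, has finite fibres. \end{enumerate} -/

import Mathlib

universe u v

open scoped TensorProduct

namespace QuantumF4

noncomputable section

/-! ### Quantum integers and Gaussian binomials -/

/-- The quantum integer `[m]_p = (p ^ m - p ^ (-m)) / (p - p⁻¹)`. -/
def qInt {K : Type u} [Field K] (p : K) (m : ℕ) : K :=
  (p ^ m - (p⁻¹) ^ m) / (p - p⁻¹)

/-- The quantum factorial `[m]_p! = ∏_{j=1}^m [j]_p`. -/
def qFact {K : Type u} [Field K] (p : K) (m : ℕ) : K :=
  ∏ j ∈ Finset.range m, qInt p (j + 1)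

/-- The symmetric Gaussian binomial coefficient, defined through its Pascal recursion, so that it
is the value at `p` of the Laurent polynomial `[m]! / ([m - n]! [n]!)` also where some of the
quantum factorials vanish at `p` (see `qBinom_mul`). -/
def qBinom {K : Type u} [Field K] (p : K) : ℕ → ℕ → K
  | _, 0 => 1
  | 0, _ + 1 => 0
  | m + 1, n + 1 =>
      p ^ (n + 1) * qBinom p m (n + 1) + p ^ ((n : ℤ) - (m : ℤ)) * qBinom p m n

theorem qBinom_eq_zero {K : Type u} [Field K] (p : K) :
    ∀ m n : ℕ, m < n → qBinom p m n = 0 := by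
  intro m
  induction m with
  | zero =>
    intro n hn
    cases n with
    | zero => omega
    | succ n => simp [qBinom]
  | succ m ih =>
    intro n hn
    cases n with
    | zero => omega
    | succ n => simp [qBinom, ih (n + 1) (by omega), ih n (by omega)]

/-- The Gaussian binomial coefficient is the quotient of the quantum factorials. -/
theorem qBinom_mul {K : Type u} [Field K] (p : K) (hp : p ≠ 0) :
    ∀ m n : ℕ, n ≤ m → qBinom p m n * (qFact p (m - n) * qFact p n) = qFact p m := by
  intro m
  induction m with
  | zero =>
    intro n hn
    obtain rfl : n = 0 := by omega
    simp [qBinom, qFact]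
  | succ m ih =>
    intro n hn
    cases n with
    | zero => simp [qBinom, qFact]
    | succ n =>
      have hs : ∀ k, qFact p (k + 1) = qFact p k * qInt p (k + 1) := fun k =>
        Finset.prod_range_succ _ _
      have hnm : n ≤ m := by omega
      obtain ⟨c, rfl⟩ := Nat.exists_eq_add_of_le hnm
      have hz : p ^ ((n : ℤ) - ((n + c : ℕ) : ℤ)) = (p⁻¹) ^ c := by
        rw [show (n : ℤ) - ((n + c : ℕ) : ℤ) = -(c : ℤ) by push_cast; ring, zpow_neg, zpow_natCast,
          inv_pow]
      have hI : qInt p (n + c + 1) = p ^ (n + 1) * qInt p c + (p⁻¹) ^ c * qInt p (n + 1) := by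
        unfold qInt
        field_simp
        ring
      have h1 := ih n hnm
      have e1 : n + c - n = c := by omega
      have e2 : n + c + 1 - (n + 1) = c := by omega
      rw [e1] at h1
      rw [e2, hs (n + c), hI, qBinom, hz]
      cases c with
      | zero =>
        rw [qBinom_eq_zero p (n + 0) (n + 1) (by omega)]
        have h0 : qInt p 0 = 0 := by simp [qInt]
        rw [h0, hs n, ← h1]
        ring
      | succ c =>
        have h2 := ih (n + 1) (by omega)
        have e3 : n + (c + 1) - (n + 1) = c := by omega
        rw [e3] at h2
        have h3 := hs c
        have h4 := hs n
        calc _ = p ^ (n + 1) * qInt p (c + 1) *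
                  (qBinom p (n + (c + 1)) (n + 1) * (qFact p c * qFact p (n + 1)))
                + (p⁻¹) ^ (c + 1) * qInt p (n + 1) *
                  (qBinom p (n + (c + 1)) n * (qFact p (c + 1) * qFact p n)) := by
              rw [h3, h4]; ring
          _ = _ := by rw [h1, h2]; ring

/-! ### The quantum group of type `F₄`

The nodes `1, 2, 3, 4` of the Dynkin diagram are the elements `0, 1, 2, 3` of `Fin 4`; the first
two simple roots are long. -/

/-- The Cartan matrix `a_{ij}` of `F₄`. -/
def cartan : Matrix (Fin 4) (Fin 4) ℤ :=
  !![ 2, -1,  0,  0;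
     -1,  2, -1,  0;
      0, -2,  2, -1;
      0,  0, -1,  2]

/-- In Mathlib's (Bourbaki's) convention this is the transpose of the Cartan matrix. -/
theorem cartan_eq : cartan = (CartanMatrix.F₄).transpose := by decide

/-- The integers `d_i`. -/
def dd : Fin 4 → ℤ := ![2, 2, 1, 1]

theorem dd_symm : ∀ i j, dd i * cartan i j = dd j * cartan j i := by decide

/-- Chevalley generators: all `e_i`, `t_i`, `t_i⁻¹`, and those `f_i` with `i ∈ S`. -/
inductive Gen (S : Set (Fin 4)) : Type
  | e (i : Fin 4) : Gen S
  | f (i : S) : Gen S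
  | t (i : Fin 4) : Gen S
  | tinv (i : Fin 4) : Gen S

/-- The nodes of the subdiagram of type `B₃`, i.e. all nodes except the last. -/
abbrev nodesB3 : Set (Fin 4) := {i | i ≠ 3}

/-- A generator, regarded as a generator of the whole quantum group. -/
def Gen.toFull {S : Set (Fin 4)} : Gen S → Gen (Set.univ : Set (Fin 4))
  | .e i => .e i
  | .f i => .f ⟨i.1, trivial⟩
  | .t i => .t i
  | .tinv i => .tinv i

/-- The left-hand side of the quantum Serre relation for `a = x_i`, `b = x_j`. -/
def serre {K : Type u} [Field K] {A : Type v} [Ring A] [Algebra K A] (q : K) (i j : Fin 4)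
    (a b : A) : A :=
  ∑ v ∈ Finset.range ((1 - cartan i j).toNat + 1),
    ((-1 : K) ^ v * qBinom (q ^ dd i) (1 - cartan i j).toNat v) •
      (a ^ ((1 - cartan i j).toNat - v) * b * a ^ v)

/-- The defining relations: those among the relations of `U_q(F₄)` which involve only the
generators in `Gen S`. -/
inductive UqRel {K : Type u} [Field K] (q : K) (S : Set (Fin 4)) :
    FreeAlgebra K (Gen S) → FreeAlgebra K (Gen S) → Prop
  | t_comm (i j : Fin 4) :
      UqRel q S (FreeAlgebra.ι K (Gen.t i) * FreeAlgebra.ι K (Gen.t j))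
        (FreeAlgebra.ι K (Gen.t j) * FreeAlgebra.ι K (Gen.t i))
  | t_tinv (i : Fin 4) :
      UqRel q S (FreeAlgebra.ι K (Gen.t i) * FreeAlgebra.ι K (Gen.tinv i)) 1
  | tinv_t (i : Fin 4) :
      UqRel q S (FreeAlgebra.ι K (Gen.tinv i) * FreeAlgebra.ι K (Gen.t i)) 1
  | t_e (i j : Fin 4) :
      UqRel q S
        (FreeAlgebra.ι K (Gen.t i) * FreeAlgebra.ι K (Gen.e j) * FreeAlgebra.ι K (Gen.tinv i))
        (q ^ (dd i * cartan i j) • FreeAlgebra.ι K (Gen.e j))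
  | t_f (i : Fin 4) (j : S) :
      UqRel q S
        (FreeAlgebra.ι K (Gen.t i) * FreeAlgebra.ι K (Gen.f j) * FreeAlgebra.ι K (Gen.tinv i))
        (q ^ (-(dd i * cartan i j)) • FreeAlgebra.ι K (Gen.f j))
  | e_f_ne (i : Fin 4) (j : S) (h : i ≠ j) :
      UqRel q S
        (FreeAlgebra.ι K (Gen.e i) * FreeAlgebra.ι K (Gen.f j)
          - FreeAlgebra.ι K (Gen.f j) * FreeAlgebra.ι K (Gen.e i)) 0
  | e_f (i : S) :
      UqRel q S
        (FreeAlgebra.ι K (Gen.e i) * FreeAlgebra.ι K (Gen.f i)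
          - FreeAlgebra.ι K (Gen.f i) * FreeAlgebra.ι K (Gen.e i))
        ((q ^ dd i - q ^ (-dd i))⁻¹ •
          (FreeAlgebra.ι K (Gen.t (i : Fin 4)) - FreeAlgebra.ι K (Gen.tinv (i : Fin 4))))
  | serre_e (i j : Fin 4) (h : i ≠ j) :
      UqRel q S (serre q i j (FreeAlgebra.ι K (Gen.e i)) (FreeAlgebra.ι K (Gen.e j))) 0
  | serre_f (i j : S) (h : i ≠ j) :
      UqRel q S (serre q i j (FreeAlgebra.ι K (Gen.f i)) (FreeAlgebra.ι K (Gen.f j))) 0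

/-- The algebra with generators `e_i`, `t_i`, `t_i⁻¹` (all `i`) and `f_i` (`i ∈ S`) and the
relations of `U_q(F₄)`. For `S = univ` this is `U_q(F₄)`, for `S = nodesB3` it is the algebra
written `Ū'_q(B₃)`. -/
def Uq {K : Type u} [Field K] (q : K) (S : Set (Fin 4)) : Type u := RingQuot (UqRel q S)

instance {K : Type u} [Field K] (q : K) (S : Set (Fin 4)) : Ring (Uq q S) :=
  inferInstanceAs (Ring (RingQuot (UqRel q S)))

instance {K : Type u} [Field K] (q : K) (S : Set (Fin 4)) : Algebra K (Uq q S) :=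
  inferInstanceAs (Algebra K (RingQuot (UqRel q S)))

/-- The image of a generator in the algebra. -/
def gen {K : Type u} [Field K] (q : K) {S : Set (Fin 4)} (s : Gen S) : Uq q S :=
  RingQuot.mkAlgHom K (UqRel q S) (FreeAlgebra.ι K s)

/-! ### The Weyl algebra and its representations at roots of unity -/

/-- Generators of the Weyl algebra. -/
inductive WeylGen : Type
  | x | xinv | z | zinv

/-- Relations of the Weyl algebra: `x z = q z x`, with `x`, `z` invertible. -/
inductive WeylRel {K : Type u} [Field K] (q : K) :
    FreeAlgebra K WeylGen → FreeAlgebra K WeylGen → Prop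
  | x_xinv : WeylRel q (FreeAlgebra.ι K WeylGen.x * FreeAlgebra.ι K WeylGen.xinv) 1
  | xinv_x : WeylRel q (FreeAlgebra.ι K WeylGen.xinv * FreeAlgebra.ι K WeylGen.x) 1
  | z_zinv : WeylRel q (FreeAlgebra.ι K WeylGen.z * FreeAlgebra.ι K WeylGen.zinv) 1
  | zinv_z : WeylRel q (FreeAlgebra.ι K WeylGen.zinv * FreeAlgebra.ι K WeylGen.z) 1
  | x_z : WeylRel q (FreeAlgebra.ι K WeylGen.x * FreeAlgebra.ι K WeylGen.z)
      (q • (FreeAlgebra.ι K WeylGen.z * FreeAlgebra.ι K WeylGen.x))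

/-- The Weyl algebra `W`. -/
def Weyl {K : Type u} [Field K] (q : K) : Type u := RingQuot (WeylRel q)

instance {K : Type u} [Field K] (q : K) : Ring (Weyl q) :=
  inferInstanceAs (Ring (RingQuot (WeylRel q)))

instance {K : Type u} [Field K] (q : K) : Algebra K (Weyl q) :=
  inferInstanceAs (Algebra K (RingQuot (WeylRel q)))

/-- The quotient map onto the Weyl algebra. -/
def Weyl.mk {K : Type u} [Field K] (q : K) : FreeAlgebra K WeylGen →ₐ[K] Weyl q :=
  RingQuot.mkAlgHom K (WeylRel q)

theorem Weyl.mk_rel {K : Type u} [Field K] (q : K) {a b : FreeAlgebra K WeylGen}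
    (h : WeylRel q a b) : Weyl.mk q a = Weyl.mk q b :=
  RingQuot.mkAlgHom_rel K h

/-- The generator `x` of the Weyl algebra, as a unit. -/
def Weyl.x {K : Type u} [Field K] (q : K) : (Weyl q)ˣ where
  val := Weyl.mk q (FreeAlgebra.ι K WeylGen.x)
  inv := Weyl.mk q (FreeAlgebra.ι K WeylGen.xinv)
  val_inv := by rw [← map_mul, Weyl.mk_rel q WeylRel.x_xinv, map_one]
  inv_val := by rw [← map_mul, Weyl.mk_rel q WeylRel.xinv_x, map_one]

/-- The generator `z` of the Weyl algebra, as a unit. -/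
def Weyl.z {K : Type u} [Field K] (q : K) : (Weyl q)ˣ where
  val := Weyl.mk q (FreeAlgebra.ι K WeylGen.z)
  inv := Weyl.mk q (FreeAlgebra.ι K WeylGen.zinv)
  val_inv := by rw [← map_mul, Weyl.mk_rel q WeylRel.z_zinv, map_one]
  inv_val := by rw [← map_mul, Weyl.mk_rel q WeylRel.zinv_z, map_one]

/-- The tensor product of fifteen copies of the Weyl algebra. -/
abbrev Weyl15 {K : Type u} [Field K] (q : K) : Type u := ⨂[K] _k : Fin 15, Weyl q

/-- The matrix `g • (cyclic shift)`: entries `g` at the places `(a, a + 1)`, indices mod `N`. -/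
def shiftMat {K : Type u} [Field K] (N : ℕ) [NeZero N] (g : K) : Matrix (Fin N) (Fin N) K :=
  Matrix.of fun a b => if b = a + 1 then g else 0

/-- The matrix `h • diag(1, ε, …, ε^(N-1))`. -/
def clockMat {K : Type u} [Field K] (ε : K) (N : ℕ) (h : K) : Matrix (Fin N) (Fin N) K :=
  Matrix.diagonal fun a => h * ε ^ (a : ℕ)

/-- Values of `σ_{gh}` on the four generators. -/
def sigmaGen {K : Type u} [Field K] (ε : K) (N : ℕ) [NeZero N] (g h : Kˣ) :
    WeylGen → Matrix (Fin N) (Fin N) K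
  | .x => shiftMat N (g : K)
  | .xinv => (shiftMat N ((g⁻¹ : Kˣ) : K)).transpose
  | .z => clockMat ε N (h : K)
  | .zinv => clockMat ε⁻¹ N ((h⁻¹ : Kˣ) : K)

theorem sigmaGen_rel {K : Type u} [Field K] (ε : K) (N : ℕ) [NeZero N] (hε : ε ^ N = 1)
    (g h : Kˣ) {a b : FreeAlgebra K WeylGen} (r : WeylRel ε a b) :
    FreeAlgebra.lift K (sigmaGen ε N g h) a = FreeAlgebra.lift K (sigmaGen ε N g h) b := by
  have hε0 : ε ≠ 0 := by
    rintro rfl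
    rw [zero_pow (NeZero.ne N)] at hε
    exact zero_ne_one hε
  have hsucc : ∀ c : Fin N, ε ^ ((c + 1 : Fin N) : ℕ) = ε * ε ^ (c : ℕ) := by
    intro c
    rw [Fin.val_add, ← pow_eq_pow_mod _ hε, pow_add, Fin.val_one' N,
      ← pow_eq_pow_mod _ hε, pow_one, mul_comm]
  cases r with
  | x_xinv =>
    simp only [map_mul, FreeAlgebra.lift_ι_apply, map_one, sigmaGen]
    ext c d
    simp [shiftMat, Matrix.mul_apply, Matrix.one_apply, eq_comm]
  | xinv_x =>
    simp only [map_mul, FreeAlgebra.lift_ι_apply, map_one, sigmaGen]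
    ext c d
    rw [Matrix.mul_apply, Finset.sum_eq_single (c - 1)]
    · by_cases hcd : c = d
      · simp [shiftMat, hcd, Matrix.one_apply]
      · simp [shiftMat, hcd, Ne.symm hcd]
    · intro x _ hx
      have hx' : c ≠ x + 1 := fun hc => hx (by rw [hc, add_sub_cancel_right])
      simp [shiftMat, hx']
    · simp
  | z_zinv =>
    simp only [map_mul, FreeAlgebra.lift_ι_apply, map_one, sigmaGen, clockMat,
      Matrix.diagonal_mul_diagonal]
    rw [← Matrix.diagonal_one]
    congr 1
    ext c
    have h1 : ε ^ (c : ℕ) ≠ 0 := pow_ne_zero _ hε0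
    have h2 : (h : K) ≠ 0 := h.ne_zero
    simp only [Units.val_inv_eq_inv_val, inv_pow]
    field_simp
  | zinv_z =>
    simp only [map_mul, FreeAlgebra.lift_ι_apply, map_one, sigmaGen, clockMat,
      Matrix.diagonal_mul_diagonal]
    rw [← Matrix.diagonal_one]
    congr 1
    ext c
    have h1 : ε ^ (c : ℕ) ≠ 0 := pow_ne_zero _ hε0
    have h2 : (h : K) ≠ 0 := h.ne_zero
    simp only [Units.val_inv_eq_inv_val, inv_pow]
    field_simp
  | x_z =>
    simp only [map_mul, map_smul, FreeAlgebra.lift_ι_apply, sigmaGen, clockMat]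
    ext c d
    rw [Matrix.mul_diagonal, Matrix.smul_apply, Matrix.diagonal_mul]
    simp only [shiftMat, Matrix.of_apply, smul_eq_mul]
    split_ifs with hd
    · rw [hd, hsucc]; ring
    · simp

/-- The representation `σ_{gh} : W → End(K^N)` of the Weyl algebra at `q = ε`, `ε^N = 1`. -/
def sigma {K : Type u} [Field K] (ε : K) (N : ℕ) [NeZero N] (hε : ε ^ N = 1) (g h : Kˣ) :
    Weyl ε →ₐ[K] Matrix (Fin N) (Fin N) K :=
  RingQuot.liftAlgHom K ⟨FreeAlgebra.lift K (sigmaGen ε N g h),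
    fun _ _ r => sigmaGen_rel ε N hε g h r⟩

/-- The space `(K^N)^{⊗ 15}`. -/
abbrev Space (K : Type u) [Field K] (N : ℕ) : Type u := ⨂[K] _k : Fin 15, (Fin N → K)

/-- The representation `σ_{gh}` of `W^{⊗ 15}` on `(K^N)^{⊗ 15}` with parameters `g_1, …, g_15` and
`h_1, …, h_15`. -/
def sigma15 {K : Type u} [Field K] (ε : K) (N : ℕ) [NeZero N] (hε : ε ^ N = 1)
    (g h : Fin 15 → Kˣ) : Weyl15 ε →ₐ[K] Module.End K (Space K N) :=
  PiTensorProduct.liftAlgHom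
    ((PiTensorProduct.mapMultilinear K (fun _ : Fin 15 => Fin N → K)
        (fun _ : Fin 15 => Fin N → K)).compLinearMap
      fun k => ((Matrix.toLinAlgEquiv' (R := K) (n := Fin N)).toAlgHom.comp
        (sigma ε N hε (g k) (h k))).toLinearMap)
    (by simp [Pi.one_def])
    (fun a b => by simp [PiTensorProduct.map_mul])

/-! ### Formal expressions and the commutation procedure -/

/-- The Dynkin nodes of the factors of the monomial `y₄`, in order: `y₄ = ∏_k f_{node k}^{(j_k)}`
with the word `4 3 2 1 3 2 3 4 3 2 1 3 2 3 4`. -/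
def node : Fin 15 → Fin 4 := ![3, 2, 1, 0, 2, 1, 2, 3, 2, 1, 0, 2, 1, 2, 3]

/-- Integer vectors indexed by the fifteen factors of `y₄`. -/
abbrev Expo : Type := Fin 15 → ℤ

/-- The standard basis vectors. -/
def δ (k : Fin 15) : Expo := Pi.single k 1

/-- Formal linear combinations of the symbols
`q^{r_1 j_1 + ⋯ + r_15 j_15} f_{i_1}^{(j_1 + α_1)} ⋯ f_{i_15}^{(j_15 + α_15)} s`, with
`i_k = node k`, free integer variables `j_1, …, j_15`, and `s` either `1` (`none`) or one
generator. The symbol is encoded by the triple `(r, α, s)`. -/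
abbrev Expr (K : Type u) [Field K] (S : Set (Fin 4)) : Type u :=
  (Expo × Expo × Option (Gen S)) →₀ K

/-- The single symbol with data `(r, α, s)`. -/
def sym (K : Type u) [Field K] {S : Set (Fin 4)} (r α : Expo) (s : Option (Gen S)) : Expr K S :=
  Finsupp.single (r, α, s) 1

/-- Multiplication by `q^{r · j}` together with the change `j_k ↦ j_k + α_k` of the exponents of
the divided powers. -/
def shift {K : Type u} [Field K] {S : Set (Fin 4)} (r α : Expo) (E : Expr K S) : Expr K S :=
  Finsupp.mapDomain (fun p => (r + p.1, α + p.2.1, p.2.2)) E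

/-- The expression `[r · j + c]_{q^d} f_{i_1}^{(j_1 + α_1)} ⋯ f_{i_15}^{(j_15 + α_15)}`, where
`[n]_p = (p^n - p^{-n}) / (p - p⁻¹)`. -/
def bracket {K : Type u} [Field K] (q : K) {S : Set (Fin 4)} (d : ℤ) (r : Expo) (c : ℤ)
    (α : Expo) : Expr K S :=
  (q ^ d - q ^ (-d))⁻¹ •
    (q ^ (d * c) • sym K (d • r) α none - q ^ (-(d * c)) • sym K (-(d • r)) α none)

/-- A generator `f_i` of the whole quantum group. -/
abbrev fGen (i : Fin 4) : Gen (Set.univ : Set (Fin 4)) := Gen.f ⟨i, trivial⟩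

/-- `Commutes q s w E`: the product of the generator `s` with the monomial
`∏_{k ∈ w} f_{node k}^{(j_k)}` (product in the order of the list `w`) is turned into the expression
`E` by the commutation relations between generators and divided powers. In `E` only the variables
`j_k` with `k ∈ w` and shifts of these occur, and the divided powers stand in the order of `w`,
or in an order that differs from it by exchanges of commuting factors.

Each rule moves `s` through the first one to three (once: eleven) factors; what is left over is a
single generator that has to be moved through the remaining factors. -/
inductive Commutes {K : Type u} [Field K] (q : K) :
    Gen (Set.univ : Set (Fin 4)) → List (Fin 15) → Expr K (Set.univ : Set (Fin 4)) → Prop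
  /-- The generator has arrived at the right end. -/
  | done (s : Gen (Set.univ : Set (Fin 4))) : Commutes q s [] (sym K 0 0 (some s))
  /-- `f_i^{(a)} f_k^{(b)} = f_k^{(b)} f_i^{(a)}` if `a_{ik} = 0`. -/
  | swap (s : Gen (Set.univ : Set (Fin 4))) (w w' : List (Fin 15)) (a b : Fin 15)
      (E : Expr K (Set.univ : Set (Fin 4))) :
      cartan (node a) (node b) = 0 → Commutes q s (w ++ a :: b :: w') E →
      Commutes q s (w ++ b :: a :: w') E
  /-- `f_i f_i^{(a)} = [a + 1]_{q^{d_i}} f_i^{(a + 1)}`. -/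
  | f_same (a : Fin 15) (w : List (Fin 15)) :
      Commutes q (fGen (node a)) (a :: w) (bracket q (dd (node a)) (δ a) 1 (δ a))
  /-- `f_i f_k^{(a)} = f_k^{(a)} f_i` if `a_{ik} = 0`. -/
  | f_comm (i : Fin 4) (a : Fin 15) (w : List (Fin 15)) (E : Expr K (Set.univ : Set (Fin 4))) :
      cartan i (node a) = 0 → Commutes q (fGen i) w E → Commutes q (fGen i) (a :: w) E
  /-- `f_i f_k^{(a)} f_i^{(b)} = [-a + b + 1]_{q^{d_i}} f_k^{(a)} f_i^{(b + 1)}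
  + f_k^{(a - 1)} f_i^{(b + 1)} f_k` if `a_{ik} = a_{ki} = -1`. -/
  | f_simple (i k : Fin 4) (a b : Fin 15) (w : List (Fin 15))
      (E : Expr K (Set.univ : Set (Fin 4))) :
      cartan i k = -1 → cartan k i = -1 → node a = k → node b = i →
      Commutes q (fGen k) w E →
      Commutes q (fGen i) (a :: b :: w)
        (bracket q (dd i) (-δ a + δ b) 1 (δ b) + shift 0 (-δ a + δ b) E)
  /-- `f_i f_k^{(a)} f_i^{(b)} f_k^{(c)} =
  [-b + c + 1]_{q^2} f_k^{(a - 2)} f_i^{(b + 1)} f_k^{(c + 2)}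
  + [-a + c + 2]_q f_k^{(a - 1)} f_i^{(b + 1)} f_k^{(c + 1)}
  + [-a + b + 1]_{q^2} f_k^{(a)} f_i^{(b + 1)} f_k^{(c)}
  + f_k^{(a - 2)} f_i^{(b)} f_k^{(c + 2)} f_i` if `a_{ki} = -2`, `a_{ik} = -1`. -/
  | f_double (i k : Fin 4) (a b c : Fin 15) (w : List (Fin 15))
      (E : Expr K (Set.univ : Set (Fin 4))) :
      cartan k i = -2 → cartan i k = -1 → node a = k → node b = i → node c = k →
      Commutes q (fGen i) w E →
      Commutes q (fGen i) (a :: b :: c :: w)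
        (bracket q 2 (-δ b + δ c) 1 (-(2 : ℤ) • δ a + δ b + (2 : ℤ) • δ c)
          + bracket q 1 (-δ a + δ c) 2 (-δ a + δ b + δ c)
          + bracket q 2 (-δ a + δ b) 1 (δ b)
          + shift 0 (-(2 : ℤ) • δ a + (2 : ℤ) • δ c) E)
  /-- The relation for `f_3` and the product
  `f_4^{(a_1)} f_3^{(a_2)} f_2^{(a_3)} f_1^{(a_4)} f_3^{(a_5)} f_2^{(a_6)} f_3^{(a_7)} f_4^{(a_8)}
  f_3^{(a_9)} f_2^{(a_10)} f_3^{(a_11)}`. -/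
  | f_long (a₁ a₂ a₃ a₄ a₅ a₆ a₇ a₈ a₉ a₁₀ a₁₁ : Fin 15) (w : List (Fin 15))
      (E : Expr K (Set.univ : Set (Fin 4))) :
      [a₁, a₂, a₃, a₄, a₅, a₆, a₇, a₈, a₉, a₁₀, a₁₁].map node
        = [3, 2, 1, 0, 2, 1, 2, 3, 2, 1, 2] →
      Commutes q (fGen 3) w E →
      Commutes q (fGen 2) (a₁ :: a₂ :: a₃ :: a₄ :: a₅ :: a₆ :: a₇ :: a₈ :: a₉ :: a₁₀ :: a₁₁ :: w)
        (shift 0 (-δ a₁ + δ a₂ - δ a₅ - δ a₆ - δ a₇ + δ a₉ + δ a₁₀ + δ a₁₁) E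
          + bracket q 1 (δ a₁₁ + δ a₉ - δ a₈) 1
              (-δ a₁ + δ a₂ - δ a₅ - δ a₆ - δ a₇ + δ a₈ + δ a₉ + δ a₁₀ + δ a₁₁)
          + bracket q 1 ((2 : ℤ) • δ a₁₀ - δ a₇ - δ a₉) 1
              (-δ a₁ + δ a₂ - δ a₅ - δ a₆ + δ a₈ + δ a₉ + δ a₁₀)
          + bracket q 1 (δ a₁₁ - δ a₇) 1
              (-δ a₁ + δ a₂ - δ a₅ - δ a₆ + δ a₈ + δ a₁₀ + δ a₁₁)
          + bracket q 1 (-(2 : ℤ) • δ a₆ + δ a₇ + δ a₉) 1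
              (-δ a₁ + δ a₂ - δ a₅ + δ a₈ + δ a₉)
          + bracket q 1 (-δ a₅ + δ a₉) 1 (-δ a₁ + δ a₂ - δ a₇ + δ a₈ + δ a₉)
          + bracket q 1 (-δ a₅ - δ a₇ + δ a₈) 1 (-δ a₁ + δ a₂ + δ a₈)
          + bracket q 1 (-δ a₁ + δ a₂) 1 (δ a₂))
  /-- `e_i f_k^{(a)} = f_k^{(a)} e_i` if `i ≠ k`. -/
  | e_comm (i : Fin 4) (a : Fin 15) (w : List (Fin 15)) (E : Expr K (Set.univ : Set (Fin 4))) :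
      i ≠ node a → Commutes q (Gen.e i) w E → Commutes q (Gen.e i) (a :: w) E
  /-- `e_i f_i^{(a)} = f_i^{(a)} e_i + f_i^{(a - 1)} {q^{d_i (1 - a)} t_i}_{q^{d_i}}` with
  `{x}_p = (x - x⁻¹) / (p - p⁻¹)`. -/
  | e_same (a : Fin 15) (w : List (Fin 15)) (E E₁ E₂ : Expr K (Set.univ : Set (Fin 4))) :
      Commutes q (Gen.e (node a)) w E → Commutes q (Gen.t (node a)) w E₁ →
      Commutes q (Gen.tinv (node a)) w E₂ →
      Commutes q (Gen.e (node a)) (a :: w)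
        (E + (q ^ dd (node a) - q ^ (-dd (node a)))⁻¹ •
          (q ^ dd (node a) • shift (-(dd (node a) • δ a)) (-δ a) E₁
            - q ^ (-dd (node a)) • shift (dd (node a) • δ a) (-δ a) E₂))
  /-- `t_i f_k^{(a)} = q^{-a a_{ik} d_i} f_k^{(a)} t_i`. -/
  | t_comm (i : Fin 4) (a : Fin 15) (w : List (Fin 15)) (E : Expr K (Set.univ : Set (Fin 4))) :
      Commutes q (Gen.t i) w E →
      Commutes q (Gen.t i) (a :: w) (shift (-((cartan i (node a) * dd i) • δ a)) 0 E)
  /-- `t_i⁻¹ f_k^{(a)} = q^{a a_{ik} d_i} f_k^{(a)} t_i⁻¹`. -/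
  | tinv_comm (i : Fin 4) (a : Fin 15) (w : List (Fin 15))
      (E : Expr K (Set.univ : Set (Fin 4))) :
      Commutes q (Gen.tinv i) w E →
      Commutes q (Gen.tinv i) (a :: w) (shift ((cartan i (node a) * dd i) • δ a) 0 E)

/-- The factors of `y₄`, from left to right. -/
def y4 : List (Fin 15) := List.finRange 15

/-- `IsRel q s E`: the expression `E` is a result of commuting `s` with the monomial `y₄`. -/
def IsRel {K : Type u} [Field K] (q : K) (s : Gen (Set.univ : Set (Fin 4)))
    (E : Expr K (Set.univ : Set (Fin 4))) : Prop :=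
  Commutes q s y4 E

/-- An expression with right-hand generators in `Gen S`, regarded as one with right-hand
generators in the whole quantum group. -/
def Expr.toFull {K : Type u} [Field K] {S : Set (Fin 4)} (E : Expr K S) :
    Expr K (Set.univ : Set (Fin 4)) :=
  Finsupp.mapDomain (fun p => (p.1, p.2.1, p.2.2.map Gen.toFull)) E

/-- The rule `Ω`: the linear map with
`q^{r · j} f_{i_1}^{(j_1 + α_1)} ⋯ f_{i_15}^{(j_15 + α_15)} s ↦
x_1^{α_1} z_1^{-r_1} ⋯ x_15^{α_15} z_15^{-r_15} ⊗ s`. -/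
def Om {K : Type u} [Field K] (q : K) (S : Set (Fin 4)) :
    Expr K S →ₗ[K] Weyl15 q ⊗[K] Uq q S :=
  Finsupp.linearCombination K fun p =>
    (PiTensorProduct.tprod K fun k : Fin 15 =>
      (((Weyl.x q) ^ (p.2.1 k) * (Weyl.z q) ^ (-(p.1 k)) : (Weyl q)ˣ) : Weyl q))
    ⊗ₜ[K] (p.2.2.elim 1 (gen q))

/-! ### The induced representations -/

/-- The algebra homomorphism `σ_{gh} ⊗ id`. -/
def sigmaId {K : Type u} [Field K] (q : K) (S : Set (Fin 4)) (N : ℕ) [NeZero N]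
    (hq : q ^ N = 1) (g h : Fin 15 → Kˣ) :
    Weyl15 q ⊗[K] Uq q S →ₐ[K] Module.End K (Space K N) ⊗[K] Uq q S :=
  Algebra.TensorProduct.map (sigma15 q N hq g h) (AlgHom.id K (Uq q S))

/-- The representation of `End((K^N)^{⊗ 15}) ⊗ Uq q S` on `(K^N)^{⊗ 15} ⊗ V` obtained from a
representation `ρbar` of `Uq q S` on `V`. -/
def idRep {K : Type u} [Field K] {q : K} {S : Set (Fin 4)} (N : ℕ)
    {V : Type v} [AddCommGroup V] [Module K V] (ρbar : Uq q S →ₐ[K] Module.End K V) :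
    Module.End K (Space K N) ⊗[K] Uq q S →ₐ[K] Module.End K (Space K N ⊗[K] V) :=
  (Module.endTensorEndAlgHom (R := K) (S := K) (A := K) (M := Space K N) (N := V)).comp
    (Algebra.TensorProduct.map (AlgHom.id K (Module.End K (Space K N))) ρbar)

/-- `π = (σ_{gh} ⊗ id) ∘ ρ`. -/
def piHom {K : Type u} [Field K] {q : K} {S : Set (Fin 4)}
    (ρ : Uq q (Set.univ : Set (Fin 4)) →ₐ[K] Weyl15 q ⊗[K] Uq q S)
    (N : ℕ) [NeZero N] (hq : q ^ N = 1) (g h : Fin 15 → Kˣ) :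
    Uq q (Set.univ : Set (Fin 4)) →ₐ[K] Module.End K (Space K N) ⊗[K] Uq q S :=
  (sigmaId q S N hq g h).comp ρ

/-- The representation `π'` on `(K^N)^{⊗ 15} ⊗ V` obtained from `π` by taking the second tensor
factor in the representation `ρbar` on `V`. -/
def piRep {K : Type u} [Field K] {q : K} {S : Set (Fin 4)}
    (ρ : Uq q (Set.univ : Set (Fin 4)) →ₐ[K] Weyl15 q ⊗[K] Uq q S)
    (N : ℕ) [NeZero N] (hq : q ^ N = 1) (g h : Fin 15 → Kˣ)
    {V : Type v} [AddCommGroup V] [Module K V] (ρbar : Uq q S →ₐ[K] Module.End K V) :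
    Uq q (Set.univ : Set (Fin 4)) →ₐ[K] Module.End K (Space K N ⊗[K] V) :=
  (idRep N ρbar).comp (piHom ρ N hq g h)

end

end QuantumF4

open QuantumF4

/-! Uniqueness of `rel`. For `e_i` and `t_i` the rules lead to closed formulas (`eExpr`, `tExp`),
and these do not change when commuting neighbours of the word are exchanged. For `f_i` there is a
choice of rules. However, the only commuting neighbours in `y₄` are the two pairs `f_1 f_3`, so only
finitely many words, the suffixes of four rearrangements, can ever be left over. On this finite set
the kernel checks that every applicable rule which does not lead into a dead end gives the same
symbolic result `fval` (`words_swaps`, `words_cands`). Induction on a derivation then gives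
uniqueness (`Commutes.expected`), and explicit derivations give existence. The leftover generator of
`f_i` is `f_i` itself for `i ≠ 4`, and there is none for `f_4`.

Existence of `ρ`. With `D_i = q^{d_i} - q^{-d_i}`, the image of `e_i` or `f_i` has the form `D_i⁻¹
P⁺ + T + D_i⁻¹ P⁻` (`gval`). Here `T` is a monomial times the generator itself (zero for `f_4`), and
`P⁺`, `P⁻` collect the terms from the first and the second half of the quantum integers. For
generators of the same kind, `P⁺_i` and `T_j`, `T_i` and `P⁻_j`, `P⁺_i` and `P⁻_j` commute up to the
factor `q^{d_i a_{ij}}`. This is the situation of a coproduct, in which Serre expressions are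
additive (`serre_add`). So the Serre relations split into those for `T`, which hold in the small
algebra, and those for `P⁺` and `P⁻`, which are identities between sums of monomials in a quantum
torus. In `[e_i, f_j]` the parts `P` of one generator commute with the part `T` of the other, and
only the commutators `[P, P]` and `[T, T]` remain (`gval_commutator`).

The torus identities are iterated `q`-commutators (`serre_eq_foldr`). They are evaluated by a
program running in the kernel, with each monomial packed into one natural number; the soundness of
the program is `eq_zero_of_cancels`.

Finite fibres. Changing `(g, h)` multiplies the image of each monomial by a character value `chi`.
Conjugations by monomials act on the terms of the image of `e_i` with different eigenvalues, so `π'`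
determines every single term (`psi_signsP_eq`). Comparing these terms with the images of `t_i^{±1}`
removes the unknown representation `ρbar` and leaves a triangular system of equations for the
quotients of the parameters, whose solutions are roots of unity (`pow_eq_one_of_psi_eq`). Once `g`
and `h` are fixed, `ρbar` is determined (`rho_eq_of_psi_gval_eq`). -/

namespace QuantumF4

noncomputable section

/-! ### Integer vectors as lists -/

/-- The integer vector with the entries of a list (and zeros after them). -/
def vec (l : List ℤ) : Expo := fun k => l.getD k 0

/-- Entrywise addition of lists, the shorter one being padded by zeros. -/
def addL : List ℤ → List ℤ → List ℤ
  | [], l => l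
  | a :: l, [] => a :: l
  | a :: l, b :: m => (a + b) :: addL l m

/-- The list of coordinates of a linear combination of the `δ k`. -/
def lcomb (l : List (ℤ × Fin 15)) : List ℤ :=
  (List.finRange 15).map fun k => (l.map fun p => if p.2 = k then p.1 else 0).sum

theorem getD_addL : ∀ (l m : List ℤ) (k : ℕ), (addL l m).getD k 0 = l.getD k 0 + m.getD k 0
  | [], m, k => by simp [addL]
  | a :: l, [], k => by simp [addL]
  | a :: l, b :: m, 0 => by simp [addL]
  | a :: l, b :: m, k + 1 => by simpa [addL] using getD_addL l m k

theorem vec_addL (l m : List ℤ) : vec (addL l m) = vec l + vec m :=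
  funext fun k => getD_addL l m k

theorem vec_lcomb (l : List (ℤ × Fin 15)) : vec (lcomb l) = (l.map fun p => p.1 • δ p.2).sum := by
  funext k
  have h : vec (lcomb l) k = (l.map fun p => if p.2 = k then p.1 else 0).sum := by
    simp [vec, lcomb, List.getD_eq_getElem?_getD]
  rw [h]
  clear h
  induction l with
  | nil => rfl
  | cons p l ih =>
    simp only [List.map_cons, List.sum_cons, ih, Pi.add_apply, Pi.smul_apply, δ, Pi.single_apply]
    simp [eq_comm]

/-! ### Shifts of expressions -/

section shift

variable {K : Type u} [Field K] {S : Set (Fin 4)}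

theorem shift_add (r α : Expo) (E F : Expr K S) :
    shift r α (E + F) = shift r α E + shift r α F := Finsupp.mapDomain_add

theorem shift_smul (r α : Expo) (c : K) (E : Expr K S) :
    shift r α (c • E) = c • shift r α E := Finsupp.mapDomain_smul _ _

theorem shift_zero_expr (r α : Expo) : shift r α (0 : Expr K S) = 0 := Finsupp.mapDomain_zero

theorem shift_sub (r α : Expo) (E F : Expr K S) :
    shift r α (E - F) = shift r α E - shift r α F := by
  rw [sub_eq_add_neg, sub_eq_add_neg, shift_add, ← neg_one_smul K F, shift_smul, neg_one_smul]

theorem shift_sym (r α r' α' : Expo) (s : Option (Gen S)) :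
    shift r α (sym K r' α' s) = sym K (r + r') (α + α') s := Finsupp.mapDomain_single

theorem shift_bracket (q : K) (α : Expo) (d : ℤ) (r : Expo) (c : ℤ) (β : Expo) :
    shift 0 α (bracket q d r c β : Expr K S) = bracket q d r c (α + β) := by
  simp only [bracket, shift_smul, shift_sub, shift_sym, zero_add]

end shift

/-! ### Moving `f_i` through a monomial -/

/-- Data for the expression obtained from `f_i`: a list of brackets `(d, r, c, α)` and possibly a
shifted monomial with a generator at its right end. -/
abbrev FVal : Type := List (ℤ × List ℤ × ℤ × List ℤ) × Option (List ℤ × Fin 4)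

instance : DecidableEq FVal :=
  @instDecidableEqProd _ _
    (@instDecidableEqList _
      (inferInstanceAs (DecidableEq (ℤ × List ℤ × ℤ × List ℤ))))
    (inferInstanceAs (DecidableEq (Option (List ℤ × Fin 4))))

/-- The expression described by an `FVal`. -/
def evalF {K : Type u} [Field K] (q : K) {S : Set (Fin 4)} (g : Fin 4 → Option (Gen S))
    (v : FVal) : Expr K S :=
  (v.1.map fun b => bracket q b.1 (vec b.2.1) b.2.2.1 (vec b.2.2.2)).sum
    + v.2.elim 0 fun p => sym K 0 (vec p.1) (g p.2)

/-- Change of all exponents of divided powers. -/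
def shiftF (α : List ℤ) (v : FVal) : FVal :=
  (v.1.map fun b => (b.1, b.2.1, b.2.2.1, addL α b.2.2.2), v.2.map fun p => (addL α p.1, p.2))

/-- Further brackets. -/
def consF (l : List (ℤ × List ℤ × ℤ × List ℤ)) (v : FVal) : FVal := (l ++ v.1, v.2)

theorem evalF_shiftF {K : Type u} [Field K] (q : K) {S : Set (Fin 4)}
    (g : Fin 4 → Option (Gen S)) (α : List ℤ) (v : FVal) :
    evalF q g (shiftF α v) = shift 0 (vec α) (evalF q g v) := by
  obtain ⟨l, t⟩ := v
  simp only [evalF, shiftF, shift_add, List.map_map]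
  congr 1
  · induction l with
    | nil => simp [shift_zero_expr]
    | cons b l ih => simp [shift_add, shift_bracket, vec_addL, ← ih]
  · cases t with
    | none => simp [shift_zero_expr]
    | some p => simp [shift_sym, vec_addL]

theorem evalF_consF {K : Type u} [Field K] (q : K) {S : Set (Fin 4)}
    (g : Fin 4 → Option (Gen S)) (l : List (ℤ × List ℤ × ℤ × List ℤ)) (v : FVal) :
    evalF q g (consF l v)
      = (l.map fun b => bracket q b.1 (vec b.2.1) b.2.2.1 (vec b.2.2.2)).sum + evalF q g v := by
  simp [evalF, consF, add_assoc]

/-- The words obtained by exchanging one pair of commuting neighbours. -/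
def swaps : List (Fin 15) → List (List (Fin 15))
  | b :: a :: w =>
    (if cartan (node a) (node b) = 0 then [a :: b :: w] else []) ++ (swaps (a :: w)).map (b :: ·)
  | _ => []

theorem mem_swaps (a b : Fin 15) (h : cartan (node a) (node b) = 0) (w' : List (Fin 15)) :
    ∀ w, w ++ a :: b :: w' ∈ swaps (w ++ b :: a :: w')
  | [] => by simp [swaps, h]
  | [c] => by simp [swaps, h]
  | c :: d :: w => by
    have := mem_swaps a b h w' (d :: w)
    simp only [List.cons_append, swaps] at this ⊢
    exact List.mem_append_right _ (List.mem_map_of_mem this)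

/-- Words which differ by at most two exchanges. -/
def swapClass (w : List (Fin 15)) : List (List (Fin 15)) :=
  (w :: swaps w ++ (swaps w).flatMap swaps).dedup

/-- All words that can be left over when the commutation relations are applied to `y₄`. -/
def words : List (List (Fin 15)) := ((swapClass y4).flatMap List.tails).dedup

/-- The result of the long relation, if it is applicable. -/
def longCand (rec : Fin 4 → List (Fin 15) → Option FVal) (i : Fin 4) :
    List (Fin 15) → Option FVal
  | a₁ :: a₂ :: a₃ :: a₄ :: a₅ :: a₆ :: a₇ :: a₈ :: a₉ :: a₁₀ :: a₁₁ :: w =>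
    if i = 2 ∧ [a₁, a₂, a₃, a₄, a₅, a₆, a₇, a₈, a₉, a₁₀, a₁₁].map node
        = [3, 2, 1, 0, 2, 1, 2, 3, 2, 1, 2] then
      (rec 3 w).map fun v => consF
        [(1, lcomb [(1, a₁₁), (1, a₉), (-1, a₈)], 1, lcomb [(-1, a₁), (1, a₂), (-1, a₅), (-1, a₆),
            (-1, a₇), (1, a₈), (1, a₉), (1, a₁₀), (1, a₁₁)]),
          (1, lcomb [(2, a₁₀), (-1, a₇), (-1, a₉)], 1, lcomb [(-1, a₁), (1, a₂), (-1, a₅),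
            (-1, a₆), (1, a₈), (1, a₉), (1, a₁₀)]),
          (1, lcomb [(1, a₁₁), (-1, a₇)], 1, lcomb [(-1, a₁), (1, a₂), (-1, a₅), (-1, a₆),
            (1, a₈), (1, a₁₀), (1, a₁₁)]),
          (1, lcomb [(-2, a₆), (1, a₇), (1, a₉)], 1, lcomb [(-1, a₁), (1, a₂), (-1, a₅), (1, a₈),
            (1, a₉)]),
          (1, lcomb [(-1, a₅), (1, a₉)], 1, lcomb [(-1, a₁), (1, a₂), (-1, a₇), (1, a₈),
            (1, a₉)]),
          (1, lcomb [(-1, a₅), (-1, a₇), (1, a₈)], 1, lcomb [(-1, a₁), (1, a₂), (1, a₈)]),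
          (1, lcomb [(-1, a₁), (1, a₂)], 1, lcomb [(1, a₂)])]
        (shiftF (lcomb [(-1, a₁), (1, a₂), (-1, a₅), (-1, a₆), (-1, a₇), (1, a₉), (1, a₁₀),
          (1, a₁₁)]) v)
    else none
  | _ => none

/-- The results of all relations which can be applied to `f_i` and the beginning of a word. -/
def cands (rec : Fin 4 → List (Fin 15) → Option FVal) (i : Fin 4) :
    List (Fin 15) → List (Option FVal)
  | [] => [some ([], some (lcomb [], i))]
  | a :: w =>
    (if node a = i then [some ([(dd (node a), lcomb [(1, a)], 1, lcomb [(1, a)])], none)] else [])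
    ++ (if cartan i (node a) = 0 then [rec i w] else [])
    ++ (match w with
      | [] => []
      | b :: w =>
        (if cartan i (node a) = -1 ∧ cartan (node a) i = -1 ∧ node b = i then
          [(rec (node a) w).map fun v => consF
            [(dd i, lcomb [(-1, a), (1, b)], 1, lcomb [(1, b)])]
            (shiftF (lcomb [(-1, a), (1, b)]) v)]
        else [])
        ++ (match w with
          | [] => []
          | c :: w =>
            if cartan (node a) i = -2 ∧ cartan i (node a) = -1 ∧ node b = i ∧ node c = node a then
              [(rec i w).map fun v => consF
                [(2, lcomb [(-1, b), (1, c)], 1, lcomb [(-2, a), (1, b), (2, c)]),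
                  (1, lcomb [(-1, a), (1, c)], 2, lcomb [(-1, a), (1, b), (1, c)]),
                  (2, lcomb [(-1, a), (1, b)], 1, lcomb [(1, b)])]
                (shiftF (lcomb [(-2, a), (2, c)]) v)]
            else []))
    ++ [longCand rec i (a :: w)]

/-- A search for the result of moving `f_i` through a word. -/
def search : ℕ → Fin 4 → List (Fin 15) → Option FVal
  | 0, _, _ => none
  | n + 1, i, w => (swapClass w).findSome? fun w' => (cands (search n) i w').findSome? id

/-- The result of moving `f_i` through a word. -/
def fval (i : Fin 4) (w : List (Fin 15)) : Option FVal := search 15 i w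

/-- Handles the rule `swap` in the uniqueness proof. Two exchanges reach all rearrangements of `y₄`,
because its only commuting neighbours are the two pairs `f_1 f_3`. -/
theorem words_swaps : ∀ w ∈ words, ∀ w' ∈ swaps w, w' ∈ words ∧ ∀ i, fval i w' = fval i w := by
  decide +kernel

/-- Confluence of the rules for `f_i`. The alternative `none` occurs for dead ends: rule (ii) also
applies to `f_3` in front of `y₄`, but it leaves an `f_4` that cannot pass the next `f_3`. The lemma
also shows that the search depth 15 is enough, since otherwise some candidate would differ from
`fval`. -/
theorem words_cands : ∀ w ∈ words, ∀ i, ∀ c ∈ cands fval i w, c = none ∨ c = fval i w := by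
  decide +kernel

theorem words_tail : ∀ w ∈ words, w.tail ∈ words := by
  decide +kernel

theorem y4_mem_words : y4 ∈ words := by
  decide +kernel

end

end QuantumF4

/-! ### Closed formulas for `e_i` and `t_i`, and uniqueness of the commutation results -/

namespace QuantumF4

noncomputable section

variable {K : Type u} [Field K]

/-- The exponent of `q` obtained when `t_i` is moved through a word. -/
def tExp (i : Fin 4) : List (Fin 15) → Expo
  | [] => 0
  | a :: w => -((cartan i (node a) * dd i) • δ a) + tExp i w

/-- The result of moving `e_i` through a word. -/
def eExpr (q : K) {S : Set (Fin 4)} (i : Fin 4) : List (Fin 15) → Expr K S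
  | [] => sym K 0 0 (some (.e i))
  | a :: w =>
    if node a = i then
      eExpr q i w + (q ^ dd i - q ^ (-dd i))⁻¹ •
        (q ^ dd i • shift (-(dd i • δ a)) (-δ a) (sym K (tExp i w) 0 (some (.t i)))
          - q ^ (-dd i) • shift (dd i • δ a) (-δ a) (sym K (-tExp i w) 0 (some (.tinv i))))
    else eExpr q i w

theorem tExp_swap (i : Fin 4) (w w' : List (Fin 15)) (a b : Fin 15) :
    tExp i (w ++ b :: a :: w') = tExp i (w ++ a :: b :: w') := by
  induction w with
  | nil => simp only [List.nil_append, tExp]; abel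
  | cons c w ih => simp only [List.cons_append, tExp, ih]

theorem dd_pos : ∀ i, 0 < dd i := by decide

theorem cartan_comm_zero (i j : Fin 4) (h : cartan i j = 0) : cartan j i = 0 := by
  have := dd_symm i j
  rw [h, mul_zero] at this
  exact (mul_eq_zero.mp this.symm).resolve_left (dd_pos j).ne'

theorem cartan_self : ∀ i, cartan i i = 2 := by decide

/-- Commuting neighbours cannot both belong to node `i`, as `a_{ii} = 2`. If one of them does,
passing `t_i` through the other one costs no power of `q`. -/
theorem eExpr_swap (q : K) {S : Set (Fin 4)} (i : Fin 4) (w w' : List (Fin 15)) (a b : Fin 15)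
    (h : cartan (node a) (node b) = 0) :
    (eExpr q i (w ++ b :: a :: w') : Expr K S) = eExpr q i (w ++ a :: b :: w') := by
  induction w with
  | nil =>
    have h' := cartan_comm_zero _ _ h
    by_cases ha : node a = i <;> by_cases hb : node b = i
    · rw [ha, hb, cartan_self] at h
      exact absurd h (by norm_num)
    · subst ha
      simp [eExpr, tExp, hb, h]
    · subst hb
      simp [eExpr, tExp, ha, h']
    · simp [eExpr, ha, hb]
  | cons c w ih => simp only [List.cons_append, eExpr, ih, tExp_swap i w w' a b]

/-- The expected form of the results of the commutation relations. -/
def Expected (q : K) (w : List (Fin 15)) (E : Expr K (Set.univ : Set (Fin 4))) :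
    Gen (Set.univ : Set (Fin 4)) → Prop
  | .e i => E = eExpr q i w
  | .t i => E = sym K (tExp i w) 0 (some (.t i))
  | .tinv i => E = sym K (-tExp i w) 0 (some (.tinv i))
  | .f i => w ∈ words → ∃ v, fval i w = some v ∧ E = evalF q (fun m => some (fGen m)) v

theorem fval_of_cand {i : Fin 4} {w : List (Fin 15)} (hw : w ∈ words) {v : FVal}
    (h : some v ∈ cands fval i w) : fval i w = some v := by
  rcases words_cands w hw i _ h with h | h
  · cases h
  · exact h.symm

/-- Induction on the derivation. Each rule for `f_i` leaves a suffix of the word, which is again in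
`words`, and what it produces is one of the candidates compared in `words_cands`. -/
theorem Commutes.expected {q : K} {s : Gen (Set.univ : Set (Fin 4))} {w : List (Fin 15)}
    {E : Expr K (Set.univ : Set (Fin 4))} (h : Commutes q s w E) : Expected q w E s := by
  induction h with
  | done s =>
    cases s with
    | e i => rfl
    | t i => rfl
    | tinv i => simp [Expected, tExp]
    | f i =>
      intro hw
      refine ⟨_, fval_of_cand hw (v := ([], some (lcomb [], i))) (by simp [cands]), ?_⟩
      simp [evalF, vec_lcomb]
  | swap s w w' a b E hab _ ih =>
    cases s with
    | e i => exact ih.trans (eExpr_swap q i w w' a b hab).symm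
    | t i => simpa only [Expected, tExp_swap i w w' a b] using ih
    | tinv i => simpa only [Expected, tExp_swap i w w' a b] using ih
    | f i =>
      intro hw
      obtain ⟨h₁, h₂⟩ := words_swaps _ hw _ (mem_swaps a b hab w' w)
      rw [← h₂]
      exact ih h₁
  | f_same a w =>
    intro hw
    refine ⟨_, fval_of_cand hw
      (v := ([(dd (node a), lcomb [(1, a)], 1, lcomb [(1, a)])], none)) ?_, ?_⟩
    · simp [cands]
    · simp [evalF, vec_lcomb]
  | f_comm i a w E h _ ih =>
    intro hw
    obtain ⟨v, hv, rfl⟩ := ih (words_tail _ hw)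
    exact ⟨v, fval_of_cand hw (by simp [cands, h, hv]), rfl⟩
  | f_simple i k a b w E h₁ h₂ ha hb _ ih =>
    intro hw
    subst ha
    obtain ⟨v, hv, rfl⟩ := ih (words_tail _ (words_tail _ hw))
    refine ⟨_, fval_of_cand hw (v := consF [(dd i, lcomb [(-1, a), (1, b)], 1, lcomb [(1, b)])]
      (shiftF (lcomb [(-1, a), (1, b)]) v)) ?_, ?_⟩
    · simp only [cands, h₁, h₂, hb, hv]
      simp
    · simp [evalF_consF, evalF_shiftF, vec_lcomb]
  | f_double i k a b c w E h₁ h₂ ha hb hc _ ih =>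
    intro hw
    subst ha
    obtain ⟨v, hv, rfl⟩ := ih (words_tail _ (words_tail _ (words_tail _ hw)))
    refine ⟨_, fval_of_cand hw (v := consF
      [(2, lcomb [(-1, b), (1, c)], 1, lcomb [(-2, a), (1, b), (2, c)]),
        (1, lcomb [(-1, a), (1, c)], 2, lcomb [(-1, a), (1, b), (1, c)]),
        (2, lcomb [(-1, a), (1, b)], 1, lcomb [(1, b)])]
      (shiftF (lcomb [(-2, a), (2, c)]) v)) ?_, ?_⟩
    · simp only [cands, h₁, h₂, hb, hc, hv]
      simp
    · simp [evalF_consF, evalF_shiftF, vec_lcomb, add_assoc]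
  | f_long a₁ a₂ a₃ a₄ a₅ a₆ a₇ a₈ a₉ a₁₀ a₁₁ w E ha _ ih =>
    intro hw
    have hw' : w ∈ words := by
      have := words_tail _ (words_tail _ (words_tail _ (words_tail _ (words_tail _ (words_tail _
        (words_tail _ (words_tail _ (words_tail _ (words_tail _ (words_tail _ hw))))))))))
      exact this
    obtain ⟨v, hv, rfl⟩ := ih hw'
    -- The long relation is the last entry of `cands`; its side condition is `ha`.
    have hc : longCand fval 2
        (a₁ :: a₂ :: a₃ :: a₄ :: a₅ :: a₆ :: a₇ :: a₈ :: a₉ :: a₁₀ :: a₁₁ :: w) = _ :=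
      (if_pos ⟨rfl, ha⟩).trans (congrArg (Option.map _) hv)
    refine ⟨_, fval_of_cand hw (by
      rw [← Option.map_some, ← hc]
      exact List.mem_append_right _ (List.mem_singleton_self _)), ?_⟩
    simp only [evalF_consF, evalF_shiftF, vec_lcomb, List.map_cons, List.map_nil, List.sum_cons,
      List.sum_nil, add_zero, neg_smul, one_smul, sub_eq_add_neg, ← add_assoc]
    abel
  | e_comm i a w E h _ ih =>
    simpa only [Expected, eExpr, if_neg (Ne.symm h)] using ih
  | e_same a w E E₁ E₂ _ _ _ ih ih₁ ih₂ =>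
    simp only [Expected] at ih ih₁ ih₂ ⊢
    simp only [eExpr, if_true, ih, ih₁, ih₂]
  | t_comm i a w E _ ih =>
    simp only [Expected] at ih ⊢
    rw [ih, shift_sym, tExp, add_zero]
  | tinv_comm i a w E _ ih =>
    simp only [Expected] at ih ⊢
    rw [ih, shift_sym, tExp, add_zero, neg_add, neg_neg]

theorem commutes_t (q : K) (i : Fin 4) : ∀ w,
    Commutes q (.t i) w (sym K (tExp i w) 0 (some (.t i)))
  | [] => .done _
  | a :: w => by
    have := Commutes.t_comm i a w _ (commutes_t q i w)
    rwa [shift_sym, add_zero] at this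

theorem commutes_tinv (q : K) (i : Fin 4) : ∀ w,
    Commutes q (.tinv i) w (sym K (-tExp i w) 0 (some (.tinv i)))
  | [] => by simpa [tExp] using Commutes.done (q := q) (.tinv i)
  | a :: w => by
    have := Commutes.tinv_comm i a w _ (commutes_tinv q i w)
    rwa [shift_sym, add_zero, ← neg_neg ((cartan i (node a) * dd i) • δ a), ← neg_add] at this

theorem commutes_e (q : K) (i : Fin 4) : ∀ w, Commutes q (.e i) w (eExpr q i w)
  | [] => .done _
  | a :: w => by
    by_cases h : node a = i
    · subst h
      simpa only [eExpr, if_true] using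
        Commutes.e_same a w _ _ _ (commutes_e q _ w) (commutes_t q _ w) (commutes_tinv q _ w)
    · simpa only [eExpr, if_neg h] using Commutes.e_comm i a w _ (Ne.symm h) (commutes_e q i w)

end

end QuantumF4

/-! ### Existence of the commutation results and the expression `rel(s y₄)` -/

namespace QuantumF4

noncomputable section

variable {K : Type u} [Field K]

theorem y4_eq : y4 = [0, 1, 2, 3, 4, 5, 6, 7, 8, 9, 10, 11, 12, 13, 14] := by decide +kernel

/-- The derivations are written out; the resulting expressions are found by unification. -/
theorem exists_commutes_f (q : K) (i : Fin 4) : ∃ E, Commutes q (fGen i) y4 E := by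
  rw [y4_eq]
  fin_cases i
  · exact ⟨_, .f_comm 0 0 _ _ rfl <| .f_comm 0 1 _ _ rfl <| .f_simple 0 1 2 3 _ _ rfl rfl rfl rfl <|
      .f_double 1 2 4 5 6 _ _ rfl rfl rfl rfl rfl <| .f_comm 1 7 _ _ rfl <|
      .swap _ [8, 9] [12, 13, 14] 11 10 _ rfl <| .f_double 1 2 8 9 11 _ _ rfl rfl rfl rfl rfl <|
      .f_simple 1 0 10 12 _ _ rfl rfl rfl rfl <| .f_comm 0 13 _ _ rfl <| .f_comm 0 14 _ _ rfl <|
      .done _⟩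
  · exact ⟨_, .f_comm 1 0 _ _ rfl <|
      .swap _ [1, 2] [5, 6, 7, 8, 9, 10, 11, 12, 13, 14] 4 3 _ rfl <|
      .f_double 1 2 1 2 4 _ _ rfl rfl rfl rfl rfl <| .f_simple 1 0 3 5 _ _ rfl rfl rfl rfl <|
      .f_comm 0 6 _ _ rfl <| .f_comm 0 7 _ _ rfl <| .f_comm 0 8 _ _ rfl <|
      .f_simple 0 1 9 10 _ _ rfl rfl rfl rfl <| .f_double 1 2 11 12 13 _ _ rfl rfl rfl rfl rfl <|
      .f_comm 1 14 _ _ rfl <| .done _⟩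
  -- The long relation needs `f_3` as its eleventh factor, so the second pair `f_1 f_3` is exchanged
  -- first. The leftover `f_4` passes `f_1` and `f_2` and becomes `f_3` at the final `f_3 f_4`.
  · exact ⟨_, .swap _ [0, 1, 2, 3, 4, 5, 6, 7, 8, 9] [12, 13, 14] 11 10 _ rfl <|
      .f_long 0 1 2 3 4 5 6 7 8 9 11 _ _ rfl <| .f_comm 3 10 _ _ rfl <| .f_comm 3 12 _ _ rfl <|
      .f_simple 3 2 13 14 _ _ rfl rfl rfl rfl <| .done _⟩
  · exact ⟨_, .f_same 0 _⟩

/-- The generator `f_m` of the subalgebra without `f_4`, where it exists. -/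
def toB3 (m : Fin 4) : Option (Gen nodesB3) := if h : m ≠ 3 then some (.f ⟨m, h⟩) else none

/-- The result of moving `f_i` through `y₄`. -/
def fdata (i : Fin 4) : FVal := (fval i y4).getD ([], none)

/-- The expression `rel(s y₄)`. -/
def relExpr (q : K) : Gen (Set.univ : Set (Fin 4)) → Expr K nodesB3
  | .e i => eExpr q i y4
  | .t i => sym K (tExp i y4) 0 (some (.t i))
  | .tinv i => sym K (-tExp i y4) 0 (some (.tinv i))
  | .f i => evalF q toB3 (fdata i)

section toFull

variable {S : Set (Fin 4)}

theorem toFull_add (E F : Expr K S) : (E + F).toFull = E.toFull + F.toFull :=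
  Finsupp.mapDomain_add

theorem toFull_smul (c : K) (E : Expr K S) : Expr.toFull (c • E) = c • E.toFull :=
  Finsupp.mapDomain_smul _ _

theorem toFull_sub (E F : Expr K S) : (E - F).toFull = E.toFull - F.toFull := by
  rw [sub_eq_add_neg, sub_eq_add_neg, toFull_add, ← neg_one_smul K F, toFull_smul, neg_one_smul]

theorem toFull_zero : (0 : Expr K S).toFull = 0 := Finsupp.mapDomain_zero

theorem toFull_sym (r α : Expo) (s : Option (Gen S)) :
    (sym K r α s).toFull = sym K r α (s.map Gen.toFull) := Finsupp.mapDomain_single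

theorem toFull_bracket (q : K) (d : ℤ) (r : Expo) (c : ℤ) (α : Expo) :
    (bracket q d r c α : Expr K S).toFull = bracket q d r c α := by
  simp only [bracket, toFull_smul, toFull_sub, toFull_sym, Option.map_none]

theorem toFull_eExpr (q : K) (i : Fin 4) (w : List (Fin 15)) :
    (eExpr q i w : Expr K S).toFull = eExpr q i w := by
  induction w with
  | nil => simp [eExpr, toFull_sym, Gen.toFull]
  | cons a w ih =>
    simp only [eExpr]
    split_ifs
    · simp only [shift_sym, toFull_add, toFull_sub, toFull_smul, toFull_sym, ih, Option.map_some,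
        Gen.toFull]
    · exact ih

theorem toFull_evalF (q : K) (v : FVal) (hv : ∀ p ∈ v.2, p.2 ≠ 3) :
    (evalF q toB3 v).toFull = evalF q (fun m => some (fGen m)) v := by
  obtain ⟨l, t⟩ := v
  simp only [evalF, toFull_add]
  congr 1
  · clear hv
    induction l with
    | nil => simp [toFull_zero]
    | cons b l ih => simp only [List.map_cons, List.sum_cons, toFull_add, toFull_bracket, ih]
  · cases t with
    | none => simp [toFull_zero]
    | some p => simp [toFull_sym, toB3, hv p rfl, Gen.toFull]

end toFull

/-- This is why `rel(s y₄)` can be formed with right-hand factors from the algebra without `f_4`. -/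
theorem fdata_tail : ∀ i, ∀ p ∈ (fdata i).2, p.2 ≠ 3 := by decide +kernel

theorem isRel_iff (q : K) (s : Gen (Set.univ : Set (Fin 4)))
    (E : Expr K (Set.univ : Set (Fin 4))) : IsRel q s E ↔ E = (relExpr q s).toFull := by
  -- It is enough to have one derivation and to know that every derivation ends in the expected
  -- expression: that one derivation then ends there too.
  suffices h : ∃ E', Commutes q s y4 E' ∧
      ∀ E, Commutes q s y4 E → E = (relExpr q s).toFull by
    obtain ⟨E', h₁, h₂⟩ := h
    refine ⟨h₂ E, ?_⟩
    rintro rfl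
    rw [← h₂ E' h₁]
    exact h₁
  cases s with
  | e i =>
    refine ⟨_, commutes_e q i y4, fun E h => ?_⟩
    rw [relExpr, toFull_eExpr]
    exact h.expected
  | t i =>
    refine ⟨_, commutes_t q i y4, fun E h => ?_⟩
    rw [relExpr, toFull_sym]
    exact h.expected
  | tinv i =>
    refine ⟨_, commutes_tinv q i y4, fun E h => ?_⟩
    rw [relExpr, toFull_sym]
    exact h.expected
  | f i =>
    obtain ⟨E', h⟩ := exists_commutes_f q i
    refine ⟨E', h, fun E h => ?_⟩
    obtain ⟨v, hv, rfl⟩ := h.expected y4_mem_words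
    rw [relExpr, toFull_evalF q _ (fdata_tail i), fdata, hv]
    rfl

end

end QuantumF4

namespace QuantumF4

noncomputable section

variable {K : Type u} [Field K]

/-! ### Relations between the generators -/

section relations

variable (q : K) {S : Set (Fin 4)}

theorem Uq.mk_rel {a b : FreeAlgebra K (Gen S)} (h : UqRel q S a b) :
    RingQuot.mkAlgHom K (UqRel q S) a = RingQuot.mkAlgHom K (UqRel q S) b :=
  RingQuot.mkAlgHom_rel K h

/-- The generator `t_i` as a unit. -/
def tU (S : Set (Fin 4)) (i : Fin 4) : (Uq q S)ˣ where
  val := gen q (.t i)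
  inv := gen q (.tinv i)
  val_inv := by
    have := Uq.mk_rel q (UqRel.t_tinv (S := S) (q := q) i)
    rw [map_mul, map_one] at this
    exact this
  inv_val := by
    have := Uq.mk_rel q (UqRel.tinv_t (S := S) (q := q) i)
    rw [map_mul, map_one] at this
    exact this

theorem tU_comm (i j : Fin 4) : Commute (tU q S i) (tU q S j) := by
  have := Uq.mk_rel q (UqRel.t_comm (S := S) (q := q) i j)
  rw [map_mul, map_mul] at this
  exact Units.ext this

theorem tU_e (i j : Fin 4) : (tU q S i : Uq q S) * gen q (.e j)
    = q ^ (dd i * cartan i j) • (gen q (.e j) * (tU q S i : Uq q S)) := by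
  have := Uq.mk_rel q (UqRel.t_e (S := S) (q := q) i j)
  rw [map_mul, map_mul, map_smul] at this
  have h2 : (tU q S i : Uq q S) * gen q (.e j) * (((tU q S i)⁻¹ : (Uq q S)ˣ) : Uq q S)
      = q ^ (dd i * cartan i j) • gen q (.e j) := this
  rw [Units.mul_inv_eq_iff_eq_mul, smul_mul_assoc] at h2
  exact h2

theorem tU_f (i : Fin 4) (j : S) : (tU q S i : Uq q S) * gen q (.f j)
    = q ^ (-(dd i * cartan i j)) • (gen q (.f j) * (tU q S i : Uq q S)) := by
  have := Uq.mk_rel q (UqRel.t_f (S := S) (q := q) i j)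
  rw [map_mul, map_mul, map_smul] at this
  have h2 : (tU q S i : Uq q S) * gen q (.f j) * (((tU q S i)⁻¹ : (Uq q S)ˣ) : Uq q S)
      = q ^ (-(dd i * cartan i j)) • gen q (.f j) := this
  rw [Units.mul_inv_eq_iff_eq_mul, smul_mul_assoc] at h2
  exact h2

theorem e_f_comm_ne (i : Fin 4) (j : S) (h : i ≠ j) :
    gen q (.e i) * gen q (.f j) - gen q (.f j) * gen q (.e i) = (0 : Uq q S) := by
  have := Uq.mk_rel q (UqRel.e_f_ne (q := q) i j h)
  rw [map_sub, map_mul, map_mul, map_zero] at this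
  exact this

theorem e_f_comm_self (i : S) :
    gen q (.e (i : Fin 4)) * gen q (.f i) - gen q (.f i) * gen q (.e (i : Fin 4))
      = ((q ^ dd i - q ^ (-dd i))⁻¹ • (gen q (.t (i : Fin 4)) - gen q (.tinv (i : Fin 4)))
          : Uq q S) := by
  have := Uq.mk_rel q (UqRel.e_f (q := q) i)
  rw [map_sub, map_mul, map_mul, map_smul, map_sub] at this
  exact this

theorem map_serre {A B : Type*} [Ring A] [Algebra K A] [Ring B] [Algebra K B] (φ : A →ₐ[K] B)
    (i j : Fin 4) (a b : A) : φ (serre q i j a b) = serre q i j (φ a) (φ b) := by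
  simp [serre]

theorem serre_gen_e (i j : Fin 4) (h : i ≠ j) :
    serre q i j (gen q (.e i)) (gen q (.e j)) = (0 : Uq q S) := by
  have := Uq.mk_rel q (UqRel.serre_e (S := S) (q := q) i j h)
  rw [map_serre, map_zero] at this
  exact this

theorem serre_gen_f (i j : S) (h : i ≠ j) :
    serre q i j (gen q (.f i)) (gen q (.f j)) = (0 : Uq q S) := by
  have := Uq.mk_rel q (UqRel.serre_f (q := q) i j h)
  rw [map_serre, map_zero] at this
  exact this

end relations

/-! ### Monomials in the tensor product -/

section monomials

variable (q : K)

theorem weyl_x_z : (Weyl.x q : Weyl q) * Weyl.z q = q • ((Weyl.z q : Weyl q) * Weyl.x q) := by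
  have := Weyl.mk_rel q WeylRel.x_z
  rw [map_mul, map_smul, map_mul] at this
  exact this

/-- Powers of two units which commute up to a scalar. -/
theorem units_zpow_comm {A : Type*} [Ring A] [Algebra K A] {c : K} (hc : c ≠ 0) {x z : Aˣ}
    (h : (x : A) * z = c • ((z : A) * x)) (a b : ℤ) :
    ((x ^ a : Aˣ) : A) * ((z ^ b : Aˣ) : A)
      = c ^ (a * b) • (((z ^ b : Aˣ) : A) * ((x ^ a : Aˣ) : A)) := by
  -- The scalar becomes a central unit, so that the computation takes place in the group of units.
  -- There a conjugation relation can be raised to an arbitrary integral power.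
  set C : Aˣ := Units.map (algebraMap K A).toMonoidHom (Units.mk0 c hc) with hC
  have hcomm : ∀ u : Aˣ, Commute C u := fun u => Units.ext (Algebra.commutes c (u : A))
  have hval : ∀ n : ℤ, ((C ^ n : Aˣ) : A) = algebraMap K A (c ^ n) := fun n => by
    rw [hC, ← map_zpow, Units.coe_map]
    simp
  have h' : x * z = C * (z * x) := Units.ext (by
    have := hval 1
    rw [zpow_one, zpow_one] at this
    rw [Units.val_mul, Units.val_mul, Units.val_mul, this, h, Algebra.smul_def])
  have h1 : ∀ b : ℤ, x * z ^ b = C ^ b * (z ^ b * x) := fun b => by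
    have e : x * z * x⁻¹ = C * z := by rw [h']; group
    have := congrArg (· ^ b) e
    rw [conj_zpow, (hcomm z).mul_zpow] at this
    rw [← mul_assoc, ← this]; group
  have h2 : x ^ a * z ^ b = C ^ (a * b) * (z ^ b * x ^ a) := by
    have e : (z ^ b)⁻¹ * x * z ^ b = C ^ b * x := by
      rw [mul_assoc, h1, ← mul_assoc, ← ((hcomm (z ^ b)⁻¹).zpow_left b).eq]; group
    have := congrArg (· ^ a) e
    rw [((hcomm x).zpow_left b).mul_zpow, ← zpow_mul, mul_comm b a] at this
    have e2 : ((z ^ b)⁻¹ * x * z ^ b) ^ a = (z ^ b)⁻¹ * x ^ a * z ^ b := by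
      have := conj_zpow (i := a) (a := (z ^ b)⁻¹) (b := x)
      rwa [inv_inv] at this
    rw [e2] at this
    calc x ^ a * z ^ b = z ^ b * ((z ^ b)⁻¹ * x ^ a * z ^ b) := by group
      _ = C ^ (a * b) * (z ^ b * x ^ a) := by
        rw [this, ← mul_assoc, ← ((hcomm (z ^ b)).zpow_left (a * b)).eq, mul_assoc]
  have := congrArg (fun u : Aˣ => (u : A)) h2
  simp only [Units.val_mul] at this
  rw [this, hval, Algebra.smul_def]

/-- The monomial `x^a z^(-r)`. -/
def wmon (a r : ℤ) : Weyl q := ((Weyl.x q ^ a * Weyl.z q ^ (-r) : (Weyl q)ˣ) : Weyl q)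

variable {q} in
-- The only reordering moves `z^{-r}` past `x^b`, and `x z = q z x` turns this into the factor `q^{r
-- b}`.
theorem wmon_mul (hq : q ≠ 0) (a r b s : ℤ) :
    wmon q a r * wmon q b s = q ^ (r * b) • wmon q (a + b) (r + s) := by
  have h := units_zpow_comm hq (weyl_x_z q) b (-r)
  have h' : ((Weyl.z q ^ (-r) : (Weyl q)ˣ) : Weyl q) * ((Weyl.x q ^ b : (Weyl q)ˣ) : Weyl q)
      = q ^ (r * b) • (((Weyl.x q ^ b : (Weyl q)ˣ) : Weyl q)
        * ((Weyl.z q ^ (-r) : (Weyl q)ˣ) : Weyl q)) := by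
    rw [h, smul_smul, ← zpow_add₀ hq, show r * b + b * -r = 0 by ring, zpow_zero, one_smul]
  simp only [wmon, Units.val_mul]
  rw [mul_assoc, ← mul_assoc _ ((Weyl.x q ^ b : (Weyl q)ˣ) : Weyl q), h', zpow_add,
    neg_add, zpow_add]
  simp only [Units.val_mul, smul_mul_assoc, mul_smul_comm, mul_assoc]

/-- The monomial `∏ x_k^{α_k} z_k^{-r_k}`. -/
def xmon (α r : Expo) : Weyl15 q := PiTensorProduct.tprod K fun k => wmon q (α k) (r k)

variable {q} in
theorem xmon_mul (hq : q ≠ 0) (α r β s : Expo) :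
    xmon q α r * xmon q β s = q ^ (∑ k, r k * β k) • xmon q (α + β) (r + s) := by
  simp only [xmon, PiTensorProduct.tprod_mul_tprod]
  have : (fun k => wmon q (α k) (r k)) * (fun k => wmon q (β k) (s k))
      = fun k => q ^ (r k * β k) • wmon q ((α + β) k) ((r + s) k) :=
    funext fun k => wmon_mul hq _ _ _ _
  rw [this, MultilinearMap.map_smul_univ]
  congr 1
  have key : ∀ (f : Fin 15 → ℤ) (s : Finset (Fin 15)), ∏ k ∈ s, q ^ f k = q ^ ∑ k ∈ s, f k := by
    intro f s
    induction s using Finset.induction_on with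
    | empty => simp
    | insert a s h ih => rw [Finset.prod_insert h, Finset.sum_insert h, zpow_add₀ hq, ih]
  exact key _ _

theorem xmon_zero : xmon q 0 0 = 1 := by
  simp only [xmon, wmon, Pi.zero_apply, neg_zero, zpow_zero, mul_one, Units.val_one]
  rfl

variable (S : Set (Fin 4))

/-- The homomorphism `τ ↦ ∏ t_i^{τ_i}`. -/
def tHom : (Fin 4 → Multiplicative ℤ) →* (Uq q S)ˣ :=
  MonoidHom.noncommPiCoprod (fun i => zpowersHom (Uq q S)ˣ (tU q S i)) fun i j _ x y => by
    simp only [zpowersHom_apply]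
    exact ((tU_comm q i j).zpow_left _).zpow_right _

/-- The monomial `∏ t_i^{τ_i}`. -/
def tmon (τ : Fin 4 → ℤ) : Uq q S := (tHom q S fun i => Multiplicative.ofAdd (τ i) : (Uq q S)ˣ)

theorem tmon_add (τ σ : Fin 4 → ℤ) : tmon q S (τ + σ) = tmon q S τ * tmon q S σ := by
  simp only [tmon, ← Units.val_mul, ← map_mul]
  rfl

theorem tmon_single (i : Fin 4) (n : ℤ) :
    tmon q S (Pi.single i n) = ((tU q S i ^ n : (Uq q S)ˣ) : Uq q S) := by
  have : (fun k => Multiplicative.ofAdd ((Pi.single i n : Fin 4 → ℤ) k))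
      = Pi.mulSingle i (Multiplicative.ofAdd n) := by
    funext k
    by_cases h : k = i
    · subst h; simp
    · simp [h]
  rw [tmon, this]
  exact congrArg Units.val
    ((MonoidHom.noncommPiCoprod_mulSingle _ _ _).trans (zpowersHom_apply _ _ _))

theorem tmon_zero : tmon q S 0 = 1 := by
  have : (fun k => Multiplicative.ofAdd ((0 : Fin 4 → ℤ) k)) = 1 := rfl
  rw [tmon, this, map_one, Units.val_one]

variable {q S} in
-- Passing from single `t_i` to torus monomials: first natural powers, then inverses, then products
-- over the nodes.
theorem tmon_mul_of_weight (hq : q ≠ 0) {y : Uq q S} {wt : Fin 4 → ℤ}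
    (h : ∀ i, (tU q S i : Uq q S) * y = q ^ wt i • (y * (tU q S i : Uq q S))) (τ : Fin 4 → ℤ) :
    tmon q S τ * y = q ^ (∑ i, τ i * wt i) • (y * tmon q S τ) := by
  have hnat : ∀ i (n : ℕ), ((tU q S i ^ n : (Uq q S)ˣ) : Uq q S) * y
      = q ^ ((n : ℤ) * wt i) • (y * ((tU q S i ^ n : (Uq q S)ˣ) : Uq q S)) := by
    intro i n
    induction n with
    | zero => simp
    | succ n ih =>
      rw [pow_succ', Units.val_mul, mul_assoc, ih, mul_smul_comm, ← mul_assoc, h,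
        smul_mul_assoc, smul_smul, ← zpow_add₀ hq, mul_assoc]
      congr 2
      push_cast
      ring
  have hint : ∀ i (n : ℤ), ((tU q S i ^ n : (Uq q S)ˣ) : Uq q S) * y
      = q ^ (n * wt i) • (y * ((tU q S i ^ n : (Uq q S)ˣ) : Uq q S)) := by
    intro i n
    obtain ⟨n, rfl | rfl⟩ := n.eq_nat_or_neg
    · simpa using hnat i n
    · rw [zpow_neg, zpow_natCast, Units.inv_mul_eq_iff_eq_mul, mul_smul_comm, ← mul_assoc, hnat,
        smul_mul_assoc, smul_smul, ← zpow_add₀ hq, Units.mul_inv_cancel_right]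
      rw [show -(n : ℤ) * wt i + n * wt i = 0 by ring, zpow_zero, one_smul]
  have hfin : ∀ s : Finset (Fin 4), tmon q S (∑ i ∈ s, Pi.single i (τ i)) * y
      = q ^ (∑ i ∈ s, τ i * wt i) • (y * tmon q S (∑ i ∈ s, Pi.single i (τ i))) := by
    intro s
    induction s using Finset.induction_on with
    | empty => simp [tmon_zero]
    | insert a s ha ih =>
      rw [Finset.sum_insert ha, Finset.sum_insert ha, tmon_add, mul_assoc, ih, mul_smul_comm,
        ← mul_assoc, tmon_single, hint, smul_mul_assoc, smul_smul, mul_assoc, ← zpow_add₀ hq,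
        add_comm]
  have := hfin Finset.univ
  rwa [Finset.univ_sum_single] at this

/-- A letter `e_i` (`true`) or `f_i` (`false`), the letter `f_4` being sent to zero. -/
def letter (l : Bool × Fin 4) : Uq q nodesB3 :=
  if l.1 then gen q (.e l.2) else (toB3 l.2).elim 0 (gen q)

/-- The weight of a letter. -/
def letterWt (l : Bool × Fin 4) (i : Fin 4) : ℤ :=
  if l.1 then dd i * cartan i l.2 else -(dd i * cartan i l.2)

theorem tU_letter (l : Bool × Fin 4) (i : Fin 4) : (tU q nodesB3 i : Uq q nodesB3) * letter q l
    = q ^ letterWt l i • (letter q l * (tU q nodesB3 i : Uq q nodesB3)) := by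
  obtain ⟨b, j⟩ := l
  cases b
  · by_cases h : j = 3
    · subst h; simp [letter, toB3]
    · have h' : toB3 j = some (.f ⟨j, h⟩) := dif_pos h
      simpa [letter, letterWt, h'] using tU_f q i (⟨j, h⟩ : nodesB3)
  · simpa [letter, letterWt] using tU_e q (S := nodesB3) i j

end monomials

end

end QuantumF4

namespace QuantumF4

noncomputable section

variable {K : Type u} [Field K]

/-! ### Computing with linear combinations of monomials -/

/-- The monomial `q^e ∏ x_k^{a_k} z_k^{-r_k} ⊗ w ∏ t_i^{t_i}`. -/
structure Mon where
  /-- The exponent of `q`. -/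
  e : ℤ
  /-- The exponents of the `x_k`. -/
  a : List ℤ
  /-- The negatives of the exponents of the `z_k`. -/
  r : List ℤ
  /-- The exponents of the `t_i`. -/
  t : List ℤ
  /-- A word in the `e_i` and `f_i`. -/
  w : List (Bool × Fin 4)
deriving DecidableEq

/-- The entries of a list as a vector of length four. -/
def vec4 (l : List ℤ) : Fin 4 → ℤ := fun i => l.getD i 0

theorem vec4_addL (l m : List ℤ) : vec4 (addL l m) = vec4 l + vec4 m :=
  funext fun k => getD_addL l m k

/-- The product of the letters of a word. -/
def wordVal (q : K) (w : List (Bool × Fin 4)) : Uq q nodesB3 := (w.map (letter q)).prod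

/-- The weight of a word. -/
def wordWt : List (Bool × Fin 4) → List ℤ
  | [] => []
  | l :: w => addL ((List.finRange 4).map (letterWt l)) (wordWt w)

/-- The element given by a monomial. -/
def Mon.eval (q : K) (m : Mon) : Weyl15 q ⊗[K] Uq q nodesB3 :=
  q ^ m.e • (xmon q (vec m.a) (vec m.r) ⊗ₜ[K] (wordVal q m.w * tmon q nodesB3 (vec4 m.t)))

/-- The inner product of the first `n` entries of two lists. -/
def dot : ℕ → List ℤ → List ℤ → ℤ
  | n + 1, a :: l, b :: m => a * b + dot n l m
  | _, _, _ => 0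

/-- The product of two monomials. -/
def Mon.mul (m n : Mon) : Mon where
  e := m.e + n.e + (dot 15 m.r n.a + dot 4 m.t (wordWt n.w))
  a := addL m.a n.a
  r := addL m.r n.r
  t := addL m.t n.t
  w := m.w ++ n.w

theorem dot_eq : ∀ (n : ℕ) (l m : List ℤ),
    dot n l m = ∑ k : Fin n, l.getD k 0 * m.getD k 0
  | 0, l, m => by simp [dot]
  | n + 1, [], m => by simp [dot]
  | n + 1, a :: l, [] => by simp [dot]
  | n + 1, a :: l, b :: m => by
    rw [dot, dot_eq n l m, Fin.sum_univ_succ]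
    simp

theorem tU_wordVal {q : K} (hq : q ≠ 0) (i : Fin 4) : ∀ w : List (Bool × Fin 4),
    (tU q nodesB3 i : Uq q nodesB3) * wordVal q w
      = q ^ vec4 (wordWt w) i • (wordVal q w * (tU q nodesB3 i : Uq q nodesB3))
  | [] => by simp [wordVal, vec4, wordWt]
  | l :: w => by
    have h : vec4 (wordWt (l :: w)) i = letterWt l i + vec4 (wordWt w) i := by
      rw [wordWt, vec4_addL, Pi.add_apply]
      congr 1
      simp [vec4, List.getD_eq_getElem?_getD]
    rw [h]
    simp only [wordVal, List.map_cons, List.prod_cons]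
    rw [← mul_assoc, tU_letter, smul_mul_assoc, mul_assoc]
    have := tU_wordVal hq i w
    rw [wordVal] at this
    rw [this, mul_smul_comm, smul_smul, zpow_add₀ hq, mul_assoc]

/-- Normal ordering of a product has two sources of powers of `q`: the `z`-part of `m` passes the
`x`-part of `n`, and the `t`-part of `m` passes the word of `n`. Words are only concatenated; no
relation between their letters is used. -/
theorem Mon.eval_mul {q : K} (hq : q ≠ 0) (m n : Mon) :
    (m.mul n).eval q = m.eval q * n.eval q := by
  simp only [Mon.eval, Mon.mul]
  rw [smul_mul_smul_comm, Algebra.TensorProduct.tmul_mul_tmul, xmon_mul hq, mul_assoc,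
    ← mul_assoc (tmon q nodesB3 _), tmon_mul_of_weight hq (fun i => tU_wordVal hq i n.w),
    vec_addL, vec_addL, vec4_addL, tmon_add, wordVal, List.map_append, List.prod_append,
    ← wordVal, ← wordVal]
  simp only [smul_mul_assoc, mul_smul_comm, TensorProduct.tmul_smul, TensorProduct.smul_tmul',
    smul_smul, mul_assoc]
  congr 1
  rw [zpow_add₀ hq, zpow_add₀ hq, zpow_add₀ hq, dot_eq, dot_eq]
  simp only [vec, vec4]
  ring_nf

/-- Linear combinations of monomials with integral coefficients. -/
abbrev Poly : Type := List (ℤ × Mon)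

/-- The element given by a linear combination of monomials. -/
def evalP (q : K) (p : Poly) : Weyl15 q ⊗[K] Uq q nodesB3 :=
  (p.map fun m => (m.1 : K) • m.2.eval q).sum

theorem evalP_cons (q : K) (x : ℤ × Mon) (l : Poly) :
    evalP q (x :: l) = (x.1 : K) • x.2.eval q + evalP q l := rfl

theorem evalP_append (q : K) (l m : Poly) : evalP q (l ++ m) = evalP q l + evalP q m := by
  simp [evalP]

/-- Multiplication by a scalar `c q ^ d`. -/
def scale (c d : ℤ) (p : Poly) : Poly := p.map fun n => (c * n.1, { n.2 with e := d + n.2.e })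

theorem evalP_scale {q : K} (hq : q ≠ 0) (c d : ℤ) (p : Poly) :
    evalP q (scale c d p) = ((c : K) * q ^ d) • evalP q p := by
  induction p with
  | nil => simp [scale, evalP]
  | cons n p ih =>
    rw [scale, List.map_cons, evalP_cons, ← scale, ih, evalP_cons, smul_add]
    simp only [Mon.eval, zpow_add₀ hq, Int.cast_mul, smul_smul]
    congr 2
    ring

/-- All monomials of `a` and `b` satisfy `m n = q ^ d n m`. -/
def qcommute (d : ℤ) (a b : Poly) : Bool :=
  a.all fun m => b.all fun n => m.2.mul n.2 = { n.2.mul m.2 with e := d + (n.2.mul m.2).e }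

/-- Used for products with the parts `T`, whose monomials contain a letter and are therefore outside
the scope of the packed computation. -/
theorem evalP_qcommute {q : K} (hq : q ≠ 0) {d : ℤ} {a b : Poly} (h : qcommute d a b = true) :
    evalP q a * evalP q b = q ^ d • (evalP q b * evalP q a) := by
  have hm : ∀ m ∈ a, ∀ n ∈ b, m.2.eval q * n.2.eval q = q ^ d • (n.2.eval q * m.2.eval q) := by
    intro m hm n hn
    have := of_decide_eq_true (List.all_eq_true.mp (List.all_eq_true.mp h m hm) n hn)
    rw [← Mon.eval_mul hq, ← Mon.eval_mul hq, this]
    simp only [Mon.eval, zpow_add₀ hq, smul_smul]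
  clear h
  induction a with
  | nil => simp [evalP]
  | cons m a ih =>
    rw [evalP_cons, add_mul, mul_add, smul_add,
      ih fun m' h => hm m' (List.mem_cons_of_mem _ h)]
    congr 1
    have hm' := hm m List.mem_cons_self
    clear hm ih
    induction b with
    | nil => simp [evalP]
    | cons n b ih =>
      rw [evalP_cons, add_mul, mul_add, smul_add, ih fun n' h => hm' n' (List.mem_cons_of_mem _ h),
        smul_mul_smul_comm, smul_mul_smul_comm, hm' n List.mem_cons_self, smul_comm, mul_comm]

end

end QuantumF4

namespace QuantumF4

noncomputable section

variable {K : Type u} [Field K]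

/-! ### The Serre relations -/

section serre

variable {A : Type*} [Ring A] [Algebra K A]

theorem serre_of_zero (q : K) {i j : Fin 4} (h : cartan i j = 0) (a b : A) :
    serre q i j a b = a * b - b * a := by
  simp [serre, h, Finset.sum_range_succ, qBinom, sub_eq_add_neg]

theorem serre_of_neg_one (q : K) {i j : Fin 4} (h : cartan i j = -1) (a b : A) :
    serre q i j a b = a * (a * b) - (q ^ dd i + (q ^ dd i)⁻¹) • (a * (b * a)) + b * (a * a) := by
  simp [serre, h, Finset.sum_range_succ, qBinom, pow_two, mul_assoc]
  module

theorem dd_of_neg_two : ∀ i j, cartan i j = -2 → dd i = 1 := by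
  intro i j
  fin_cases i <;> fin_cases j <;> simp [cartan, dd]

theorem serre_of_neg_two {q : K} (hq : q ≠ 0) {i j : Fin 4} (h : cartan i j = -2) (a b : A) :
    serre q i j a b = a * (a * (a * b)) - (q ^ 2 + 1 + (q⁻¹) ^ 2) • (a * (a * (b * a)))
      + (q ^ 2 + 1 + (q⁻¹) ^ 2) • (a * (b * (a * a))) - b * (a * (a * a)) := by
  have h3 : (1 - (-2 : ℤ)).toNat = 3 := rfl
  have e1 : qBinom q 3 1 = q ^ 2 + 1 + (q⁻¹) ^ 2 := by
    simp [qBinom, zpow_neg]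
    field_simp
  have e2 : qBinom q 3 2 = q ^ 2 + 1 + (q⁻¹) ^ 2 := by
    simp [qBinom, zpow_neg]
    field_simp
    ring
  have e0 : qBinom q 3 0 = 1 := by simp [qBinom]
  have e3 : qBinom q 3 3 = 1 := by simp [qBinom]
  simp only [serre, h, dd_of_neg_two i j h, zpow_one, h3, Finset.sum_range_succ,
    Finset.sum_range_zero, e0, e1, e2, e3]
  simp only [pow_succ, pow_zero, mul_one, one_mul, mul_assoc, zero_add, one_smul,
    Nat.reduceSub, neg_mul, neg_neg, neg_smul]
  module

theorem cartan_cases (i j : Fin 4) (h : i ≠ j) :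
    cartan i j = 0 ∨ cartan i j = -1 ∨ cartan i j = -2 := by
  fin_cases i <;> fin_cases j <;> simp [cartan] at h ⊢

/-- The Serre expressions of two pairs of elements with suitable `q`-commutation relations add
up. -/
theorem serre_add {q : K} (hq : q ≠ 0) {i j : Fin 4} (h : i ≠ j) {a b a' b' : A}
    (haa : a * a' = q ^ (dd i * 2) • (a' * a)) (hab : a * b' = q ^ (dd i * cartan i j) • (b' * a))
    (hba : b * a' = q ^ (dd i * cartan i j) • (a' * b)) :
    serre q i j (a + a') (b + b') = serre q i j a b + serre q i j a' b' := by
  -- In this form the relations move all primed factors to the left inside right-associated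
  -- products. After that the coefficient of each mixed word is a Laurent polynomial in `q` that
  -- vanishes identically.
  have haa' : ∀ x, a * (a' * x) = q ^ (dd i * 2) • (a' * (a * x)) := fun x => by
    rw [← mul_assoc, haa, smul_mul_assoc, mul_assoc]
  have hab' : ∀ x, a * (b' * x) = q ^ (dd i * cartan i j) • (b' * (a * x)) := fun x => by
    rw [← mul_assoc, hab, smul_mul_assoc, mul_assoc]
  have hba' : ∀ x, b * (a' * x) = q ^ (dd i * cartan i j) • (a' * (b * x)) := fun x => by
    rw [← mul_assoc, hba, smul_mul_assoc, mul_assoc]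
  rcases cartan_cases i j h with h | h | h
  · rw [h] at hab hba
    simp only [serre_of_zero q h, mul_add, add_mul, hab, hba, mul_zero, zpow_zero, one_smul]
    abel
  · have hp : q ^ dd i ≠ 0 := zpow_ne_zero _ hq
    have e1 : q ^ (dd i * 2) = (q ^ dd i) ^ 2 := by rw [zpow_mul]; norm_cast
    have e2 : q ^ (dd i * -1) = (q ^ dd i)⁻¹ := by rw [zpow_mul, zpow_neg_one]
    rw [h, e2] at hab hba hab' hba'
    rw [e1] at haa haa'
    simp only [serre_of_neg_one q h]
    generalize q ^ dd i = p at *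
    simp only [mul_add, add_mul, haa, hab, hba, haa', hab', hba', mul_smul_comm, smul_add,
      smul_smul]
    match_scalars <;> field_simp <;> ring
  · have hd := dd_of_neg_two i j h
    have e1 : q ^ (dd i * 2) = q ^ 2 := by rw [hd]; norm_cast
    have e2 : q ^ (dd i * -2) = (q⁻¹) ^ 2 := by
      rw [hd, one_mul, zpow_neg, inv_pow]; norm_cast
    rw [h, e2] at hab hba hab' hba'
    rw [e1] at haa haa'
    simp only [serre_of_neg_two hq h]
    simp only [mul_add, add_mul, haa, hab, hba, haa', hab', hba', mul_smul_comm, smul_add,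
      smul_smul]
    match_scalars <;> field_simp <;> ring

theorem serre_smul (q : K) (i j : Fin 4) (c c' : K) (a b : A) :
    serre q i j (c • a) (c' • b) = (c ^ (1 - cartan i j).toNat * c') • serre q i j a b := by
  rw [serre, serre, Finset.smul_sum]
  refine Finset.sum_congr rfl fun v hv => ?_
  have hv' : v ≤ (1 - cartan i j).toNat := Nat.lt_succ_iff.mp (Finset.mem_range.mp hv)
  rw [smul_pow, smul_pow, smul_mul_smul_comm, smul_mul_smul_comm, smul_smul, smul_smul]
  congr 1
  rw [← Nat.sub_add_cancel hv', pow_add, Nat.add_sub_cancel]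
  ring

/-- All terms of the Serre expression have the same left tensor factor, because `m'` commutes with
the powers of `m`. -/
theorem serre_mul_of_commute {B : Type*} [Ring B] [Algebra K B] (q : K) (i j : Fin 4) {m m' : A}
    (h : Commute m m') (a b : B) :
    serre q i j (m ⊗ₜ[K] a) (m' ⊗ₜ[K] b)
      = (m ^ (1 - cartan i j).toNat * m') ⊗ₜ[K] serre q i j a b := by
  rw [serre, serre, TensorProduct.tmul_sum]
  refine Finset.sum_congr rfl fun v hv => ?_
  have hv' : v ≤ (1 - cartan i j).toNat := Nat.lt_succ_iff.mp (Finset.mem_range.mp hv)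
  rw [Algebra.TensorProduct.tmul_pow, Algebra.TensorProduct.tmul_pow,
    Algebra.TensorProduct.tmul_mul_tmul, Algebra.TensorProduct.tmul_mul_tmul,
    TensorProduct.tmul_smul]
  congr 2
  rw [mul_assoc, ← (h.pow_left v).eq, ← mul_assoc, ← pow_add, Nat.sub_add_cancel hv']

/-- The exponents in the description of Serre expressions as iterated `q`-commutators. -/
def serreExps (i j : Fin 4) : List ℤ :=
  if cartan i j = 0 then [0] else if cartan i j = -1 then [dd i, -dd i] else [-2, 0, 2]

/-- Left and right multiplication by `a` commute, and the Serre polynomial in these two operators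
factors by the `q`-binomial theorem. In this form terms cancel after each commutator, before the
next product is formed. -/
theorem serre_eq_foldr {q : K} (hq : q ≠ 0) {i j : Fin 4} (h : i ≠ j) (a b : A) :
    serre q i j a b
      = (serreExps i j).foldr (fun c x => a * x - q ^ c • (x * a)) b := by
  rcases cartan_cases i j h with h | h | h
  · simp [serre_of_zero q h, serreExps, h]
  · simp only [serre_of_neg_one q h, serreExps, h, if_true, List.foldr_cons, List.foldr_nil,
      zpow_neg, if_neg (show ¬ (-1 : ℤ) = 0 by norm_num)]
    have hp : q ^ dd i ≠ 0 := zpow_ne_zero _ hq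
    generalize q ^ dd i = p at *
    simp only [mul_sub, sub_mul, mul_smul_comm, smul_mul_assoc, smul_sub, smul_smul, mul_assoc]
    match_scalars <;> field_simp <;> ring
  · simp only [serre_of_neg_two hq h, serreExps, h, List.foldr_cons, List.foldr_nil,
      if_neg (show ¬ (-2 : ℤ) = 0 by norm_num), if_neg (show ¬ (-2 : ℤ) = -1 by norm_num),
      zpow_neg, zpow_zero, one_smul, inv_pow]
    simp only [show q ^ (2 : ℤ) = q ^ 2 by norm_cast]
    simp only [mul_sub, sub_mul, mul_smul_comm, smul_mul_assoc, smul_sub, smul_smul, mul_assoc]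
    match_scalars <;> field_simp <;> ring

end serre

end

end QuantumF4

namespace QuantumF4

noncomputable section

/-! ### Fast computation of iterated `q`-commutators

Sums of monomials `X_v`, where `v` runs through an abelian group and `X_v X_w` is a power of `q`
times `X_{v + w}`, are represented by lists. The index `v` is encoded by a natural number, whose
digits in base `65536` are the values of a list of additive functions at `v`, shifted by a constant.
The functions in continuation passing style evaluate their arguments eagerly. -/

/-- A term `c q^e X_v`, where `v` is encoded by `k`. -/
structure Term where
  /-- The encoded index. -/
  k : ℕ
  /-- The exponent of `q`, up to an offset. -/
  e : ℕ
  /-- The coefficient. -/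
  c : ℤ

/-- A term together with the positions of the digits which describe its commutation with other
terms. -/
structure Letter extends Term where
  /-- The position for the commutation from the left. -/
  sl : ℕ
  /-- The position for the commutation from the right. -/
  sr : ℕ

/-- Call by value. -/
def forceN (n : ℕ) (f : ℕ → Bool) : Bool :=
  match n with
  | 0 => f 0
  | n + 1 => f (n + 1)

/-- Call by value. -/
def forceZ (z : ℤ) (f : ℤ → Bool) : Bool :=
  match z with
  | .ofNat n => forceN n fun n => f (.ofNat n)
  | .negSucc n => forceN n fun n => f (.negSucc n)

/-- The exponent of `q` in a product. -/
def expo (e d k s : ℕ) : ℕ :=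
  Nat.add (Nat.add e d) (Nat.mod (Nat.shiftRight k s) 65536)

/-- The two parts of the `q`-commutator of a letter and a sum of terms. -/
def stepK (g : Letter) (d : ℕ) : List Term → (List Term → List Term → Bool) → Bool
  | [], f => f [] []
  | t :: ts, f =>
    forceN (expo (Nat.add t.e g.e) 40 t.k g.sl) fun e₁ =>
    forceN (expo (Nat.add t.e g.e) d t.k g.sr) fun e₂ =>
    bif Nat.beq e₁ e₂ then stepK g d ts f else
      forceN (Nat.add t.k g.k) fun k =>
      forceZ (Int.mul g.c t.c) fun c₁ => forceZ (Int.neg c₁) fun c₂ =>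
        stepK g d ts fun l r => f (⟨k, e₁, c₁⟩ :: l) (⟨k, e₂, c₂⟩ :: r)

/-- The sum of two sums of terms. -/
def mergeK : List Term → List Term → (List Term → Bool) → Bool
  | [], m, f => f m
  | x :: xs, m, f => go x xs (mergeK xs) m f
where
  /-- The recursion on the second argument. -/
  go (x : Term) (xs : List Term) (h : List Term → (List Term → Bool) → Bool) :
      List Term → (List Term → Bool) → Bool
    | [], f => f (x :: xs)
    | y :: ys, f =>
      bif Nat.beq x.k y.k then
        bif Nat.beq x.e y.e then
          forceZ (Int.add x.c y.c) fun c =>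
            bif decide (c = 0) then h ys f else h ys fun l => f (⟨x.k, x.e, c⟩ :: l)
        else bif Nat.ble x.e y.e then h (y :: ys) fun l => f (x :: l)
        else go x xs h ys fun l => f (y :: l)
      else bif Nat.ble x.k y.k then h (y :: ys) fun l => f (x :: l)
      else go x xs h ys fun l => f (y :: l)

/-- The `q`-commutator of two sums of terms. -/
def comK (d : ℕ) (b : List Term) : List Letter → (List Term → Bool) → Bool
  | [], f => f []
  | g :: a, f => stepK g d b fun l r => mergeK l r fun s => comK d b a fun t => mergeK s t f

/-- Iterated `q`-commutators. -/
def iterK (a : List Letter) : List ℕ → List Term → (List Term → Bool) → Bool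
  | [], b, f => f b
  | d :: ds, b, f => comK d b a fun b => iterK a ds b f

theorem forceN_eq (n : ℕ) (f : ℕ → Bool) : forceN n f = f n := by
  cases n <;> rfl

theorem forceZ_eq (z : ℤ) (f : ℤ → Bool) : forceZ z f = f z := by
  cases z <;> simp [forceZ, forceN_eq]

theorem ofDigits_div_pow_mod {B : ℕ} : ∀ (l : List ℕ), (∀ d ∈ l, d < B) → ∀ i : ℕ,
    Nat.ofDigits B l / B ^ i % B = l.getD i 0
  | [], _, i => by simp [Nat.ofDigits_nil]
  | d :: l, h, 0 => by
    simp [Nat.ofDigits_cons, Nat.mod_eq_of_lt (h d List.mem_cons_self)]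
  | d :: l, h, i + 1 => by
    have hd := h d List.mem_cons_self
    rw [Nat.ofDigits_cons, pow_succ', ← Nat.div_div_eq_div_mul, Nat.add_mul_div_left _ _ (by omega),
      show ((d : ℕ) / B) = 0 from Nat.div_eq_of_lt hd, zero_add,
      ofDigits_div_pow_mod l (fun d' h' => h d' (List.mem_cons_of_mem _ h')) i]
    simp

section sound

variable {V : Type*} [AddCommGroup V] (Φ : List (V →+ ℤ))

/-- The number `k` encodes `v`. -/
def Encodes (N k : ℕ) (v : V) : Prop :=
  k = Nat.ofDigits 65536 (Φ.map fun φ => (φ v + (N : ℤ)).toNat) ∧ ∀ φ ∈ Φ, -(N : ℤ) ≤ φ v ∧ φ v ≤ N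

variable {Φ}

/-- The shift by `N` makes each digit nonnegative and at most `2N`, hence below the base, so a bit
shift by `16 i` and a remainder recover the value. -/
theorem Encodes.digit {N k : ℕ} {v : V} (h : Encodes Φ N k v) (hN : 2 * N < 65536) {i : ℕ}
    {φ : V →+ ℤ} (hφ : Φ[i]? = some φ) :
    ((Nat.mod (Nat.shiftRight k (16 * i)) 65536 : ℕ) : ℤ) = φ v + N := by
  have hb := h.2 φ (List.mem_of_getElem? hφ)
  have e : Nat.mod (Nat.shiftRight k (16 * i)) 65536 = k / 65536 ^ i % 65536 := by
    change (k >>> (16 * i)) % 65536 = _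
    rw [Nat.shiftRight_eq_div_pow, pow_mul]
    norm_num
  rw [e, h.1, ofDigits_div_pow_mod]
  · simp only [List.getD_eq_getElem?_getD, List.getElem?_map, hφ, Option.map_some,
      Option.getD_some]
    omega
  · intro d hd
    obtain ⟨φ, hφ, rfl⟩ := List.mem_map.mp hd
    have := h.2 φ hφ
    omega

/-- The point of the encoding: one addition of natural numbers multiplies two monomials, and all
commutation exponents of the product are updated along with it. The bounds add up. -/
theorem Encodes.add {N M k l : ℕ} {v w : V} (hv : Encodes Φ N k v) (hw : Encodes Φ M l w) :
    Encodes Φ (N + M) (k + l) (v + w) := by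
  constructor
  · rw [hv.1, hw.1]
    have h1 := hv.2
    have h2 := hw.2
    clear hv hw
    induction Φ with
    | nil => simp
    | cons φ Φ ih =>
      simp only [List.map_cons, Nat.ofDigits_cons, map_add]
      have i1 := h1 φ List.mem_cons_self
      have i2 := h2 φ List.mem_cons_self
      have := ih (fun φ h => h1 φ (List.mem_cons_of_mem _ h))
        (fun φ h => h2 φ (List.mem_cons_of_mem _ h))
      simp only [map_add] at this
      rw [← this]
      have e : (φ v + φ w + ((N + M : ℕ) : ℤ)).toNat = (φ v + N).toNat + (φ w + M).toNat := by
        omega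
      rw [e]
      ring
  · intro φ hφ
    have h1 := hv.2 φ hφ
    have h2 := hw.2 φ hφ
    rw [map_add]
    omega

theorem Encodes.unique (hΦ : ∀ v w : V, (∀ φ ∈ Φ, φ v = φ w) → v = w) {N k : ℕ}
    (hN : 2 * N < 65536) {v w : V} (hv : Encodes Φ N k v) (hw : Encodes Φ N k w) : v = w := by
  refine hΦ v w fun φ hφ => ?_
  obtain ⟨i, hi⟩ := List.mem_iff_getElem?.mp hφ
  have h1 := hv.digit hN hi
  rw [hw.digit hN hi] at h1
  omega

variable {K : Type*} [Field K] {A : Type*} [Ring A] [Algebra K A] (Φ) (q : K) (X : V → A)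

/-- The list represents the element `x`. -/
def Represents (N o : ℕ) : List Term → A → Prop
  | [], x => x = 0
  | t :: ts, x => ∃ v y, Encodes Φ N t.k v ∧ Represents N o ts y ∧
      x = ((t.c : K) * q ^ ((t.e : ℤ) - o)) • X v + y

variable {Φ q X}

/-- Sorted input is not assumed. The order only decides how many terms get collected; every single
move of the merge preserves the sum. Equal codes may be collected since an encoded index is unique.
-/
theorem mergeK_sound (hΦ : ∀ v w : V, (∀ φ ∈ Φ, φ v = φ w) → v = w) {N o : ℕ}
    (hN : 2 * N < 65536) :
    ∀ (l m : List Term) (f : List Term → Bool) {x y : A}, mergeK l m f = true →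
      Represents Φ q X N o l x → Represents Φ q X N o m y →
      ∃ r, f r = true ∧ Represents Φ q X N o r (x + y)
  | [], m, f, x, y, h, hl, hm => by
    rw [mergeK] at h
    have hl : x = 0 := hl
    exact ⟨m, h, by rwa [hl, zero_add]⟩
  | t :: ts, m, f, x, y, h, hl, hm => by
    have ih := @mergeK_sound hΦ N o hN ts
    rw [mergeK] at h
    obtain ⟨v, x', hv, hts, rfl⟩ := id hl
    induction m generalizing f y with
    | nil =>
      rw [mergeK.go] at h
      have hm : y = 0 := hm
      exact ⟨_, h, by rwa [hm, add_zero]⟩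
    | cons s ss ihm =>
      obtain ⟨w, y', hw, hss, rfl⟩ := id hm
      have first : ∀ f : List Term → Bool, mergeK ts (s :: ss) (fun l => f (t :: l)) = true →
          ∃ r, f r = true ∧ Represents Φ q X N o r (((t.c : K) * q ^ ((t.e : ℤ) - o)) • X v + x' +
            (((s.c : K) * q ^ ((s.e : ℤ) - o)) • X w + y')) := by
        intro f h
        obtain ⟨r, hr, hr'⟩ := ih _ _ h hts hm
        exact ⟨_, hr, v, _, hv, hr', by abel⟩
      have second : ∀ f : List Term → Bool, mergeK.go t ts (mergeK ts) ss (fun l => f (s :: l)) = true →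
          ∃ r, f r = true ∧ Represents Φ q X N o r (((t.c : K) * q ^ ((t.e : ℤ) - o)) • X v + x' +
            (((s.c : K) * q ^ ((s.e : ℤ) - o)) • X w + y')) := by
        intro f h
        obtain ⟨r, hr, hr'⟩ := ihm _ _ h hss
        exact ⟨_, hr, w, _, hw, hr', by abel⟩
      rw [mergeK.go] at h
      simp only [cond_eq_ite, forceZ_eq, decide_eq_true_eq] at h
      split_ifs at h with h1 h2 h3 h4 h5
      · obtain ⟨r, hr, hr'⟩ := ih _ _ h hts hss
        have hk := Nat.eq_of_beq_eq_true h1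
        have he := Nat.eq_of_beq_eq_true h2
        obtain rfl := Encodes.unique hΦ hN hv (hk ▸ hw)
        refine ⟨_, hr, ?_⟩
        have h3' : (t.c : K) + (s.c : K) = 0 := by exact_mod_cast congrArg (Int.cast (R := K)) h3
        rw [← he, add_add_add_comm, ← add_smul, ← add_mul, h3', zero_mul, zero_smul, zero_add]
        exact hr'
      · obtain ⟨r, hr, hr'⟩ := ih _ _ h hts hss
        have hk := Nat.eq_of_beq_eq_true h1
        have he := Nat.eq_of_beq_eq_true h2
        obtain rfl := Encodes.unique hΦ hN hv (hk ▸ hw)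
        refine ⟨_, hr, v, _, hv, hr', ?_⟩
        rw [← he, add_add_add_comm, ← add_smul, ← add_mul]
        congr 3
        exact (Int.cast_add t.c s.c).symm
      · exact first _ h
      · exact second _ h
      · exact first _ h
      · exact second _ h

/-- The element given by a letter, with the values of the functions at its two positions. -/
def LetterRepresents (Φ : List (V →+ ℤ)) (β : V → V → ℤ) (q : K) (X : V → A) (g : Letter)
    (x : A) : Prop :=
  ∃ w, Encodes Φ 32 g.k w ∧ x = ((g.c : K) * q ^ ((g.e : ℤ) - 32)) • X w ∧
    (∃ i φ, g.sl = 16 * i ∧ Φ[i]? = some φ ∧ ∀ v, φ v = β w v) ∧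
    ∃ i φ, g.sr = 16 * i ∧ Φ[i]? = some φ ∧ ∀ v, φ v = β v w

variable {β : V → V → ℤ}

/-- Exponents of `q` are stored with an offset to stay in `ℕ`. A letter contributes 32 to it, the
exponent `d'` of the commutator 40, and the digit that was read `N`, which gives `o + 72 + N`. The
product without the factor `q ^ d'` gets the constant 40 as well, so both parts have the same
offset. -/
theorem stepK_sound (hq : q ≠ 0) (hX : ∀ v w, X v * X w = q ^ β v w • X (v + w)) {N o : ℕ}
    (hN : 2 * N < 65536) {g : Letter} {y : A} (hg : LetterRepresents Φ β q X g y) {d : ℕ} {d' : ℤ}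
    (hd : (d : ℤ) = d' + 40) :
    ∀ (ts : List Term) (f : List Term → List Term → Bool) {x : A}, stepK g d ts f = true →
      Represents Φ q X N o ts x →
      ∃ l r xl xr, f l r = true ∧ Represents Φ q X (N + 32) (o + 72 + N) l xl ∧
        Represents Φ q X (N + 32) (o + 72 + N) r xr ∧ y * x - q ^ d' • (x * y) = xl + xr
  | [], f, x, h, hx => by
    have hx : x = 0 := hx
    exact ⟨[], [], 0, 0, h, rfl, rfl, by simp [hx]⟩
  | t :: ts, f, x, h, hx => by
    obtain ⟨v, x', hv, hts, rfl⟩ := id hx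
    obtain ⟨w, hw, rfl, ⟨i, φ, hi, hφ, hφ'⟩, j, ψ, hj, hψ, hψ'⟩ := id hg
    have e1 : ((expo (Nat.add t.e g.e) 40 t.k g.sl : ℕ) : ℤ) = t.e + g.e + 40 + (β w v + N) := by
      have := hv.digit hN hφ
      rw [hφ', ← hi] at this
      rw [← this, expo]
      exact Nat.cast_add _ _ |>.trans (by congr 1)
    have e2 : ((expo (Nat.add t.e g.e) d t.k g.sr : ℕ) : ℤ) = t.e + g.e + d + (β v w + N) := by
      have := hv.digit hN hψ
      rw [hψ', ← hj] at this
      rw [← this, expo]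
      exact Nat.cast_add _ _ |>.trans (by congr 1)
    have key : (((g.c : K) * q ^ ((g.e : ℤ) - 32)) • X w)
          * (((t.c : K) * q ^ ((t.e : ℤ) - o)) • X v + x')
        - q ^ d' • ((((t.c : K) * q ^ ((t.e : ℤ) - o)) • X v + x')
          * (((g.c : K) * q ^ ((g.e : ℤ) - 32)) • X w))
        = (((g.c : K) * t.c) * q ^ (((expo (Nat.add t.e g.e) 40 t.k g.sl : ℕ) : ℤ)
              - (o + 72 + N : ℕ))) • X (v + w)
          + (-((g.c : K) * t.c) * q ^ (((expo (Nat.add t.e g.e) d t.k g.sr : ℕ) : ℤ)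
              - (o + 72 + N : ℕ))) • X (v + w)
          + ((((g.c : K) * q ^ ((g.e : ℤ) - 32)) • X w) * x'
            - q ^ d' • (x' * (((g.c : K) * q ^ ((g.e : ℤ) - 32)) • X w))) := by
      have f1 : ((expo (Nat.add t.e g.e) 40 t.k g.sl : ℕ) : ℤ) - (o + 72 + N : ℕ)
          = ((g.e : ℤ) - 32) + ((t.e : ℤ) - o) + β w v := by rw [e1]; push_cast; ring
      have f2 : ((expo (Nat.add t.e g.e) d t.k g.sr : ℕ) : ℤ) - (o + 72 + N : ℕ)
          = ((g.e : ℤ) - 32) + ((t.e : ℤ) - o) + β v w + d' := by rw [e2, hd]; push_cast; ring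
      rw [f1, f2, mul_add, add_mul, smul_mul_smul_comm, smul_mul_smul_comm, hX, hX, add_comm w v]
      simp only [zpow_add₀ hq, smul_add, smul_smul]
      module
    rw [stepK] at h
    simp only [cond_eq_ite, forceN_eq, forceZ_eq] at h
    split_ifs at h with h1
    · obtain ⟨l, r, xl, xr, hf, hl, hr, hs⟩ := stepK_sound hq hX hN hg hd ts _ h hts
      refine ⟨l, r, xl, xr, hf, hl, hr, ?_⟩
      -- If both exponents agree, the two new terms are negatives of each other and are dropped at
      -- once.
      rw [key, Nat.eq_of_beq_eq_true h1, hs]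
      module
    · obtain ⟨l, r, xl, xr, hf, hl, hr, hs⟩ := stepK_sound hq hX hN hg hd ts _ h hts
      refine ⟨_, _, _, _, hf, ⟨v + w, xl, hv.add hw, hl, rfl⟩, ⟨v + w, xr, hv.add hw, hr, rfl⟩, ?_⟩
      rw [key, hs]
      have c1 : ((Int.mul g.c t.c : ℤ) : K) = (g.c : K) * t.c := Int.cast_mul _ _
      have c2 : ((Int.neg (Int.mul g.c t.c) : ℤ) : K) = -((g.c : K) * t.c) :=
        (Int.cast_neg _).trans (congrArg _ c1)
      rw [c1, c2]
      abel

theorem comK_sound (hΦ : ∀ v w : V, (∀ φ ∈ Φ, φ v = φ w) → v = w) (hq : q ≠ 0)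
    (hX : ∀ v w, X v * X w = q ^ β v w • X (v + w)) {N o : ℕ} (hN : 2 * (N + 32) < 65536) {d : ℕ}
    {d' : ℤ} (hd : (d : ℤ) = d' + 40) {b : List Term} {x : A} (hb : Represents Φ q X N o b x) :
    ∀ (a : List Letter) (ys : List A) (f : List Term → Bool),
      List.Forall₂ (LetterRepresents Φ β q X) a ys → comK d b a f = true →
      ∃ r, f r = true ∧ Represents Φ q X (N + 32) (o + 72 + N) r (ys.sum * x - q ^ d' • (x * ys.sum))
  | [], _, f, .nil, h => ⟨[], h, by simp [Represents]⟩
  | g :: a, _, f, .cons (b := y) (l₂ := ys) hg ha, h => by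
    obtain ⟨l, r, xl, xr, h1, hl, hr, e⟩ := stepK_sound hq hX (by omega) hg hd b _ h hb
    obtain ⟨s, h2, hs⟩ := mergeK_sound hΦ hN l r _ h1 hl hr
    obtain ⟨t, h3, ht⟩ := comK_sound hΦ hq hX hN hd hb a _ _ ha h2
    obtain ⟨u, h4, hu⟩ := mergeK_sound hΦ hN s t _ h3 hs ht
    refine ⟨u, h4, ?_⟩
    rw [← e] at hu
    convert hu using 1
    rw [List.sum_cons, add_mul, mul_add, smul_add]
    abel

/-- The offset of the exponents in an `n`-fold commutator. -/
def offs : ℕ → ℕ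
  | 0 => 32
  | n + 1 => offs n + 72 + 32 * (n + 1)

/-- Each commutator enlarges the bound on the digits by 32, the bound for letters. Fewer than ten
commutators keep the digits far below the base. -/
theorem iterK_sound (hΦ : ∀ v w : V, (∀ φ ∈ Φ, φ v = φ w) → v = w) (hq : q ≠ 0)
    (hX : ∀ v w, X v * X w = q ^ β v w • X (v + w)) {a : List Letter} {ys : List A}
    (ha : List.Forall₂ (LetterRepresents Φ β q X) a ys) :
    ∀ (ds : List ℕ) (ds' : List ℤ), List.Forall₂ (fun (d : ℕ) d' => (d : ℤ) = d' + 40) ds ds' →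
      ∀ (n : ℕ) (_ : n + ds.length < 10) (b : List Term) (f : List Term → Bool) {x : A},
      Represents Φ q X (32 * (n + 1)) (offs n) b x → iterK a ds b f = true →
      ∃ r, f r = true ∧ Represents Φ q X (32 * (n + ds.length + 1)) (offs (n + ds.length)) r
        (ds'.foldl (fun x c => ys.sum * x - q ^ c • (x * ys.sum)) x)
  | [], _, .nil, n, _, b, f, x, hb, h => ⟨b, h, hb⟩
  | d :: ds, _, .cons (b := d') (l₂ := ds') hd hds, n, hn, b, f, x, hb, h => by
    rw [List.length_cons] at hn ⊢
    obtain ⟨r, hr, hr'⟩ := comK_sound hΦ hq hX (by omega) hd hb a _ _ ha h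
    have e : n + (ds.length + 1) = n + 1 + ds.length := by ring
    rw [e]
    exact iterK_sound hΦ hq hX ha ds ds' hds (n + 1) (by omega) r f hr' hr

end sound

end

end QuantumF4

namespace QuantumF4

noncomputable section

variable {K : Type u} [Field K]

/-! ### Commutators of linear combinations of monomials without words -/

/-- The index of the monomial. -/
def Mon.index (m : Mon) : Expo × Expo × (Fin 4 → ℤ) := (vec m.a, vec m.r, vec4 m.t)

/-- The monomial with index `v`. -/
def xtmon (q : K) (v : Expo × Expo × (Fin 4 → ℤ)) : Weyl15 q ⊗[K] Uq q nodesB3 :=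
  xmon q v.1 v.2.1 ⊗ₜ[K] tmon q nodesB3 v.2.2

theorem Mon.eval_eq (q : K) {m : Mon} (h : m.w = []) :
    m.eval q = q ^ m.e • xtmon q m.index := by
  simp [Mon.eval, xtmon, Mon.index, h, wordVal]

theorem xtmon_mul {q : K} (hq : q ≠ 0) (v w : Expo × Expo × (Fin 4 → ℤ)) :
    xtmon q v * xtmon q w = q ^ (∑ k, v.2.1 k * w.1 k) • xtmon q (v + w) := by
  rw [xtmon, xtmon, Algebra.TensorProduct.tmul_mul_tmul, xmon_mul hq, ← tmon_add,
    ← TensorProduct.smul_tmul', xtmon]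
  rfl

/-- The exponent of `q` in the product with a monomial on the left. -/
def leftHom (m : Mon) : Expo × Expo × (Fin 4 → ℤ) →+ ℤ :=
  AddMonoidHom.mk' (fun v => ∑ k, vec m.r k * v.1 k) fun v w => by
    simp [mul_add, Finset.sum_add_distrib]

/-- The exponent of `q` in the product with a monomial on the right. -/
def rightHom (m : Mon) : Expo × Expo × (Fin 4 → ℤ) →+ ℤ :=
  AddMonoidHom.mk' (fun v => ∑ k, v.2.1 k * vec m.a k) fun v w => by
    simp [add_mul, Finset.sum_add_distrib]

/-- The coordinates of an index. -/
def coordHoms : List (Expo × Expo × (Fin 4 → ℤ) →+ ℤ) :=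
  ((List.finRange 15).map fun k => AddMonoidHom.mk' (fun v => v.1 k) fun _ _ => rfl) ++
  (((List.finRange 15).map fun k => AddMonoidHom.mk' (fun v => v.2.1 k) fun _ _ => rfl) ++
    (List.finRange 4).map fun k => AddMonoidHom.mk' (fun v => v.2.2 k) fun _ _ => rfl)

/-- The functions used in computations of commutators with `A`. -/
def homs (A : Poly) : List (Expo × Expo × (Fin 4 → ℤ) →+ ℤ) :=
  (A.map fun p => leftHom p.2) ++ ((A.map fun p => rightHom p.2) ++ coordHoms)

/-- The values of these functions. -/
def homVals (A : Poly) (n : Mon) : List ℤ :=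
  (A.map fun p => dot 15 p.2.r n.a) ++ ((A.map fun p => dot 15 n.r p.2.a) ++
    (((List.finRange 15).map fun k => n.a.getD k 0) ++ (((List.finRange 15).map fun k =>
      n.r.getD k 0) ++ (List.finRange 4).map fun k => n.t.getD k 0)))

theorem homVals_eq (A : Poly) (n : Mon) : homVals A n = (homs A).map fun φ => φ n.index := by
  simp only [homVals, homs, coordHoms, List.map_append, List.map_map]
  congr 1
  · exact List.map_congr_left fun p _ => dot_eq 15 _ _
  congr 1
  exact List.map_congr_left fun p _ => dot_eq 15 _ _

/-- The coordinate functions are included in `homs` to make the encoding injective; the other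
functions give the commutation exponents. -/
theorem eq_of_homs (A : Poly) (v w : Expo × Expo × (Fin 4 → ℤ))
    (h : ∀ φ ∈ homs A, φ v = φ w) : v = w := by
  have h' : ∀ φ ∈ coordHoms, φ v = φ w := fun φ hφ =>
    h φ (List.mem_append_right _ (List.mem_append_right _ hφ))
  refine Prod.ext (funext fun k => ?_) (Prod.ext (funext fun k => ?_) (funext fun k => ?_))
  · exact h' _ (List.mem_append_left _ (List.mem_map_of_mem (List.mem_finRange k)))
  · exact h' _ (List.mem_append_right _
      (List.mem_append_left _ (List.mem_map_of_mem (List.mem_finRange k))))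
  · exact h' _ (List.mem_append_right _
      (List.mem_append_right _ (List.mem_map_of_mem (List.mem_finRange k))))

/-- Call by value for natural numbers given as integers. -/
def forceNat (z : ℤ) (f : ℕ → Bool) : Bool :=
  match z with
  | .ofNat n => forceN n f
  | .negSucc _ => false

theorem forceNat_sound {z : ℤ} {f : ℕ → Bool} (h : forceNat z f = true) :
    ∃ n : ℕ, f n = true ∧ (n : ℤ) = z := by
  cases z with
  | ofNat n => exact ⟨n, by simpa [forceNat, forceN_eq] using h, rfl⟩
  | negSucc n => simp [forceNat] at h

/-- The number with the given shifted digits. -/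
def encode (N : ℕ) : List ℤ → (ℕ → Bool) → Bool
  | [], f => f 0
  | z :: l, f => forceNat (z + N) fun d => Nat.ble d (2 * N) &&
      encode N l fun k => forceN (d + 65536 * k) f

theorem encode_sound {N : ℕ} : ∀ {l : List ℤ} {f : ℕ → Bool}, encode N l f = true →
    ∃ k, f k = true ∧ k = Nat.ofDigits 65536 (l.map fun z => (z + (N : ℤ)).toNat) ∧
      ∀ z ∈ l, -(N : ℤ) ≤ z ∧ z ≤ N
  | [], f, h => ⟨0, h, by simp⟩
  | z :: l, f, h => by
    obtain ⟨d, h1, hd⟩ := forceNat_sound h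
    rw [Bool.and_eq_true] at h1
    obtain ⟨k, h2, hk, hl⟩ := encode_sound h1.2
    have hd' := Nat.le_of_ble_eq_true h1.1
    refine ⟨_, by rwa [forceN_eq] at h2, ?_, ?_⟩
    · rw [List.map_cons, Nat.ofDigits_cons, ← hk, ← hd]
      simp
    · intro z' hz'
      rcases List.mem_cons.mp hz' with rfl | hz'
      · omega
      · exact hl _ hz'

/-- The representation of a monomial with a coefficient. -/
def encodeTerm (N o : ℕ) (A : Poly) (p : ℤ × Mon) (f : Term → Bool) : Bool :=
  p.2.w.isEmpty && forceNat (p.2.e + o) fun e => encode N (homVals A p.2) fun k =>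
    forceZ p.1 fun c => f ⟨k, e, c⟩

theorem encodeTerm_sound {N o : ℕ} {A : Poly} {p : ℤ × Mon} {f : Term → Bool}
    (h : encodeTerm N o A p f = true) (q : K) :
    ∃ t, f t = true ∧ Encodes (homs A) N t.k p.2.index ∧
      (p.1 : K) • p.2.eval q = ((t.c : K) * q ^ ((t.e : ℤ) - o)) • xtmon q p.2.index := by
  rw [encodeTerm, Bool.and_eq_true] at h
  obtain ⟨e, h1, he⟩ := forceNat_sound h.2
  obtain ⟨k, h2, hk, hl⟩ := encode_sound h1
  refine ⟨_, by rwa [forceZ_eq] at h2, ⟨?_, ?_⟩, ?_⟩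
  · rw [hk, homVals_eq, List.map_map]
    rfl
  · intro φ hφ
    refine hl _ ?_
    rw [homVals_eq]
    exact List.mem_map_of_mem hφ
  · rw [Mon.eval_eq q (List.isEmpty_iff.mp h.1), smul_smul, he, add_sub_cancel_right]

/-- The representation of a linear combination of monomials. -/
def encodePoly (N o : ℕ) (A : Poly) : Poly → (List Term → Bool) → Bool
  | [], f => f []
  | p :: B, f => encodeTerm N o A p fun t => encodePoly N o A B fun l => mergeK [t] l f

theorem encodePoly_sound {N o : ℕ} {A : Poly} (hN : 2 * N < 65536) (q : K) :
    ∀ {B : Poly} {f : List Term → Bool}, encodePoly N o A B f = true →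
      ∃ l, f l = true ∧ Represents (homs A) q (xtmon q) N o l (evalP q B)
  | [], f, h => ⟨[], h, by simp [evalP, Represents]⟩
  | p :: B, f, h => by
    obtain ⟨t, h1, ht, e⟩ := encodeTerm_sound h q
    obtain ⟨l, h2, hl⟩ := encodePoly_sound hN q h1
    obtain ⟨r, h3, hr⟩ := mergeK_sound (eq_of_homs A) hN _ _ _ h2 ⟨_, 0, ht, rfl, rfl⟩ hl
    exact ⟨r, h3, by rwa [evalP_cons, e, ← add_zero (_ • xtmon q _)]⟩

/-- The representation of the terms of `A` as letters, starting with the `i`-th one. -/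
def encodeLetters (A : Poly) (n : ℕ) : ℕ → Poly → (List Letter → Bool) → Bool
  | _, [], f => f []
  | i, p :: B, f => encodeTerm 32 32 A p fun t => forceN (16 * i) fun sl =>
      forceN (16 * (n + i)) fun sr => encodeLetters A n (i + 1) B fun l => f (⟨t, sl, sr⟩ :: l)

theorem encodeLetters_sound {A : Poly} (q : K) :
    ∀ {B C : Poly} {f : List Letter → Bool}, A = C ++ B →
      encodeLetters A A.length C.length B f = true →
      ∃ l, f l = true ∧ List.Forall₂
        (LetterRepresents (homs A) (fun v w => ∑ k, v.2.1 k * w.1 k) q (xtmon q)) l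
        (B.map fun p => (p.1 : K) • p.2.eval q)
  | [], _, f, _, h => ⟨[], h, .nil⟩
  | p :: B, C, f, hA, h => by
    obtain ⟨t, h1, ht, e⟩ := encodeTerm_sound h q
    rw [forceN_eq, forceN_eq] at h1
    obtain ⟨l, h2, hl⟩ := encodeLetters_sound (C := C ++ [p]) q (by simpa using hA)
      (by simpa using h1)
    have hi : A[C.length]? = some p := by simp [hA]
    have hlt := (List.getElem?_eq_some_iff.mp hi).1
    refine ⟨_, h2, .cons ⟨_, ht, e, ⟨C.length, leftHom p.2, rfl, ?_, fun _ => rfl⟩,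
      ⟨A.length + C.length, rightHom p.2, rfl, ?_, fun _ => rfl⟩⟩ hl⟩
    · rw [homs, List.getElem?_append_left (by simpa using hlt), List.getElem?_map, hi]
      rfl
    · rw [homs, List.getElem?_append_right (by simp), List.getElem?_append_left (by simpa using hlt)]
      simp [hi]

/-- The representation of the exponents in commutators. -/
def encodeExps : List ℤ → (List ℕ → Bool) → Bool
  | [], f => f []
  | d :: ds, f => forceNat (d + 40) fun d => encodeExps ds fun ds => f (d :: ds)

theorem encodeExps_sound : ∀ {ds' : List ℤ} {f : List ℕ → Bool}, encodeExps ds' f = true →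
    ∃ ds, f ds = true ∧ List.Forall₂ (fun (d : ℕ) d' => (d : ℤ) = d' + 40) ds ds'
  | [], f, h => ⟨[], h, .nil⟩
  | d :: ds', f, h => by
    obtain ⟨d, h1, hd⟩ := forceNat_sound h
    obtain ⟨ds, h2, hds⟩ := encodeExps_sound h1
    exact ⟨_, h2, .cons hd hds⟩

/-- The iterated `q`-commutators of `A` with `B` and the sum `T` cancel. -/
def cancels (ds : List ℤ) (A B T : Poly) : Bool :=
  Nat.blt ds.length 10 &&
  encodeLetters A A.length 0 A fun a => encodePoly 32 32 A B fun b =>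
  encodePoly (32 * (ds.length + 1)) (offs ds.length) A T fun t => encodeExps ds fun ds =>
  iterK a ds b fun r => mergeK r t fun l => l.isEmpty

/-- Soundness of the whole program: a successful run ends with an empty list, which represents zero.
The result is valid for every nonzero `q` in every field, as coefficients are integers and exponents
are tracked formally. -/
theorem eq_zero_of_cancels {q : K} (hq : q ≠ 0) {ds : List ℤ} {A B T : Poly}
    (h : cancels ds A B T = true) :
    ds.foldl (fun x c => evalP q A * x - q ^ c • (x * evalP q A)) (evalP q B) + evalP q T = 0 := by
  rw [cancels, Bool.and_eq_true] at h
  have h10 : ds.length < 10 := Nat.le_of_ble_eq_true h.1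
  obtain ⟨a, h1, ha⟩ := encodeLetters_sound (C := []) q rfl h.2
  obtain ⟨b, h2, hb⟩ := encodePoly_sound (by norm_num) q h1
  obtain ⟨t, h3, ht⟩ := encodePoly_sound (by omega) q h2
  obtain ⟨es, h4, hes⟩ := encodeExps_sound h3
  have hlen := hes.length_eq
  obtain ⟨r, h5, hr⟩ := iterK_sound (eq_of_homs A) hq (xtmon_mul hq) ha es ds hes 0 (by omega) b _
    hb h4
  rw [zero_add, hlen] at hr
  obtain ⟨l, h6, hl⟩ := mergeK_sound (eq_of_homs A) (by omega) _ _ _ h5 hr ht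
  rw [List.isEmpty_iff.mp h6] at hl
  exact hl

end

end QuantumF4

namespace QuantumF4

noncomputable section

/-! ### The images of the generators as linear combinations of monomials -/

/-- The coordinates of `tExp`. -/
def tExpL (i : Fin 4) : List (Fin 15) → List ℤ
  | [] => lcomb []
  | a :: w => addL (lcomb [(-(cartan i (node a) * dd i), a)]) (tExpL i w)

/-- The exponents of the monomials with a factor `t_i` in the result of moving `e_i` through a
word. -/
def eExps (i : Fin 4) : List (Fin 15) → List (List ℤ × List ℤ)
  | [] => []
  | a :: w =>
    if node a = i then
      (lcomb [(-1, a)], addL (lcomb [(-dd i, a)]) (tExpL i w)) :: eExps i w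
    else eExps i w

/-- The coordinates of a multiple of a unit vector. -/
def unitL (i : Fin 4) (c : ℤ) : List ℤ := (List.finRange 4).map fun k => if k = i then c else 0

/-- The exponents of the monomial in front of `e_i` (for `true`) or `f_i` (for `false`) in the
image of this generator. -/
def tailExp : Bool → Fin 4 → List ℤ
  | true, _ => lcomb []
  | false, i => ((fdata i).2.map Prod.fst).getD (lcomb [])

/-- The part of the image of a generator which contains `e_i` or `f_i`. -/
def tailP (b : Bool) (i : Fin 4) : Poly :=
  if b = false ∧ i = 3 then [] else [(1, ⟨0, tailExp b i, lcomb [], [], [(b, i)]⟩)]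

/-- The part `± q^{± ⋯}` of a bracket in the image of `f_i`, multiplied by
`q^{d_i} - q^{-d_i}`. -/
def signB (s : ℤ) (i : Fin 4) (b : ℤ × List ℤ × ℤ × List ℤ) : Poly :=
  if b.1 = dd i then [(s, ⟨s * (b.1 * b.2.2.1), b.2.2.2, b.2.1.map (s * b.1 * ·), [], []⟩)]
  else [(s, ⟨s * b.2.2.1 + 1, b.2.2.2, b.2.1.map (s * ·), [], []⟩),
    (s, ⟨s * b.2.2.1 - 1, b.2.2.2, b.2.1.map (s * ·), [], []⟩)]

/-- The part `± q^{± ⋯}` of the quantum integers in the image of a generator, multiplied by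
`q^{d_i} - q^{-d_i}`. -/
def signP (s : ℤ) : Bool → Fin 4 → Poly
  | true, i => (eExps i y4).map fun p =>
    (s, ⟨s * dd i, p.1, p.2.map (s * ·), unitL i s, []⟩)
  | false, i => (fdata i).1.flatMap (signB s i)

/-- The image of `t_i` (for `s = 1`) and `t_i⁻¹` (for `s = -1`). -/
def tMon (s : ℤ) (i : Fin 4) : Mon := ⟨0, lcomb [], (tExpL i y4).map (s * ·), unitL i s, []⟩

/-- Multiplication by `q ^ d - q ^ (-d)`. -/
def scaleD (d : ℤ) (p : Poly) : Poly := scale 1 d p ++ scale (-1) (-d) p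

/-- The sum of `signP 1` and `signP (-1)`. -/
def signsP (b : Bool) (i : Fin 4) : Poly := signP 1 b i ++ signP (-1) b i

/-- The negative of the commutator of `signsP true i` and `signsP false j`. -/
def efDefect (i j : Fin 4) : Poly :=
  if i = j then
    scaleD (dd i) [(-1, tMon 1 i), (1, tMon (-1) i)] ++
    if i = 3 then [] else
      scaleD (dd i) [(1, ⟨0, tailExp false i, lcomb [], unitL i 1, []⟩),
        (-1, ⟨0, tailExp false i, lcomb [], unitL i (-1), []⟩)]
  else []

/-- The Serre relations between the parts `P⁺` alone; the parts `P⁻` are treated next. The list of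
exponents is reversed because the program folds from the left. -/
theorem cancels_serre : ∀ b i j, i ≠ j →
    cancels (serreExps i j).reverse (signP 1 b i) (signP 1 b j) [] = true := by
  decide +kernel

theorem cancels_serre_neg : ∀ b i j, i ≠ j →
    cancels (serreExps i j).reverse (signP (-1) b i) (signP (-1) b j) [] = true := by
  decide +kernel

/-- For `i = j` the parts `P` produce the wanted difference of the images of `t_i` and `t_i⁻¹`, and
for `i ≠ 4` an unwanted multiple of `t_i - t_i⁻¹` that will cancel against the commutator of the
parts `T`. -/
theorem cancels_efDefect : ∀ i j,
    cancels [0] (signsP true i) (signsP false j) (efDefect i j) = true := by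
  decide +kernel

theorem qcommute_signsP_tailP : ∀ i j, qcommute 0 (signsP true i) (tailP false j) = true ∧
    qcommute 0 (tailP true i) (signsP false j) = true := by
  decide +kernel

/-- Together with `cancels_signP` these are the hypotheses of `serre_add`, for the decomposition in
the order `P⁺`, `T`, `P⁻`. -/
theorem qcommute_tailP : ∀ b i j,
    qcommute (dd i * cartan i j) (signP 1 b i) (tailP b j) = true ∧
    qcommute (dd i * cartan i j) (tailP b i) (signP (-1) b j) = true := by
  decide +kernel

theorem cancels_signP : ∀ b i j,
    cancels [dd i * cartan i j] (signP 1 b i) (signP (-1) b j) [] = true := by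
  decide +kernel

theorem qcommute_tMon_tailP : ∀ (b : Bool) i j,
    qcommute (if b then dd i * cartan i j else -(dd i * cartan i j)) [(1, tMon 1 i)]
      (tailP b j) = true := by
  decide +kernel

theorem cancels_tMon : ∀ (b : Bool) i j,
    cancels [if b then dd i * cartan i j else -(dd i * cartan i j)] [(1, tMon 1 i)]
      (signsP b j) [] = true := by
  decide +kernel

theorem tMon_mul : ∀ i, (tMon 1 i).mul (tMon (-1) i) = ⟨0, lcomb [], lcomb [], [0, 0, 0, 0], []⟩ ∧
    (tMon (-1) i).mul (tMon 1 i) = ⟨0, lcomb [], lcomb [], [0, 0, 0, 0], []⟩ ∧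
    ∀ j, (tMon 1 i).mul (tMon 1 j) = (tMon 1 j).mul (tMon 1 i) := by
  decide +kernel

end

end QuantumF4

namespace QuantumF4

noncomputable section

variable {K : Type u} [Field K]

/-! ### The images of the generators -/

section images

theorem Om_sym (q : K) {S : Set (Fin 4)} (r α : Expo) (s : Option (Gen S)) :
    Om q S (sym K r α s) = xmon q α r ⊗ₜ[K] s.elim 1 (gen q) := by
  rw [Om, sym, Finsupp.linearCombination_single, one_smul]
  rfl

theorem vec_map_mul (c : ℤ) (l : List ℤ) : vec (l.map (c * ·)) = c • vec l := by
  funext k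
  simp only [vec, List.getD_eq_getElem?_getD, List.getElem?_map, Pi.smul_apply, smul_eq_mul]
  cases l[(k : ℕ)]? <;> simp

theorem vec_lcomb_nil : vec (lcomb []) = 0 := by
  rw [vec_lcomb]
  rfl

theorem vec_tExpL (i : Fin 4) (w : List (Fin 15)) : vec (tExpL i w) = tExp i w := by
  induction w with
  | nil => exact vec_lcomb_nil
  | cons a w ih =>
    rw [tExpL, vec_addL, vec_lcomb, ih, tExp]
    simp

theorem vec4_unitL (i : Fin 4) (c : ℤ) : vec4 (unitL i c) = Pi.single i c := by
  funext k
  simp [vec4, unitL, List.getD_eq_getElem?_getD, Pi.single_apply]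

theorem vec4_nil : vec4 [] = 0 := by
  funext k
  simp [vec4]

theorem evalP_singleton (q : K) (c : ℤ) (m : Mon) : evalP q [(c, m)] = (c : K) • m.eval q := by
  simp [evalP]

theorem evalP_nil (q : K) : evalP q [] = 0 := rfl

theorem evalP_tailP (q : K) (b : Bool) (i : Fin 4) :
    evalP q (tailP b i) = xmon q (vec (tailExp b i)) 0 ⊗ₜ[K] letter q (b, i) := by
  rw [tailP]
  split_ifs with h
  · obtain ⟨rfl, rfl⟩ := h
    simp [evalP_nil, letter, toB3]
  · simp [evalP_singleton, Mon.eval, vec_lcomb_nil, vec4_nil, tmon_zero, wordVal]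

theorem tU_zpow_neg_one (q : K) (S : Set (Fin 4)) (i : Fin 4) :
    ((tU q S i ^ (-1 : ℤ) : (Uq q S)ˣ) : Uq q S) = gen q (.tinv i) := by
  rw [zpow_neg_one]
  rfl

theorem tU_zpow_one (q : K) (S : Set (Fin 4)) (i : Fin 4) :
    ((tU q S i ^ (1 : ℤ) : (Uq q S)ˣ) : Uq q S) = gen q (.t i) := by
  rw [zpow_one]
  rfl

theorem Om_relExpr_t (q : K) (i : Fin 4) :
    Om q nodesB3 (relExpr q (.t i)) = (tMon 1 i).eval q := by
  rw [relExpr, Om_sym]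
  simp only [tMon, Mon.eval, vec_map_mul, vec_tExpL, vec_lcomb_nil, vec4_unitL, tmon_single,
    wordVal, List.map_nil, List.prod_nil, tU_zpow_one]
  simp only [one_mul, zpow_zero, one_smul]
  rfl

theorem Om_relExpr_tinv (q : K) (i : Fin 4) :
    Om q nodesB3 (relExpr q (.tinv i)) = (tMon (-1) i).eval q := by
  rw [relExpr, Om_sym]
  simp only [tMon, Mon.eval, vec_map_mul, vec_tExpL, vec_lcomb_nil, vec4_unitL, tmon_single,
    wordVal, List.map_nil, List.prod_nil, tU_zpow_neg_one]
  simp only [one_mul, zpow_zero, one_smul, neg_smul]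
  rfl

/-- The image of `e_i` or `f_i`. -/
def gval (q : K) (b : Bool) (i : Fin 4) : Weyl15 q ⊗[K] Uq q nodesB3 :=
  (q ^ dd i - q ^ (-dd i))⁻¹ • evalP q (signP 1 b i) + evalP q (tailP b i)
    + (q ^ dd i - q ^ (-dd i))⁻¹ • evalP q (signP (-1) b i)

theorem add_combine {M : Type*} [AddCommGroup M] [Module K M] (c : K) (x y u v z w w' : M)
    (hw : w = c • x + z + c • y) (hw' : w' = c • u + c • v) :
    w + w' = c • (u + x) + z + c • (v + y) := by
  rw [hw, hw']
  module

theorem add_combine' {M : Type*} [AddCommGroup M] [Module K M] (c : K) (x y u v w w' : M)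
    (hw : w = c • x + c • y) (hw' : w' = c • u + c • v) :
    w' + w = c • (u + x) + c • (v + y) := by
  rw [hw, hw']
  module

theorem sign_combine {M : Type*} [AddCommGroup M] [Module K M] (c a b : K) (x y u v : M)
    (hu : u = a • x) (hv : v = -(b • y)) : c • (a • x - b • y) = c • u + c • v := by
  rw [hu, hv]
  module

theorem neg_combine {M : Type*} [AddCommGroup M] [Module K M] (a b c : K) (x : M)
    (h : a + b = c) : (-1 : K) • a • x + (-1 : K) • b • x = -(c • x) := by
  rw [← h]
  module

/-- Each factor `f_i^{(j)}` of the word contributes one term with `t_i` and one with `t_i⁻¹`, which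
belong to `P⁺` and `P⁻`. -/
theorem Om_eExpr (q : K) (i : Fin 4) : ∀ w : List (Fin 15),
    Om q nodesB3 (eExpr q i w)
      = (q ^ dd i - q ^ (-dd i))⁻¹ • evalP q ((eExps i w).map fun p =>
          (1, ⟨1 * dd i, p.1, p.2.map (1 * ·), unitL i 1, []⟩))
        + evalP q (tailP true i)
        + (q ^ dd i - q ^ (-dd i))⁻¹ • evalP q ((eExps i w).map fun p =>
          (-1, ⟨-1 * dd i, p.1, p.2.map (-1 * ·), unitL i (-1), []⟩))
  | [] => by
    rw [eExpr, Om_sym, evalP_tailP]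
    simp only [eExps, List.map_nil, evalP_nil, smul_zero, zero_add, add_zero, tailExp,
      vec_lcomb_nil]
    rfl
  | a :: w => by
    have ih := Om_eExpr q i w
    rw [eExpr, eExps]
    split_ifs with h
    · rw [map_add, List.map_cons, List.map_cons, evalP_cons, evalP_cons]
      refine add_combine (M := Weyl15 q ⊗[K] Uq q nodesB3) _ _ _ _ _ _ _ _ ih ?_
      rw [map_smul, map_sub, map_smul, map_smul, shift_sym, shift_sym, Om_sym, Om_sym]
      refine sign_combine (M := Weyl15 q ⊗[K] Uq q nodesB3) _ _ _ _ _ _ _ ?_ ?_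
      · simp only [Mon.eval, vec_map_mul, vec_addL, vec_lcomb, vec_tExpL, vec4_unitL,
          tmon_single, wordVal, List.map_nil, List.prod_nil, tU_zpow_one]
        simp
      · simp only [Mon.eval, vec_map_mul, vec_addL, vec_lcomb, vec_tExpL, vec4_unitL,
          tmon_single, wordVal, List.map_nil, List.prod_nil, tU_zpow_neg_one]
        simp
        exact neg_one_smul K (M := Weyl15 q ⊗[K] Uq q nodesB3) _
    · exact ih

theorem Om_relExpr_e (q : K) (i : Fin 4) : Om q nodesB3 (relExpr q (.e i)) = gval q true i :=
  Om_eExpr q i y4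

theorem fdata_brackets : ∀ i, ∀ b ∈ (fdata i).1, b.1 = dd i ∨ b.1 = 1 ∧ dd i = 2 := by
  decide +kernel

theorem fdata_snd : ∀ i, (fdata i).2 = if i = 3 then none else some (tailExp false i, i) := by
  decide +kernel

theorem sub_inv_ne_zero {q : K} (hq0 : q ≠ 0) (hq4 : q ^ 4 ≠ 1) : q - q⁻¹ ≠ 0 := by
  intro h
  apply hq4
  have : q * q = 1 := by
    rw [sub_eq_zero] at h
    nth_rewrite 2 [h]
    exact mul_inv_cancel₀ hq0
  calc q ^ 4 = (q * q) * (q * q) := by ring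
    _ = 1 := by rw [this, one_mul]

theorem add_inv_ne_zero {q : K} (hq0 : q ≠ 0) (hq4 : q ^ 4 ≠ 1) : q + q⁻¹ ≠ 0 := by
  intro h
  apply hq4
  have : q * q = -1 := by
    have h' : q = -q⁻¹ := eq_neg_of_add_eq_zero_left h
    nth_rewrite 2 [h']
    rw [mul_neg, mul_inv_cancel₀ hq0]
  calc q ^ 4 = (q * q) * (q * q) := by ring
    _ = 1 := by rw [this]; ring

theorem sub_dd_ne_zero {q : K} (hq0 : q ≠ 0) (hq4 : q ^ 4 ≠ 1) (i : Fin 4) :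
    q ^ dd i - q ^ (-dd i) ≠ 0 := by
  have h2 : ∀ i, dd i = 1 ∨ dd i = 2 := by decide
  rcases h2 i with h | h <;> rw [h]
  · simpa using sub_inv_ne_zero hq0 hq4
  · have : q ^ (2 : ℤ) - q ^ (-2 : ℤ) = (q - q⁻¹) * (q + q⁻¹) := by
      rw [zpow_neg]
      norm_cast
      field_simp
      ring
    rw [this]
    exact mul_ne_zero (sub_inv_ne_zero hq0 hq4) (add_inv_ne_zero hq0 hq4)

/-- The contribution of a bracket. -/
theorem Om_bracket {q : K} (hq0 : q ≠ 0) (hq4 : q ^ 4 ≠ 1) (i : Fin 4)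
    (b : ℤ × List ℤ × ℤ × List ℤ) (hb : b.1 = dd i ∨ b.1 = 1 ∧ dd i = 2) :
    Om q nodesB3 (bracket q b.1 (vec b.2.1) b.2.2.1 (vec b.2.2.2))
      = (q ^ dd i - q ^ (-dd i))⁻¹ • evalP q (signB 1 i b)
        + (q ^ dd i - q ^ (-dd i))⁻¹ • evalP q (signB (-1) i b) := by
  rw [bracket, map_smul, map_sub, map_smul, map_smul, Om_sym, Om_sym, signB, signB]
  rcases hb with h | ⟨h, h'⟩
  · rw [if_pos h, if_pos h, h]
    refine sign_combine (M := Weyl15 q ⊗[K] Uq q nodesB3) _ _ _ _ _ _ _ ?_ ?_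
    · simp only [evalP_singleton, Mon.eval, vec_map_mul, vec4_nil, tmon_zero, wordVal,
        List.map_nil, List.prod_nil]
      simp
    · simp only [evalP_singleton, Mon.eval, vec_map_mul, vec4_nil, tmon_zero, wordVal,
        List.map_nil, List.prod_nil]
      simp
      exact neg_one_smul K (M := Weyl15 q ⊗[K] Uq q nodesB3) _
  · rw [if_neg (by omega), if_neg (by omega), h, h']
    have hs := sub_inv_ne_zero hq0 hq4
    have ha := add_inv_ne_zero hq0 hq4
    -- A bracket with base `q` in the image of a long `f_i` is brought to the common denominator `q²
    -- - q⁻²`. The factor `q + q⁻¹` explains the two monomials in `signB`.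
    have hD : (q ^ (1 : ℤ) - q ^ (-1 : ℤ))⁻¹
        = (q ^ (2 : ℤ) - q ^ (-2 : ℤ))⁻¹ * (q + q⁻¹) := by
      have : q ^ (2 : ℤ) - q ^ (-2 : ℤ) = (q - q⁻¹) * (q + q⁻¹) := by
        rw [zpow_neg]
        norm_cast
        field_simp
        ring
      rw [this, zpow_one, zpow_neg_one, mul_inv, mul_assoc, inv_mul_cancel₀ ha, mul_one]
    rw [hD, mul_smul, smul_sub, smul_smul, smul_smul]
    refine sign_combine (M := Weyl15 q ⊗[K] Uq q nodesB3) _ _ _ _ _ _ _ ?_ ?_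
    · simp only [evalP_cons, evalP_nil, Mon.eval, vec_map_mul, vec4_nil, tmon_zero, wordVal,
        List.map_nil, List.prod_nil]
      simp only [one_mul, Int.cast_one, one_smul, Option.elim_none,
        zpow_add₀ hq0, zpow_sub₀ hq0, zpow_one, add_zero]
      rw [← add_smul]
      congr 1
      field_simp
    · simp only [evalP_cons, evalP_nil, Mon.eval, vec_map_mul, vec4_nil, tmon_zero, wordVal,
        List.map_nil, List.prod_nil]
      simp only [one_mul, Int.cast_neg, Int.cast_one, one_smul, Option.elim_none, zpow_add₀ hq0, zpow_sub₀ hq0, zpow_one, add_zero, neg_smul, neg_mul]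
      refine neg_combine (K := K) (M := Weyl15 q ⊗[K] Uq q nodesB3) _ _ _ _ ?_
      field_simp

theorem Om_relExpr_f {q : K} (hq0 : q ≠ 0) (hq4 : q ^ 4 ≠ 1) (i : Fin 4) :
    Om q nodesB3 (relExpr q (fGen i)) = gval q false i := by
  have key : ∀ l : List (ℤ × List ℤ × ℤ × List ℤ),
      (∀ b ∈ l, b.1 = dd i ∨ b.1 = 1 ∧ dd i = 2) →
      Om q nodesB3 ((l.map fun b => bracket q b.1 (vec b.2.1) b.2.2.1 (vec b.2.2.2)).sum)
        = (q ^ dd i - q ^ (-dd i))⁻¹ • evalP q (l.flatMap (signB 1 i))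
          + (q ^ dd i - q ^ (-dd i))⁻¹ • evalP q (l.flatMap (signB (-1) i)) := by
    intro l hl
    induction l with
    | nil => simp [evalP_nil]
    | cons b l ih =>
      rw [List.map_cons, List.sum_cons, map_add, List.flatMap_cons, List.flatMap_cons,
        evalP_append, evalP_append]
      exact add_combine' (M := Weyl15 q ⊗[K] Uq q nodesB3) _ _ _ _ _ _ _ (ih fun b h => hl b (List.mem_cons_of_mem _ h))
        (Om_bracket hq0 hq4 i b (hl b List.mem_cons_self))
  have ht : Om q nodesB3 ((fdata i).2.elim 0 fun p => sym K 0 (vec p.1) (toB3 p.2))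
      = evalP q (tailP false i) := by
    rw [fdata_snd, evalP_tailP]
    split_ifs with h
    · subst h
      simp [letter, toB3]
    · simp [Om_sym, letter, toB3, h]
  rw [relExpr, evalF, map_add, key _ (fdata_brackets i), ht, gval, add_right_comm]
  rfl

end images

end

end QuantumF4

namespace QuantumF4

noncomputable section

variable {K : Type u} [Field K]

/-! ### The relations between the images -/

section qcomm

variable {A : Type*} [Ring A] [Algebra K A]

theorem smul_qcomm {k : K} {x y : A} (h : x * y = k • (y * x)) (c c' : K) :
    (c • x) * (c' • y) = k • ((c' • y) * (c • x)) := by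
  rw [smul_mul_smul_comm, smul_mul_smul_comm, h, smul_comm, mul_comm]

theorem add_left_qcomm {k : K} {x x' y : A} (h : x * y = k • (y * x)) (h' : x' * y = k • (y * x')) :
    (x + x') * y = k • (y * (x + x')) := by
  rw [add_mul, mul_add, smul_add, h, h']

theorem add_right_qcomm {k : K} {x y y' : A} (h : x * y = k • (y * x))
    (h' : x * y' = k • (y' * x)) : x * (y + y') = k • ((y + y') * x) := by
  rw [add_mul, mul_add, smul_add, h, h']

theorem eq_of_sub_add_zero {x y z : A} (hz : z = 0) (h : x - y + z = 0) : x = y := by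
  rw [hz, add_zero] at h
  exact sub_eq_zero.mp h

theorem commutator_expand (c c' : K) {x x' y y' z : A} (h₁ : x * y' = y' * x)
    (h₂ : x' * y = y * x') (h : x * y - y * x + z = 0) :
    (c • x + x') * (c' • y + y') - (c' • y + y') * (c • x + x')
      = -((c * c') • z) + (x' * y' - y' * x') := by
  have hz : z = -(x * y - y * x) := eq_neg_of_add_eq_zero_right h
  rw [hz]
  simp only [add_mul, mul_add, smul_mul_assoc, mul_smul_comm, h₁, h₂]
  module

theorem foldr_reverse_qcomm (q : K) (a b : A) (l : List ℤ) :
    l.reverse.foldl (fun x c => a * x - q ^ c • (x * a)) b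
      = l.foldr (fun c x => a * x - q ^ c • (x * a)) b := by
  rw [List.foldl_reverse]

end qcomm

variable {q : K}

theorem qcomm_of_cancels (hq : q ≠ 0) {d : ℤ} {a b : Poly} (h : cancels [d] a b [] = true) :
    evalP q a * evalP q b = q ^ d • (evalP q b * evalP q a) :=
  eq_of_sub_add_zero (evalP_nil q) (eq_zero_of_cancels hq h)

theorem serre_evalP (hq : q ≠ 0) {i j : Fin 4} (hij : i ≠ j) {a b : Poly}
    (h : cancels (serreExps i j).reverse a b [] = true) :
    serre q i j (evalP q a) (evalP q b) = 0 := by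
  have := eq_zero_of_cancels hq h
  rw [evalP_nil, foldr_reverse_qcomm, ← serre_eq_foldr hq hij] at this
  exact (add_zero _).symm.trans this

/-- Setting `f_4 = 0` is compatible with the Serre relations, since each of their terms contains
both generators involved. -/
theorem serre_letter {i j : Fin 4} (hij : i ≠ j) (b : Bool) :
    serre q i j (letter q (b, i)) (letter q (b, j)) = 0 := by
  cases b
  · by_cases hi : i = 3
    · subst hi
      have e : letter q (false, 3) = (0 : K) • letter q (false, 3) := by simp [letter, toB3]
      have hn : (1 - cartan 3 j).toNat ≠ 0 := by
        revert j
        decide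
      rw [e, ← one_smul K (letter q (false, j)), serre_smul, zero_pow hn, zero_mul, zero_smul]
    by_cases hj : j = 3
    · subst hj
      have e : letter q (false, 3) = (0 : K) • letter q (false, 3) := by simp [letter, toB3]
      rw [e, ← one_smul K (letter q (false, i)), serre_smul, mul_zero, zero_smul]
    · have hi' : toB3 i = some (.f ⟨i, hi⟩) := dif_pos hi
      have hj' : toB3 j = some (.f ⟨j, hj⟩) := dif_pos hj
      simpa [letter, hi', hj'] using
        serre_gen_f q (S := nodesB3) ⟨i, hi⟩ ⟨j, hj⟩ fun h => hij (congrArg Subtype.val h)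
  · exact serre_gen_e q i j hij

theorem xmon_zero_commute (hq : q ≠ 0) (α β : Expo) : Commute (xmon q α 0) (xmon q β 0) := by
  have h : ∀ α β : Expo, xmon q α 0 * xmon q β 0 = xmon q (α + β) 0 := fun α β => by
    simp [xmon_mul hq]
  rw [Commute, SemiconjBy, h, h, add_comm]

theorem serre_tailP (hq : q ≠ 0) {i j : Fin 4} (hij : i ≠ j) (b : Bool) :
    serre q i j (evalP q (tailP b i)) (evalP q (tailP b j)) = 0 := by
  rw [evalP_tailP, evalP_tailP, serre_mul_of_commute q i j (xmon_zero_commute hq _ _),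
    serre_letter hij, TensorProduct.tmul_zero]

/-- `serre_add` is applied twice, to `(P⁺ + T) + P⁻` and then to `P⁺ + T`. The three resulting Serre
expressions vanish separately. -/
theorem serre_gval (hq0 : q ≠ 0) (b : Bool) {i j : Fin 4} (hij : i ≠ j) :
    serre q i j (gval q b i) (gval q b j) = 0 := by
  have pm : ∀ i j, evalP q (signP 1 b i) * evalP q (signP (-1) b j)
      = q ^ (dd i * cartan i j) • (evalP q (signP (-1) b j) * evalP q (signP 1 b i)) :=
    fun i j => qcomm_of_cancels hq0 (cancels_signP b i j)
  have pt : ∀ i j, evalP q (signP 1 b i) * evalP q (tailP b j)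
      = q ^ (dd i * cartan i j) • (evalP q (tailP b j) * evalP q (signP 1 b i)) :=
    fun i j => evalP_qcommute hq0 (qcommute_tailP b i j).1
  have tm : ∀ i j, evalP q (tailP b i) * evalP q (signP (-1) b j)
      = q ^ (dd i * cartan i j) • (evalP q (signP (-1) b j) * evalP q (tailP b i)) :=
    fun i j => evalP_qcommute hq0 (qcommute_tailP b i j).2
  have hii : dd i * 2 = dd i * cartan i i := by rw [cartan_self]
  have hji : dd i * cartan i j = dd j * cartan j i := dd_symm i j
  rw [gval, gval, serre_add hq0 hij, serre_add hq0 hij, serre_tailP hq0 hij, serre_smul,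
    serre_smul, serre_evalP hq0 hij (cancels_serre b i j hij),
    serre_evalP hq0 hij (cancels_serre_neg b i j hij)]
  · simp only [smul_zero, add_zero]
  · rw [hii, ← one_smul K (evalP q (tailP b i))]
    exact smul_qcomm (pt i i) _ _
  · rw [← one_smul K (evalP q (tailP b j))]
    exact smul_qcomm (pt i j) _ _
  · rw [hji, ← one_smul K (evalP q (tailP b i))]
    exact smul_qcomm (pt j i) _ _
  · rw [hii, ← one_smul K (evalP q (tailP b i))]
    exact add_left_qcomm (smul_qcomm (pm i i) _ _) (smul_qcomm (tm i i) _ _)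
  · rw [← one_smul K (evalP q (tailP b i))]
    exact add_left_qcomm (smul_qcomm (pm i j) _ _) (smul_qcomm (tm i j) _ _)
  · rw [hji, ← one_smul K (evalP q (tailP b j))]
    exact add_left_qcomm (smul_qcomm (pm j i) _ _) (smul_qcomm (tm j i) _ _)

theorem gval_eq (b : Bool) (i : Fin 4) : gval q b i
    = (q ^ dd i - q ^ (-dd i))⁻¹ • evalP q (signsP b i) + evalP q (tailP b i) := by
  rw [gval, signsP, evalP_append, smul_add, add_right_comm]

theorem tMon_eval_mul_gval (hq : q ≠ 0) (b : Bool) (i j : Fin 4) :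
    (tMon 1 i).eval q * gval q b j = q ^ (if b then dd i * cartan i j else -(dd i * cartan i j)) •
      (gval q b j * (tMon 1 i).eval q) := by
  have e : (tMon 1 i).eval q = (1 : K) • evalP q [(1, tMon 1 i)] := by
    rw [evalP_singleton, Int.cast_one, one_smul, one_smul]
  rw [e, gval_eq, ← one_smul K (evalP q (tailP b j))]
  exact add_right_qcomm (smul_qcomm (qcomm_of_cancels hq (cancels_tMon b i j)) _ _)
    (smul_qcomm (evalP_qcommute hq (qcommute_tMon_tailP b i j)) _ _)

theorem tMon_eval_one (hq : q ≠ 0) (i : Fin 4) :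
    (tMon 1 i).eval q * (tMon (-1) i).eval q = 1 ∧ (tMon (-1) i).eval q * (tMon 1 i).eval q = 1 := by
  have h : (⟨0, lcomb [], lcomb [], [0, 0, 0, 0], []⟩ : Mon).eval q = 1 := by
    have : vec4 [0, 0, 0, 0] = 0 := by
      funext k
      fin_cases k <;> rfl
    simp only [Mon.eval, vec_lcomb_nil, this, xmon_zero, tmon_zero, wordVal, List.map_nil,
      List.prod_nil, zpow_zero, one_smul, mul_one]
    rfl
  rw [← Mon.eval_mul hq, ← Mon.eval_mul hq, (tMon_mul i).1, (tMon_mul i).2.1, h]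
  exact ⟨rfl, rfl⟩

theorem gval_commutator_tail (i j : Fin 4) :
    evalP q (tailP true i) * evalP q (tailP false j)
        - evalP q (tailP false j) * evalP q (tailP true i)
      = xmon q (vec (tailExp false j)) 0 ⊗ₜ[K]
        (letter q (true, i) * letter q (false, j) - letter q (false, j) * letter q (true, i)) := by
  rw [evalP_tailP, evalP_tailP, Algebra.TensorProduct.tmul_mul_tmul,
    Algebra.TensorProduct.tmul_mul_tmul, TensorProduct.tmul_sub, tailExp, vec_lcomb_nil, xmon_zero,
    one_mul, mul_one]

theorem letter_commutator_ne {i j : Fin 4} (h : i ≠ j ∨ j = 3) :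
    letter q (true, i) * letter q (false, j) - letter q (false, j) * letter q (true, i) = 0 := by
  by_cases hj : j = 3
  · subst hj
    simp [letter, toB3]
  · have hj' : toB3 j = some (.f ⟨j, hj⟩) := dif_pos hj
    simpa [letter, hj'] using e_f_comm_ne q (S := nodesB3) i ⟨j, hj⟩ (h.resolve_right hj)

theorem letter_commutator_self {i : Fin 4} (h : i ≠ 3) :
    letter q (true, i) * letter q (false, i) - letter q (false, i) * letter q (true, i)
      = (q ^ dd i - q ^ (-dd i))⁻¹ • (gen q (.t i) - gen q (.tinv i)) := by
  have h' : toB3 i = some (.f ⟨i, h⟩) := dif_pos h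
  simpa [letter, h'] using e_f_comm_self q (S := nodesB3) ⟨i, h⟩

theorem gval_commutator (hq : q ≠ 0) (i j : Fin 4) :
    gval q true i * gval q false j - gval q false j * gval q true i
      = -(((q ^ dd i - q ^ (-dd i))⁻¹ * (q ^ dd j - q ^ (-dd j))⁻¹) • evalP q (efDefect i j))
        + xmon q (vec (tailExp false j)) 0 ⊗ₜ[K]
        (letter q (true, i) * letter q (false, j) - letter q (false, j) * letter q (true, i)) := by
  rw [gval_eq, gval_eq, ← gval_commutator_tail]
  refine commutator_expand _ _ ?_ ?_ ?_
  · have := evalP_qcommute hq (qcommute_signsP_tailP i j).1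
    rwa [zpow_zero, one_smul] at this
  · have := evalP_qcommute hq (qcommute_signsP_tailP i j).2
    rwa [zpow_zero, one_smul] at this
  · have := eq_zero_of_cancels hq (cancels_efDefect i j)
    rwa [List.foldl_cons, List.foldl_nil, zpow_zero, one_smul] at this

theorem evalP_scaleD (hq : q ≠ 0) (d : ℤ) (p : Poly) :
    evalP q (scaleD d p) = (q ^ d - q ^ (-d)) • evalP q p := by
  rw [scaleD, evalP_append, evalP_scale hq, evalP_scale hq, ← add_smul]
  congr 1
  push_cast
  ring

theorem gval_commutator_ne (hq : q ≠ 0) {i j : Fin 4} (h : i ≠ j) :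
    gval q true i * gval q false j - gval q false j * gval q true i = 0 := by
  rw [gval_commutator hq, letter_commutator_ne (Or.inl h), TensorProduct.tmul_zero, efDefect,
    if_neg h, evalP_nil, smul_zero, neg_zero, add_zero]

theorem commutator_collect {M : Type*} [AddCommGroup M] [Module K M] {D : K} (hD : D ≠ 0)
    (t t' u : M) : -((D⁻¹ * D⁻¹) • (D • ((-1 : K) • t + (1 : K) • t') + D • u)) + D⁻¹ • u
      = D⁻¹ • (t - t') := by
  match_scalars <;> field_simp
  ring

/-- The excess term of `efDefect` cancels against the commutator of the parts `T`, which the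
relation between `e_i` and `f_i` in the small algebra provides. For `i = 4` both are absent. -/
theorem gval_commutator_self (hq0 : q ≠ 0) (hq4 : q ^ 4 ≠ 1) (i : Fin 4) :
    gval q true i * gval q false i - gval q false i * gval q true i
      = (q ^ dd i - q ^ (-dd i))⁻¹ • ((tMon 1 i).eval q - (tMon (-1) i).eval q) := by
  have hD := sub_dd_ne_zero hq0 hq4 i
  have hT : evalP q [(-1, tMon 1 i), (1, tMon (-1) i)]
      = (-1 : K) • (tMon 1 i).eval q + (1 : K) • (tMon (-1) i).eval q := by
    rw [evalP_cons, evalP_singleton]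
    simp only [Int.cast_neg, Int.cast_one]
  rw [gval_commutator hq0, efDefect, if_pos rfl, evalP_append, evalP_scaleD hq0, hT,
    -- The excess term has to be supplied, because it does not occur in the target.
    ← commutator_collect (M := Weyl15 q ⊗[K] Uq q nodesB3) hD _ _
      (xmon q (vec (tailExp false i)) 0 ⊗ₜ[K]
        (if i = 3 then (0 : Uq q nodesB3) else gen q (.t i) - gen q (.tinv i)))]
  split_ifs with h
  · rw [letter_commutator_ne (Or.inr h), TensorProduct.tmul_zero, evalP_nil, smul_zero, smul_zero]
  · rw [letter_commutator_self h, TensorProduct.tmul_smul, evalP_scaleD hq0]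
    congr 6
    simp only [evalP_cons, evalP_nil, Mon.eval, vec_lcomb_nil, vec4_unitL, tmon_single,
      tU_zpow_one, tU_zpow_neg_one, wordVal, List.map_nil, List.prod_nil, one_mul, zpow_zero,
      one_smul, Int.cast_one, Int.cast_neg, add_zero]
    rw [TensorProduct.tmul_sub, sub_eq_add_neg]
    congr 1

theorem map_relations (hq0 : q ≠ 0) (hq4 : q ^ 4 ≠ 1)
    {a b : FreeAlgebra K (Gen (Set.univ : Set (Fin 4)))} (h : UqRel q Set.univ a b) :
    FreeAlgebra.lift K (fun s => Om q nodesB3 (relExpr q s)) a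
      = FreeAlgebra.lift K (fun s => Om q nodesB3 (relExpr q s)) b := by
  have hf := Om_relExpr_f hq0 hq4
  cases h with
  | t_comm i j =>
    simp only [map_mul, FreeAlgebra.lift_ι_apply, Om_relExpr_t]
    rw [← Mon.eval_mul hq0, (tMon_mul i).2.2, Mon.eval_mul hq0]
  | t_tinv i =>
    simp only [map_mul, map_one, FreeAlgebra.lift_ι_apply, Om_relExpr_t, Om_relExpr_tinv]
    exact (tMon_eval_one hq0 i).1
  | tinv_t i =>
    simp only [map_mul, map_one, FreeAlgebra.lift_ι_apply, Om_relExpr_t, Om_relExpr_tinv]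
    exact (tMon_eval_one hq0 i).2
  | t_e i j =>
    simp only [map_mul, map_smul, FreeAlgebra.lift_ι_apply, Om_relExpr_t, Om_relExpr_tinv,
      Om_relExpr_e]
    rw [tMon_eval_mul_gval hq0, smul_mul_assoc, mul_assoc, (tMon_eval_one hq0 i).1, mul_one]
    rfl
  | t_f i j =>
    obtain ⟨j, _⟩ := j
    simp only [map_mul, map_smul, FreeAlgebra.lift_ι_apply, Om_relExpr_t, Om_relExpr_tinv, hf]
    rw [tMon_eval_mul_gval hq0, smul_mul_assoc, mul_assoc, (tMon_eval_one hq0 i).1, mul_one]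
    rfl
  | e_f_ne i j h =>
    obtain ⟨j, _⟩ := j
    simp only [map_mul, map_sub, map_zero, FreeAlgebra.lift_ι_apply, Om_relExpr_e, hf]
    exact gval_commutator_ne hq0 h
  | e_f i =>
    obtain ⟨i, _⟩ := i
    simp only [map_mul, map_sub, map_smul, FreeAlgebra.lift_ι_apply, Om_relExpr_e, hf,
      Om_relExpr_t, Om_relExpr_tinv]
    exact gval_commutator_self hq0 hq4 i
  | serre_e i j h =>
    simp only [map_serre, map_zero, FreeAlgebra.lift_ι_apply, Om_relExpr_e]
    exact serre_gval hq0 true h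
  | serre_f i j h =>
    obtain ⟨i, _⟩ := i
    obtain ⟨j, _⟩ := j
    simp only [map_serre, map_zero, FreeAlgebra.lift_ι_apply, hf]
    exact serre_gval hq0 false fun e => h (Subtype.ext e)

/-- The homomorphism `ρ`. -/
def rhoHom (hq0 : q ≠ 0) (hq4 : q ^ 4 ≠ 1) :
    Uq q (Set.univ : Set (Fin 4)) →ₐ[K] Weyl15 q ⊗[K] Uq q nodesB3 :=
  RingQuot.liftAlgHom K ⟨FreeAlgebra.lift K fun s => Om q nodesB3 (relExpr q s),
    fun _ _ h => map_relations hq0 hq4 h⟩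

theorem rhoHom_gen (hq0 : q ≠ 0) (hq4 : q ^ 4 ≠ 1) (s : Gen (Set.univ : Set (Fin 4))) :
    rhoHom hq0 hq4 (gen q s) = Om q nodesB3 (relExpr q s) := by
  rw [rhoHom, gen]
  erw [RingQuot.liftAlgHom_mkAlgHom_apply]
  exact FreeAlgebra.lift_ι_apply _ _

theorem Uq.algHom_ext {S : Set (Fin 4)} {A : Type*} [Semiring A] [Algebra K A]
    {φ ψ : Uq q S →ₐ[K] A} (h : ∀ s, φ (gen q s) = ψ (gen q s)) : φ = ψ :=
  RingQuot.ringQuot_ext' K φ ψ (FreeAlgebra.hom_ext (funext h))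

end

end QuantumF4

namespace QuantumF4

noncomputable section

variable {K : Type u} [Field K]

/-! ### The representations -/

/-! ### Eigenvectors, powers of units and tensor products -/

section general

/-- Vectors with pairwise different systems of eigenvalues whose sum is zero vanish. -/
theorem eq_zero_of_add_sum_eq_zero {ι M : Type*} [AddCommGroup M] [Module K M]
    (T : ι → M →ₗ[K] M) : ∀ (l : List (M × (ι → K))) (y : M) (μ : ι → K),
      (∀ k, T k y = μ k • y) → (∀ p ∈ l, ∀ k, T k p.1 = p.2 k • p.1) → (∀ p ∈ l, p.2 ≠ μ) →
      y + (l.map Prod.fst).sum = 0 → y = 0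
  | [], y, _, _, _, _, h => by simpa using h
  | p :: l, y, μ, hy, hl, hμ, h => by
    obtain ⟨k, hk⟩ := Function.ne_iff.mp (hμ p List.mem_cons_self)
    -- This operator kills the first vector of the list, multiplies `y` by a nonzero scalar and
    -- keeps the other vectors eigenvectors of all `T j`.
    set S : M →ₗ[K] M := T k - p.2 k • LinearMap.id with hS
    have hSv : ∀ (x : M) (c : K), T k x = c • x → S x = (c - p.2 k) • x := fun x c hx => by
      simp [hS, hx, sub_smul]
    have hp : S p.1 = 0 := by
      rw [hSv _ _ (hl p List.mem_cons_self k), sub_self, zero_smul]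
    have hsum : S y + ((l.map fun p => (S p.1, p.2)).map Prod.fst).sum = 0 := by
      have := congrArg S h
      rw [map_add, List.map_cons, List.sum_cons, map_add, hp, zero_add, map_list_sum, map_zero,
        List.map_map] at this
      rw [List.map_map]
      exact this
    have hSy : S y = 0 := by
      refine eq_zero_of_add_sum_eq_zero T _ (S y) μ ?_ ?_ ?_ hsum
      · intro j
        rw [hSv _ _ (hy k), map_smul, hy j, smul_comm]
      · intro p' hp' j
        obtain ⟨p'', hp'', rfl⟩ := List.mem_map.mp hp'
        have := hl p'' (List.mem_cons_of_mem _ hp'')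
        simp only
        rw [hSv _ _ (this k), map_smul, this j, smul_comm]
      · intro p' hp'
        obtain ⟨p'', hp'', rfl⟩ := List.mem_map.mp hp'
        exact hμ p'' (List.mem_cons_of_mem _ hp'')
    rw [hSv _ _ (hy k)] at hSy
    exact (smul_eq_zero.mp hSy).resolve_left (sub_ne_zero.mpr hk.symm)
termination_by l => l.length

theorem eq_zero_of_sum_eq_zero {ι M : Type*} [AddCommGroup M] [Module K M]
    (T : ι → M →ₗ[K] M) : ∀ l : List (M × (ι → K)), (∀ p ∈ l, ∀ k, T k p.1 = p.2 k • p.1) →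
      l.Pairwise (fun p p' => p'.2 ≠ p.2) → (l.map Prod.fst).sum = 0 → ∀ p ∈ l, p.1 = 0
  | [], _, _, _, _, hp => by simp at hp
  | p :: l, hl, hd, h, p', hp' => by
    rw [List.pairwise_cons] at hd
    have h0 : p.1 = 0 := eq_zero_of_add_sum_eq_zero T l p.1 p.2 (hl p List.mem_cons_self)
      (fun p hp => hl p (List.mem_cons_of_mem _ hp)) hd.1 h
    rcases List.mem_cons.mp hp' with rfl | hp'
    · exact h0
    · rw [List.map_cons, List.sum_cons, h0, zero_add] at h
      exact eq_zero_of_sum_eq_zero T l (fun p hp => hl p (List.mem_cons_of_mem _ hp)) hd.2 h p' hp'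

theorem units_zpow_of_smul {A : Type*} [Ring A] [Algebra K A] (c : Kˣ) {x y : Aˣ}
    (h : (x : A) = (c : K) • (y : A)) (n : ℤ) :
    ((x ^ n : Aˣ) : A) = ((c ^ n : Kˣ) : K) • ((y ^ n : Aˣ) : A) := by
  have h' : x = Units.map (algebraMap K A).toMonoidHom c * y := Units.ext (by
    rw [h, Algebra.smul_def]
    rfl)
  have hc : Commute (Units.map (algebraMap K A).toMonoidHom c) y :=
    Units.ext (Algebra.commutes (c : K) (y : A))
  rw [h', hc.mul_zpow, ← map_zpow, Units.val_mul, Algebra.smul_def]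
  rfl

/-- Two sums of vectors with pairwise different systems of eigenvalues agree only if the summands
do. -/
theorem eq_of_sum_eq_sum {ι M : Type*} [AddCommMonoid M] [Module K M] (T : ι → M →ₗ[K] M)
    (l : List (M × M × (ι → K)))
    (hl : ∀ p ∈ l, ∀ k, T k p.1 = p.2.2 k • p.1 ∧ T k p.2.1 = p.2.2 k • p.2.1)
    (hd : l.Pairwise fun p p' => p'.2.2 ≠ p.2.2)
    (h : (l.map fun p => p.1).sum = (l.map fun p => p.2.1).sum) : ∀ p ∈ l, p.1 = p.2.1 := by
  let _ : AddCommGroup M := Module.addCommMonoidToAddCommGroup K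
  intro p hp
  have := eq_zero_of_sum_eq_zero T (l.map fun p => (p.1 - p.2.1, p.2.2)) ?_ ?_ ?_
    (p.1 - p.2.1, p.2.2) (List.mem_map_of_mem hp)
  · exact sub_eq_zero.mp this
  · intro p hp k
    obtain ⟨p', hp', rfl⟩ := List.mem_map.mp hp
    rw [map_sub, (hl p' hp' k).1, (hl p' hp' k).2, smul_sub]
  · exact List.pairwise_map.mpr hd
  · rw [List.map_map, ← sub_eq_zero.mpr h]
    clear hl hd h hp p
    induction l with
    | nil => simp
    | cons p l ih =>
      simp only [List.map_cons, List.sum_cons, ih, Function.comp_apply]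
      abel

/-- Evaluate at `w ⊗ v` and contract the first factor with a linear form that does not vanish at
`w`. -/
theorem eq_of_map_id_eq {M : Type*} [AddCommGroup M] [Module K M] [Nontrivial M]
    {V : Type*} [AddCommGroup V] [Module K V] {B B' : Module.End K V}
    (h : TensorProduct.map (LinearMap.id : M →ₗ[K] M) B = TensorProduct.map LinearMap.id B') :
    B = B' := by
  obtain ⟨w, hw⟩ := exists_ne (0 : M)
  obtain ⟨φ, hφ⟩ : ∃ φ : Module.Dual K M, φ w ≠ 0 := by
    by_contra hc
    push Not at hc
    exact hw ((Module.forall_dual_apply_eq_zero_iff K w).mp hc)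
  ext v
  have h1 := congrArg (fun L => TensorProduct.lid K V (TensorProduct.map φ LinearMap.id (L (w ⊗ₜ v))))
    h
  simp only [TensorProduct.map_tmul, LinearMap.id_apply, TensorProduct.lid_tmul] at h1
  exact smul_right_injective V hφ h1

end general

theorem rank_space (N : ℕ) (V : Type v) [AddCommGroup V] [Module K V] :
    Module.rank K (Space K N ⊗[K] V) = (N : Cardinal) ^ 15 * Cardinal.lift.{u} (Module.rank K V) := by
  have h : Module.rank K (Space K N) = (N : Cardinal.{u}) ^ 15 := by
    have b := Basis.piTensorProduct fun _ : Fin 15 => Pi.basisFun K (Fin N)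
    rw [rank_eq_card_basis b]
    simp
  rw [rank_tensorProduct, h, ← Nat.cast_pow, Cardinal.lift_natCast, Nat.cast_pow]

theorem space_nontrivial (N : ℕ) [NeZero N] : Nontrivial (Space K N) := by
  have b := Basis.piTensorProduct fun _ : Fin 15 => Pi.basisFun K (Fin N)
  exact b.repr.toEquiv.nontrivial

theorem space_tensor_nontrivial (N : ℕ) [NeZero N] (V : Type v) [AddCommGroup V] [Module K V]
    [Nontrivial V] : Nontrivial (Space K N ⊗[K] V) := by
  by_contra h
  rw [not_nontrivial_iff_subsingleton] at h
  have h0 := rank_space (K := K) N V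
  rw [rank_subsingleton'] at h0
  rcases mul_eq_zero.mp h0.symm with h1 | h1
  · exact NeZero.ne N (by exact_mod_cast pow_eq_zero_iff (n := 15) (by norm_num) |>.mp h1)
  · rw [Cardinal.lift_eq_zero] at h1
    exact (rank_pos_iff_nontrivial.mpr ‹Nontrivial V›).ne' h1

/-! ### Dependence of the representations on the parameters -/

variable {q : K}

/-- The scalar by which `∏ x_k^{α_k} z_k^{-r_k}` changes when the parameters are multiplied by
`u_k` and `v_k`. -/
def chi (u v : Fin 15 → Kˣ) (α r : Expo) : Kˣ := ∏ k, u k ^ α k * v k ^ (-r k)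

theorem chi_add (u v : Fin 15 → Kˣ) (α r β s : Expo) :
    chi u v (α + β) (r + s) = chi u v α r * chi u v β s := by
  rw [chi, chi, chi, ← Finset.prod_mul_distrib]
  refine Finset.prod_congr rfl fun k _ => ?_
  simp only [Pi.add_apply, neg_add, zpow_add]
  exact mul_mul_mul_comm _ _ _ _

theorem chi_zero (u v : Fin 15 → Kˣ) : chi u v 0 0 = 1 := by
  simp [chi]

theorem chi_neg (u v : Fin 15 → Kˣ) (α r : Expo) : chi u v (-α) (-r) = (chi u v α r)⁻¹ := by
  rw [eq_inv_iff_mul_eq_one, ← chi_add, neg_add_cancel, neg_add_cancel, chi_zero]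

section sigma

variable (N : ℕ) [NeZero N] (hN : q ^ N = 1)

theorem sigma_x (g h : Kˣ) : sigma q N hN g h (Weyl.x q : Weyl q) = shiftMat N (g : K) := by
  rw [sigma, Weyl.x]
  erw [RingQuot.liftAlgHom_mkAlgHom_apply]
  exact FreeAlgebra.lift_ι_apply _ _

theorem sigma_z (g h : Kˣ) : sigma q N hN g h (Weyl.z q : Weyl q) = clockMat q N (h : K) := by
  rw [sigma, Weyl.z]
  erw [RingQuot.liftAlgHom_mkAlgHom_apply]
  exact FreeAlgebra.lift_ι_apply _ _

/-- The parameters only rescale the matrices of `x` and `z`, so they rescale every monomial. -/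
theorem sigma_wmon (g h g' h' : Kˣ) (a r : ℤ) :
    sigma q N hN g h (wmon q a r)
      = (((g / g') ^ a * (h / h') ^ (-r) : Kˣ) : K) • sigma q N hN g' h' (wmon q a r) := by
  have hx : sigma q N hN g h (Weyl.x q : Weyl q)
      = ((g / g' : Kˣ) : K) • sigma q N hN g' h' (Weyl.x q : Weyl q) := by
    rw [sigma_x, sigma_x]
    ext i j
    simp [shiftMat]
  have hz : sigma q N hN g h (Weyl.z q : Weyl q)
      = ((h / h' : Kˣ) : K) • sigma q N hN g' h' (Weyl.z q : Weyl q) := by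
    rw [sigma_z, sigma_z, clockMat, clockMat, ← Matrix.diagonal_smul]
    congr 1
    ext i
    simp
    field_simp
  have hx' := units_zpow_of_smul (g / g') (x := Units.map (sigma q N hN g h : Weyl q →* Matrix (Fin N) (Fin N) K) (Weyl.x q))
    (y := Units.map (sigma q N hN g' h' : Weyl q →* Matrix (Fin N) (Fin N) K) (Weyl.x q)) hx a
  have hz' := units_zpow_of_smul (h / h') (x := Units.map (sigma q N hN g h : Weyl q →* Matrix (Fin N) (Fin N) K) (Weyl.z q))
    (y := Units.map (sigma q N hN g' h' : Weyl q →* Matrix (Fin N) (Fin N) K) (Weyl.z q)) hz (-r)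
  rw [← map_zpow, ← map_zpow] at hx' hz'
  rw [wmon, Units.val_mul, map_mul, map_mul, Units.val_mul, ← smul_mul_smul_comm]
  exact congrArg₂ (· * ·) hx' hz'

theorem sigma15_xmon (g h g' h' : Fin 15 → Kˣ) (α r : Expo) :
    sigma15 q N hN g h (xmon q α r)
      = (chi (g / g') (h / h') α r : K) • sigma15 q N hN g' h' (xmon q α r) := by
  have key : ∀ g h : Fin 15 → Kˣ, sigma15 q N hN g h (xmon q α r)
      = PiTensorProduct.mapMultilinear K (fun _ : Fin 15 => Fin N → K) (fun _ : Fin 15 => Fin N → K)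
        fun k => Matrix.toLinAlgEquiv' (sigma q N hN (g k) (h k) (wmon q (α k) (r k))) := by
    intro g h
    rw [sigma15, PiTensorProduct.liftAlgHom_apply, xmon, PiTensorProduct.lift.tprod]
    rfl
  rw [key, key]
  have e : (fun k => Matrix.toLinAlgEquiv' (sigma q N hN (g k) (h k) (wmon q (α k) (r k))))
      = fun k => (((g k / g' k) ^ α k * (h k / h' k) ^ (-r k) : Kˣ) : K) •
        Matrix.toLinAlgEquiv' (sigma q N hN (g' k) (h' k) (wmon q (α k) (r k))) :=
    funext fun k => by rw [sigma_wmon N hN (g k) (h k) (g' k) (h' k), map_smul]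
  rw [e, MultilinearMap.map_smul_univ, chi]
  congr 1

variable {V : Type v} [AddCommGroup V] [Module K V]

/-- The representation `σ_{gh} ⊗ ρbar`. -/
def psi (g h : Fin 15 → Kˣ) (ρbar : Uq q nodesB3 →ₐ[K] Module.End K V) :
    Weyl15 q ⊗[K] Uq q nodesB3 →ₐ[K] Module.End K (Space K N ⊗[K] V) :=
  (idRep N ρbar).comp (sigmaId q nodesB3 N hN g h)

theorem psi_tmul (g h : Fin 15 → Kˣ) (ρbar : Uq q nodesB3 →ₐ[K] Module.End K V) (m : Weyl15 q)
    (y : Uq q nodesB3) :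
    psi N hN g h ρbar (m ⊗ₜ[K] y) = TensorProduct.map (sigma15 q N hN g h m) (ρbar y) := rfl

theorem psi_xmon_tmul (g h g' h' : Fin 15 → Kˣ) (ρbar : Uq q nodesB3 →ₐ[K] Module.End K V)
    (α r : Expo) (y : Uq q nodesB3) :
    psi N hN g h ρbar (xmon q α r ⊗ₜ[K] y)
      = (chi (g / g') (h / h') α r : K) • psi N hN g' h' ρbar (xmon q α r ⊗ₜ[K] y) := by
  rw [psi_tmul, psi_tmul, sigma15_xmon N hN g h g' h', TensorProduct.map_smul_left]

theorem xmon_mul_neg (hq : q ≠ 0) (α r : Expo) :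
    xmon q (-α) (-r) * xmon q α r = q ^ (-∑ k, r k * α k) • (1 : Weyl15 q) := by
  rw [xmon_mul hq, neg_add_cancel, neg_add_cancel, xmon_zero]
  simp

/-- The monomial in the first factor is invertible up to a power of `q`; multiplying by its inverse
leaves `id ⊗ ρbar y`. -/
theorem rho_eq_of_psi_eq (hq : q ≠ 0) (g h : Fin 15 → Kˣ)
    {ρbar ρbar' : Uq q nodesB3 →ₐ[K] Module.End K V} {α r : Expo} {y y' : Uq q nodesB3}
    (h0 : psi N hN g h ρbar (xmon q α r ⊗ₜ[K] y) = psi N hN g h ρbar' (xmon q α r ⊗ₜ[K] y')) :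
    ρbar y = ρbar' y' := by
  have := space_nontrivial (K := K) N
  have e : ∀ (ρ : Uq q nodesB3 →ₐ[K] Module.End K V) (y : Uq q nodesB3),
      TensorProduct.map LinearMap.id (ρ y) = q ^ (∑ k, r k * α k) •
        (TensorProduct.map (sigma15 q N hN g h (xmon q (-α) (-r))) LinearMap.id
          * psi N hN g h ρ (xmon q α r ⊗ₜ[K] y)) := by
    intro ρ y
    rw [psi_tmul, ← TensorProduct.map_mul, ← map_mul, xmon_mul_neg hq, map_smul, map_one,
      TensorProduct.map_smul_left, smul_smul, ← zpow_add₀ hq, add_neg_cancel, zpow_zero, one_smul]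
    rfl
  exact eq_of_map_id_eq ((e ρbar y).trans (h0 ▸ (e ρbar' y').symm))

end sigma

end

end QuantumF4

namespace QuantumF4

noncomputable section

variable {K : Type u} [Field K]

/-! ### Finiteness of the fibres -/

section data

/-- Two monomials in the `x_k` and `z_k` have different commutation relations with the generators
if `q ^ 4 ≠ 1`. -/
abbrev Separated (m m' : List ℤ × List ℤ) : Prop :=
  ∃ k : Fin 15, vec m.1 k - vec m'.1 k ∣ 4 ∨ vec m.2 k - vec m'.2 k ∣ 4

/-- The trivial pair of exponents stands for the term `1 ⊗ e_i`. A difference that divides 4 is what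
`q ^ 4 ≠ 1` can detect. -/
theorem separated_signsP : ∀ i, ((lcomb [], lcomb []) ::
    (signsP true i).map fun p => (p.2.a, p.2.r)).Pairwise Separated := by
  decide +kernel

/-- This is the term arising when `e_i` meets the `a`-th factor: the new `t_i` passes only the later
factors. Compared with `t_i` passing all of `y₄`, the exponents differ only up to position `a`, and
there by `2 d_i - d_i`. -/
theorem eExps_triangular : ∀ a, ∃ p ∈ eExps (node a) y4, p.1 = lcomb [(-1, a)] ∧
    vec p.2 a - vec (tExpL (node a) y4) a = dd (node a) ∧
    ∀ k, a < k → vec p.2 k = vec (tExpL (node a) y4) k := by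
  decide +kernel

theorem signsP_coeff (i : Fin 4) (p : ℤ × Mon) (hp : p ∈ signsP true i) :
    (p.1 = 1 ∨ p.1 = -1) ∧ p.2.w = [] := by
  rcases List.mem_append.mp hp with h | h <;>
  · obtain ⟨p, -, rfl⟩ := List.mem_map.mp h
    simp

theorem mem_signsP {i : Fin 4} {p : List ℤ × List ℤ} (hp : p ∈ eExps i y4) {s : ℤ}
    (hs : s = 1 ∨ s = -1) :
    (s, (⟨s * dd i, p.1, p.2.map (s * ·), unitL i s, []⟩ : Mon)) ∈ signsP true i := by
  rcases hs with rfl | rfl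
  · exact List.mem_append_left _ (List.mem_map_of_mem (f := fun p : List ℤ × List ℤ =>
      ((1 : ℤ), (⟨1 * dd i, p.1, p.2.map (1 * ·), unitL i 1, []⟩ : Mon))) hp)
  · exact List.mem_append_right _ (List.mem_map_of_mem (f := fun p : List ℤ × List ℤ =>
      ((-1 : ℤ), (⟨-1 * dd i, p.1, p.2.map (-1 * ·), unitL i (-1), []⟩ : Mon))) hp)

end data

variable {q : K}

theorem zpow_ne_of_dvd_four (hq0 : q ≠ 0) (hq4 : q ^ 4 ≠ 1) {m n : ℤ} (h : m - n ∣ 4) :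
    q ^ m ≠ q ^ n := by
  intro e
  obtain ⟨c, hc⟩ := h
  apply hq4
  have h1 : q ^ (m - n) = 1 := by
    rw [zpow_sub₀ hq0, e, div_self (zpow_ne_zero _ hq0)]
  have : q ^ (4 : ℤ) = 1 := by rw [hc, zpow_mul, h1, one_zpow]
  exact_mod_cast this

theorem smul_eigenvector {M : Type*} [AddCommMonoid M] [Module K M] {T : M →ₗ[K] M} {y : M} {d : K}
    (h : T y = d • y) (c : K) : T (c • y) = d • c • y := by
  rw [map_smul, h, smul_comm]

theorem eq_one_of_smul_one_eq_one {M : Type*} [AddCommMonoid M] [Module K M] [Nontrivial M] {c : K}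
    (h : c • (1 : Module.End K M) = 1) : c = 1 := by
  let _ : AddCommGroup M := Module.addCommMonoidToAddCommGroup K
  obtain ⟨x, hx⟩ := exists_ne (0 : M)
  have h1 : c • x = (1 : K) • x := (congrArg (fun T => T x) h).trans (one_smul K x).symm
  exact smul_left_injective K hx h1

/-- The factor obtained by conjugating `∏ x_k^{α_k} z_k^{-r_k}` with `∏ x_k^{β_k} z_k^{-s_k}`. -/
def conjFactor (q : K) (α r : Expo) (p : Expo × Expo) : K :=
  q ^ (∑ k, p.2 k * α k - ∑ k, p.2 k * p.1 k - ∑ k, r k * p.1 k)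

/-- Conjugation by a power of `z_k` detects the exponent of `x_k`, and conjugation by `x_k` detects
that of `z_k`. -/
theorem conjFactor_ne (hq0 : q ≠ 0) (hq4 : q ^ 4 ≠ 1) {m m' : List ℤ × List ℤ}
    (h : Separated m m') :
    conjFactor q (vec m'.1) (vec m'.2) ≠ conjFactor q (vec m.1) (vec m.2) := by
  obtain ⟨k, hk | hk⟩ := h
  · intro e
    have := congrFun e (0, δ k)
    simp [conjFactor, δ, Pi.single_apply] at this
    exact zpow_ne_of_dvd_four hq0 hq4 hk this.symm
  · intro e
    have := congrFun e (δ k, 0)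
    simp [conjFactor, δ, Pi.single_apply] at this
    exact zpow_ne_of_dvd_four hq0 hq4 hk this.symm

section fibres

variable (hq0 : q ≠ 0) (hq4 : q ^ 4 ≠ 1) (N : ℕ) [NeZero N] (hN : q ^ N = 1)
variable {V : Type v} [AddCommGroup V] [Module K V]

/-- Conjugation with the monomial `∏ x_k^{β_k} z_k^{-s_k}`, up to a power of `q`. -/
def conjMap (V : Type v) [AddCommGroup V] [Module K V] (g h : Fin 15 → Kˣ) (p : Expo × Expo) :
    Module.End K (Space K N ⊗[K] V) →ₗ[K] Module.End K (Space K N ⊗[K] V) :=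
  LinearMap.mulLeft K (TensorProduct.map (sigma15 q N hN g h (xmon q p.1 p.2)) LinearMap.id) ∘ₗ
    LinearMap.mulRight K (TensorProduct.map (sigma15 q N hN g h (xmon q (-p.1) (-p.2)))
      LinearMap.id)

include hq0 in
-- The eigenvalue does not depend on `g'`, `h'` and `ρbar`, since other parameters only multiply the
-- monomial by a scalar. So the same operators separate the terms of two different representations.
theorem conjMap_psi (g h g' h' : Fin 15 → Kˣ) (ρbar : Uq q nodesB3 →ₐ[K] Module.End K V)
    (α r : Expo) (y : Uq q nodesB3) (p : Expo × Expo) :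
    conjMap N hN V g h p (psi N hN g' h' ρbar (xmon q α r ⊗ₜ[K] y))
      = conjFactor q α r p • psi N hN g' h' ρbar (xmon q α r ⊗ₜ[K] y) := by
  have e : xmon q p.1 p.2 * (xmon q α r * xmon q (-p.1) (-p.2))
      = conjFactor q α r p • xmon q α r := by
    rw [xmon_mul hq0, mul_smul_comm, xmon_mul hq0, smul_smul, ← zpow_add₀ hq0, conjFactor]
    congr 2
    · simp only [Pi.add_apply, Pi.neg_apply, mul_add, mul_neg, Finset.sum_add_distrib,
        Finset.sum_neg_distrib]
      ring
    · abel
    · abel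
  rw [psi_xmon_tmul N hN g' h' g h, map_smul, smul_comm, psi_tmul]
  congr 1
  rw [conjMap, LinearMap.comp_apply, LinearMap.mulRight_apply, LinearMap.mulLeft_apply,
    ← TensorProduct.map_mul, ← TensorProduct.map_mul, ← map_mul, ← map_mul, e, map_smul,
    TensorProduct.map_smul_left]
  rfl

include hq0 in
theorem conjMap_psi_eval (g h g' h' : Fin 15 → Kˣ) (ρbar : Uq q nodesB3 →ₐ[K] Module.End K V)
    {m : Mon} (hm : m.w = []) (c : K) (p : Expo × Expo) :
    conjMap N hN V g h p (psi N hN g' h' ρbar (c • m.eval q))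
      = conjFactor q (vec m.a) (vec m.r) p • psi N hN g' h' ρbar (c • m.eval q) := by
  rw [Mon.eval_eq q hm, xtmon, map_smul (psi N hN g' h' ρbar), map_smul (psi N hN g' h' ρbar)]
  have h1 := conjMap_psi hq0 N hN g h g' h' ρbar (vec m.a) (vec m.r) (tmon q nodesB3 (vec4 m.t)) p
  have h2 := smul_eigenvector h1 (q ^ m.e)
  exact smul_eigenvector h2 c

theorem psi_evalP (g h : Fin 15 → Kˣ) (ρbar : Uq q nodesB3 →ₐ[K] Module.End K V) (c : K)
    (l : Poly) : psi N hN g h ρbar (c • evalP q l)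
      = (l.map fun p => psi N hN g h ρbar ((c * (p.1 : K)) • p.2.eval q)).sum := by
  induction l with
  | nil => simp [evalP_nil]
  | cons p l ih =>
    rw [evalP_cons, smul_add, map_add, ih, List.map_cons, List.sum_cons, smul_smul]

include hq0 hq4 in
-- Equality of the images of `e_i` is an equality of two sums of simultaneous eigenvectors of the
-- maps `conjMap`. Corresponding terms share their eigenvalues and different terms do not, so the
-- equality holds term by term.
theorem psi_signsP_eq {g h g' h' : Fin 15 → Kˣ} {ρbar ρbar' : Uq q nodesB3 →ₐ[K] Module.End K V}
    {i : Fin 4} (he : psi N hN g h ρbar (gval q true i) = psi N hN g' h' ρbar' (gval q true i)) :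
    ∀ p ∈ signsP true i, psi N hN g h ρbar (p.2.eval q) = psi N hN g' h' ρbar' (p.2.eval q) := by
  set c := (q ^ dd i - q ^ (-dd i))⁻¹ with hc
  have hc0 : c ≠ 0 := inv_ne_zero (sub_dd_ne_zero hq0 hq4 i)
  have key := eq_of_sum_eq_sum (conjMap N hN V g h)
    ((psi N hN g h ρbar (evalP q (tailP true i)), psi N hN g' h' ρbar' (evalP q (tailP true i)),
        conjFactor q (vec (lcomb [])) (vec (lcomb []))) ::
      (signsP true i).map fun p => (psi N hN g h ρbar ((c * (p.1 : K)) • p.2.eval q),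
        psi N hN g' h' ρbar' ((c * (p.1 : K)) • p.2.eval q),
        conjFactor q (vec p.2.a) (vec p.2.r))) ?_ ?_ ?_
  · intro p hp
    have := key _ (List.mem_cons_of_mem _ (List.mem_map_of_mem hp))
    simp only [map_smul] at this
    have hp1 : (c * (p.1 : K)) ≠ 0 := by
      refine mul_ne_zero hc0 ?_
      rcases (signsP_coeff i p hp).1 with h | h <;> simp [h]
    have h2 := congrArg (fun x => (c * (p.1 : K))⁻¹ • x) this
    simpa only [smul_smul, inv_mul_cancel₀ hp1, one_smul] using h2
  · intro p hp k
    rcases List.mem_cons.mp hp with rfl | hp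
    · simp only [evalP_tailP, tailExp, vec_lcomb_nil]
      exact ⟨conjMap_psi hq0 N hN _ _ _ _ _ _ _ _ _, conjMap_psi hq0 N hN _ _ _ _ _ _ _ _ _⟩
    · obtain ⟨p, hp', rfl⟩ := List.mem_map.mp hp
      have hw := (signsP_coeff i p hp').2
      have h1 := conjMap_psi_eval hq0 N hN g h g h ρbar hw (c * (p.1 : K)) k
      have h2 := conjMap_psi_eval hq0 N hN g h g' h' ρbar' hw (c * (p.1 : K)) k
      exact ⟨h1, h2⟩
  · have := separated_signsP i
    rw [List.pairwise_cons] at this ⊢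
    refine ⟨?_, ?_⟩
    · intro p hp
      obtain ⟨p, hp', rfl⟩ := List.mem_map.mp hp
      exact conjFactor_ne hq0 hq4 (m := (lcomb [], lcomb [])) (m' := (p.2.a, p.2.r)) (this.1 _
        (List.mem_map_of_mem (f := fun p : ℤ × Mon => (p.2.a, p.2.r)) hp'))
    · have h2 := this.2
      rw [List.pairwise_map] at h2 ⊢
      exact h2.imp fun {p p'} h => conjFactor_ne hq0 hq4 (m := (p.2.a, p.2.r))
        (m' := (p'.2.a, p'.2.r)) h
  · rw [gval_eq, map_add, map_add, psi_evalP, psi_evalP] at he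
    rw [List.map_cons, List.map_cons, List.sum_cons, List.sum_cons, List.map_map, List.map_map,
      add_comm, add_comm (psi N hN g' h' ρbar' _)]
    exact he

/-- With 1 in the second factor neither `ρbar` nor `ρbar'` enters, and both sides are multiples of
one invertible operator. -/
theorem chi_eq_one [Nontrivial V] (hq0 : q ≠ 0) {g h g' h' : Fin 15 → Kˣ}
    {ρbar ρbar' : Uq q nodesB3 →ₐ[K] Module.End K V} {α r : Expo}
    (he : psi N hN g h ρbar (xmon q α r ⊗ₜ[K] 1) = psi N hN g' h' ρbar' (xmon q α r ⊗ₜ[K] 1)) :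
    chi (g / g') (h / h') α r = 1 := by
  have := space_tensor_nontrivial (K := K) N V
  have e1 : ∀ (ρbar : Uq q nodesB3 →ₐ[K] Module.End K V), psi N hN g' h' ρbar (xmon q α r ⊗ₜ[K] 1)
      = TensorProduct.map (sigma15 q N hN g' h' (xmon q α r)) LinearMap.id := fun ρbar => by
    rw [psi_tmul, map_one]
    rfl
  rw [psi_xmon_tmul N hN g h g' h', e1, e1] at he
  have h2 := congrArg (fun x => TensorProduct.map (sigma15 q N hN g' h' (xmon q (-α) (-r)))
    LinearMap.id * x) he
  simp only [mul_smul_comm] at h2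
  rw [← TensorProduct.map_mul, ← map_mul, xmon_mul_neg hq0, map_smul, map_one,
    TensorProduct.map_smul_left, smul_comm] at h2
  have h3 := congrArg (fun x => (q ^ (-∑ k, r k * α k))⁻¹ • x) h2
  simp only [smul_smul, inv_mul_cancel_left₀ (zpow_ne_zero _ hq0),
    inv_mul_cancel₀ (zpow_ne_zero _ hq0), one_smul] at h3
  have h4 : TensorProduct.map (1 : Module.End K (Space K N)) (LinearMap.id * LinearMap.id : Module.End K V)
      = (1 : Module.End K (Space K N ⊗[K] V)) := TensorProduct.map_one
  rw [h4] at h3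
  exact Units.ext (eq_one_of_smul_one_eq_one h3)

end fibres

end

end QuantumF4

/-! ### Equations for the quotients of the parameters, and the conclusion -/

namespace QuantumF4

noncomputable section

variable {K : Type u} [Field K]

section parameters

theorem prod_zpow_single {u : Fin 15 → Kˣ} {n : Expo} {a : Fin 15} (hn : ∀ k, a < k → n k = 0)
    (hu : ∀ k < a, u k ^ n k = 1) : ∏ k, u k ^ n k = u a ^ n a := by
  refine Finset.prod_eq_single a (fun k _ hk => ?_) (by simp)
  rcases lt_or_gt_of_ne hk with h | h
  · exact hu k h
  · rw [hn k h, zpow_zero]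

theorem sq_eq_one_of_chi {u v : Fin 15 → Kˣ} {a : Fin 15} {n : Expo}
    (h : chi u v (-δ a) n = 1) (h' : chi u v (-δ a) (-n) = 1) : u a ^ 2 = 1 := by
  have := chi_add u v (-δ a) n (-δ a) (-n)
  rw [h, h', mul_one, add_neg_cancel] at this
  have e : chi u v (-δ a + -δ a) 0 = (u a ^ 2)⁻¹ := by
    rw [chi, Finset.prod_eq_single a]
    · simp only [Pi.add_apply, Pi.neg_apply, δ, Pi.single_eq_same, Pi.zero_apply, neg_zero,
        zpow_zero, mul_one]
      norm_num
    · intro k _ hk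
      simp [δ, Pi.single_eq_of_ne hk]
    · simp
  rw [e] at this
  exact inv_eq_one.mp this

theorem prod_eq_one_of_chi {u v : Fin 15 → Kˣ} {a : Fin 15} {n : Expo}
    (h : chi u v (-δ a) n = 1) (h' : chi u v (-δ a) (-n) = 1) : ∏ k, v k ^ (2 * n k) = 1 := by
  have e : chi u v (-δ a + - -δ a) (n + - -n) = 1 := by
    rw [chi_add, chi_neg, h, h', inv_one, one_mul]
  rw [add_neg_cancel, neg_neg, chi] at e
  have e2 : (∏ k, v k ^ (2 * n k))⁻¹ = 1 := by
    rw [← e, ← Finset.prod_inv_distrib]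
    refine Finset.prod_congr rfl fun k _ => ?_
    simp only [Pi.zero_apply, zpow_zero, one_mul, Pi.add_apply, ← zpow_neg]
    congr 1
    ring
  exact inv_eq_one.mp e2

/-- A system of equations in triangular form has only solutions of finite order. -/
theorem pow_eq_one_of_triangular {v : Fin 15 → Kˣ} {n : Fin 15 → Expo}
    (hd : ∀ a, n a a = 1 ∨ n a a = 2) (hn : ∀ a k, a < k → n a k = 0)
    (h : ∀ a, ∏ k, v k ^ (2 * n a k) = 1) : ∀ a : Fin 15, v a ^ 4 ^ ((a : ℕ) + 1) = 1 := by
  intro a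
  induction a using WellFoundedLT.induction with
  | ind a ih =>
    have h1 : ∏ k, v k ^ (2 * n a k * (4 ^ (a : ℕ) : ℕ)) = 1 := by
      calc _ = (∏ k, v k ^ (2 * n a k)) ^ 4 ^ (a : ℕ) := by
            rw [← Finset.prod_pow]
            exact Finset.prod_congr rfl fun k _ => by rw [zpow_mul, zpow_natCast]
        _ = 1 := by rw [h a, one_pow]
    -- Raising the `a`-th equation to the power `4 ^ a` removes all earlier unknowns by induction,
    -- and later ones do not occur. The remaining exponent `2 · n a a · 4 ^ a` divides `4 ^ (a +
    -- 1)`.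
    rw [prod_zpow_single (n := fun k => 2 * n a k * (4 ^ (a : ℕ) : ℕ)) (a := a)] at h1
    · rcases hd a with hd | hd
      · rw [hd] at h1
        have h2 := congrArg (· ^ (2 : ℤ)) h1
        simp only [one_zpow, ← zpow_mul] at h2
        rw [← h2, ← zpow_natCast]
        congr 1
        push_cast
        ring
      · rw [hd] at h1
        rw [← h1, ← zpow_natCast]
        congr 1
        push_cast
        ring
    · intro k hk
      simp [hn a k hk]
    · intro k hk
      obtain ⟨c, hc⟩ := pow_dvd_pow 4 (show (k : ℕ) + 1 ≤ a from hk)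
      rw [mul_comm, hc, zpow_mul, zpow_natCast, pow_mul, ih k hk, one_pow, one_zpow]

end parameters

variable {q : K}

section fibres

variable (hq0 : q ≠ 0) (hq4 : q ^ 4 ≠ 1) (N : ℕ) [NeZero N] (hN : q ^ N = 1)
variable {V : Type v} [AddCommGroup V] [Module K V]

include hq0 hq4 in
-- A term of the image of `e_i` contains `t_i^{±1}`, whose value under `ρbar` is unknown. The
-- product with the image of the inverse of `t_i^{±1}` has no such factor any more.
theorem chi_eExps [Nontrivial V] {g h g' h' : Fin 15 → Kˣ}
    {ρbar ρbar' : Uq q nodesB3 →ₐ[K] Module.End K V} {i : Fin 4}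
    (he : psi N hN g h ρbar (gval q true i) = psi N hN g' h' ρbar' (gval q true i))
    {s : ℤ} (hs : s = 1 ∨ s = -1)
    (ht : psi N hN g h ρbar ((tMon (-s) i).eval q) = psi N hN g' h' ρbar' ((tMon (-s) i).eval q))
    {p : List ℤ × List ℤ} (hp : p ∈ eExps i y4) :
    chi (g / g') (h / h') (vec p.1) (s • (vec p.2 - vec (tExpL i y4))) = 1 := by
  refine chi_eq_one N hN (ρbar := ρbar) (ρbar' := ρbar') hq0 ?_
  set m : Mon := ⟨s * dd i, p.1, p.2.map (s * ·), unitL i s, []⟩ with hm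
  have h1 := psi_signsP_eq hq0 hq4 N hN he _ (mem_signsP hp hs)
  have h2 : psi N hN g h ρbar ((m.mul (tMon (-s) i)).eval q)
      = psi N hN g' h' ρbar' ((m.mul (tMon (-s) i)).eval q) := by
    rw [Mon.eval_mul hq0, map_mul, map_mul, ht]
    exact congrArg (· * _) h1
  have e : (m.mul (tMon (-s) i)).eval q = q ^ (m.mul (tMon (-s) i)).e •
      (xmon q (vec p.1) (s • (vec p.2 - vec (tExpL i y4))) ⊗ₜ[K] 1) := by
    rw [Mon.eval]
    congr 2
    · simp only [Mon.mul, hm, tMon, vec_addL, vec_map_mul, vec_lcomb_nil, add_zero]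
      congr 1
      module
    · simp only [Mon.mul, hm, tMon, vec4_addL, vec4_unitL, ← Pi.single_add, add_neg_cancel,
        Pi.single_zero, tmon_zero, wordVal, List.append_nil, List.map_nil, List.prod_nil, one_mul]
  rw [e, map_smul, map_smul] at h2
  have h3 := congrArg (fun x => (q ^ (m.mul (tMon (-s) i)).e)⁻¹ • x) h2
  simpa only [smul_smul, inv_mul_cancel₀ (zpow_ne_zero _ hq0), one_smul] using h3

include hq0 hq4 in
-- For each `a` the two signs give two equations with exponents `(-δ a, ± n a)`. Their product
-- involves only `g_a / g'_a`, their quotient only the `h_k / h'_k` with `k ≤ a`. The exponent `4 ^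
-- 15` is a common bound for all positions.
theorem pow_eq_one_of_psi_eq [Nontrivial V] {g h g' h' : Fin 15 → Kˣ}
    {ρbar ρbar' : Uq q nodesB3 →ₐ[K] Module.End K V}
    (he : ∀ i, psi N hN g h ρbar (gval q true i) = psi N hN g' h' ρbar' (gval q true i))
    (ht : ∀ i, psi N hN g h ρbar ((tMon 1 i).eval q) = psi N hN g' h' ρbar' ((tMon 1 i).eval q))
    (ht' : ∀ i, psi N hN g h ρbar ((tMon (-1) i).eval q)
      = psi N hN g' h' ρbar' ((tMon (-1) i).eval q)) (a : Fin 15) :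
    (g a / g' a) ^ 4 ^ 15 = 1 ∧ (h a / h' a) ^ 4 ^ 15 = 1 := by
  choose p hp hp1 hp2 hp3 using eExps_triangular
  set n : Fin 15 → Expo := fun a => vec (p a).2 - vec (tExpL (node a) y4) with hn
  have hδ : ∀ a, vec (p a).1 = -δ a := fun a => by
    rw [hp1, vec_lcomb]
    simp
  have c1 : ∀ a, chi (g / g') (h / h') (-δ a) (n a) = 1 := fun a => by
    have := chi_eExps hq0 hq4 N hN (he (node a)) (s := 1) (Or.inl rfl) (ht' _) (hp a)
    rwa [hδ, one_smul] at this
  have c2 : ∀ a, chi (g / g') (h / h') (-δ a) (-n a) = 1 := fun a => by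
    have := chi_eExps hq0 hq4 N hN (he (node a)) (s := -1) (Or.inr rfl)
      (by rw [neg_neg]; exact ht _) (hp a)
    rwa [hδ, neg_one_smul] at this
  constructor
  · have := sq_eq_one_of_chi (c1 a) (c2 a)
    have e : (4 : ℕ) ^ 15 = 2 * 2 ^ 29 := by norm_num
    rw [e, pow_mul]
    exact (congrArg (· ^ 2 ^ 29) this).trans (one_pow _)
  · have := pow_eq_one_of_triangular (v := h / h') (n := n) (fun a => ?_) (fun a k hk => ?_)
      (fun a => prod_eq_one_of_chi (c1 a) (c2 a)) a
    · have e : (4 : ℕ) ^ 15 = 4 ^ ((a : ℕ) + 1) * 4 ^ (14 - (a : ℕ)) := by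
        rw [← pow_add]
        congr 1
        omega
      rw [e, pow_mul]
      exact (congrArg (· ^ 4 ^ (14 - (a : ℕ))) this).trans (one_pow _)
    · have h2 : ∀ i, dd i = 1 ∨ dd i = 2 := by decide
      simp only [hn, Pi.sub_apply, hp2]
      exact h2 _
    · simp only [hn, Pi.sub_apply, hp3 a k hk, sub_self]

theorem add_left_cancel_of_module {M : Type*} [AddCommMonoid M] [Module K M] {x y y' : M}
    (h : x + y = x + y') : y = y' := by
  let _ : AddCommGroup M := Module.addCommMonoidToAddCommGroup K
  exact add_left_cancel h

include hq0 in
-- The images of `t_i^{±1}` give `ρbar` on `t_i^{±1}`. The parts `P` contain no other generators, so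
-- they can be subtracted, and the parts `T` give `ρbar` on `e_i` and `f_i`.
theorem rho_eq_of_psi_gval_eq {g h : Fin 15 → Kˣ}
    {ρbar ρbar' : Uq q nodesB3 →ₐ[K] Module.End K V}
    (he : ∀ b i, psi N hN g h ρbar (gval q b i) = psi N hN g h ρbar' (gval q b i))
    (ht : ∀ i, psi N hN g h ρbar ((tMon 1 i).eval q) = psi N hN g h ρbar' ((tMon 1 i).eval q))
    (ht' : ∀ i, psi N hN g h ρbar ((tMon (-1) i).eval q)
      = psi N hN g h ρbar' ((tMon (-1) i).eval q)) : ρbar = ρbar' := by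
  have tt : ∀ i, ρbar (gen q (.t i)) = ρbar' (gen q (.t i)) := fun i => by
    have := ht i
    rw [← Om_relExpr_t, relExpr, Om_sym] at this
    exact rho_eq_of_psi_eq N hN hq0 g h this
  have tt' : ∀ i, ρbar (gen q (.tinv i)) = ρbar' (gen q (.tinv i)) := fun i => by
    have := ht' i
    rw [← Om_relExpr_tinv, relExpr, Om_sym] at this
    exact rho_eq_of_psi_eq N hN hq0 g h this
  have signs : ∀ b i, ∀ p ∈ signsP b i, p.2.w = [] ∧
      ρbar (tmon q nodesB3 (vec4 p.2.t)) = ρbar' (tmon q nodesB3 (vec4 p.2.t)) := by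
    intro b i p hp
    cases b
    · have h0 : ∀ s, ∀ p ∈ signP s false i, p.2.w = [] ∧ p.2.t = [] := by
        intro s p hp
        obtain ⟨b, -, hb⟩ := List.mem_flatMap.mp hp
        rw [signB] at hb
        split_ifs at hb
        · simp only [List.mem_singleton] at hb
          simp [hb]
        · simp only [List.mem_cons, List.not_mem_nil, or_false] at hb
          rcases hb with rfl | rfl <;> simp
      have h1 : p.2.w = [] ∧ p.2.t = [] :=
        (List.mem_append.mp hp).elim (h0 1 p) (h0 (-1) p)
      refine ⟨h1.1, ?_⟩
      rw [h1.2, vec4_nil, tmon_zero, map_one, map_one]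
    · refine ⟨(signsP_coeff i p hp).2, ?_⟩
      rcases List.mem_append.mp hp with hp | hp <;> obtain ⟨p, -, rfl⟩ := List.mem_map.mp hp
      · simpa only [vec4_unitL, tmon_single, tU_zpow_one] using tt i
      · simpa only [vec4_unitL, tmon_single, tU_zpow_neg_one] using tt' i
  have letters : ∀ b i, ρbar (letter q (b, i)) = ρbar' (letter q (b, i)) := by
    intro b i
    have h1 := he b i
    rw [gval_eq, map_add, map_add, psi_evalP, psi_evalP] at h1
    have h2 : (signsP b i).map (fun p => psi N hN g h ρbar
          (((q ^ dd i - q ^ (-dd i))⁻¹ * (p.1 : K)) • p.2.eval q))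
        = (signsP b i).map (fun p => psi N hN g h ρbar'
          (((q ^ dd i - q ^ (-dd i))⁻¹ * (p.1 : K)) • p.2.eval q)) := by
      refine List.map_congr_left fun p hp => ?_
      obtain ⟨hw, ht⟩ := signs b i p hp
      rw [Mon.eval_eq q hw, xtmon, map_smul, map_smul, map_smul, map_smul, psi_tmul, psi_tmul]
      simp only [Mon.index]
      rw [ht]
    rw [h2] at h1
    have h3 := add_left_cancel_of_module (K := K) h1
    rw [evalP_tailP] at h3
    exact rho_eq_of_psi_eq N hN hq0 g h h3
  refine Uq.algHom_ext fun s => ?_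
  cases s with
  | e i => exact letters true i
  | f i =>
    have := letters false i
    have hi : toB3 (i : Fin 4) = some (.f i) := dif_pos i.2
    simpa [letter, hi] using this
  | t i => exact tt i
  | tinv i => exact tt' i

theorem finite_zpow_eq_one (g : Fin 15 → Kˣ) {M : ℕ} (hM : M ≠ 0) :
    {u : Fin 15 → Kˣ | ∀ k, (u k / g k) ^ M = 1}.Finite := by
  have : NeZero M := ⟨hM⟩
  have h : ∀ k, {x : Kˣ | (x / g k) ^ M = 1}.Finite := fun k =>
    Set.Finite.preimage (f := (· / g k)) (s := {x : Kˣ | x ^ M = 1})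
      (div_left_injective.injOn) (Set.finite_coe_iff.mp (inferInstanceAs (Finite (rootsOfUnity M K))))
  refine (Set.Finite.pi h).subset fun u hu k _ => hu k

include hq0 hq4 in
theorem finite_fibre [Nontrivial V] (g h : Fin 15 → Kˣ)
    (ρbar : Uq q nodesB3 →ₐ[K] Module.End K V) :
    {p : (Fin 15 → Kˣ) × (Fin 15 → Kˣ) × (Uq q nodesB3 →ₐ[K] Module.End K V) |
      piRep (rhoHom hq0 hq4) N hN p.1 p.2.1 p.2.2
        = piRep (rhoHom hq0 hq4) N hN g h ρbar}.Finite := by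
  have key : ∀ {g h g' h' : Fin 15 → Kˣ} {ρbar ρbar' : Uq q nodesB3 →ₐ[K] Module.End K V},
      piRep (rhoHom hq0 hq4) N hN g h ρbar = piRep (rhoHom hq0 hq4) N hN g' h' ρbar' →
      ∀ s, psi N hN g h ρbar (Om q nodesB3 (relExpr q s))
        = psi N hN g' h' ρbar' (Om q nodesB3 (relExpr q s)) := by
    intro g h g' h' ρbar ρbar' e s
    have := congrArg (fun φ => φ (gen q s)) e
    rw [← rhoHom_gen hq0 hq4]
    exact this
  have ke : ∀ {g h g' h' : Fin 15 → Kˣ} {ρbar ρbar' : Uq q nodesB3 →ₐ[K] Module.End K V},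
      piRep (rhoHom hq0 hq4) N hN g h ρbar = piRep (rhoHom hq0 hq4) N hN g' h' ρbar' →
      ∀ b i, psi N hN g h ρbar (gval q b i) = psi N hN g' h' ρbar' (gval q b i) := by
    intro g h g' h' ρbar ρbar' e b i
    cases b
    · rw [← Om_relExpr_f hq0 hq4]
      exact key e _
    · rw [← Om_relExpr_e]
      exact key e _
  have kt : ∀ {g h g' h' : Fin 15 → Kˣ} {ρbar ρbar' : Uq q nodesB3 →ₐ[K] Module.End K V},
      piRep (rhoHom hq0 hq4) N hN g h ρbar = piRep (rhoHom hq0 hq4) N hN g' h' ρbar' →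
      ∀ i, psi N hN g h ρbar ((tMon 1 i).eval q) = psi N hN g' h' ρbar' ((tMon 1 i).eval q) ∧
        psi N hN g h ρbar ((tMon (-1) i).eval q) = psi N hN g' h' ρbar' ((tMon (-1) i).eval q) := by
    intro g h g' h' ρbar ρbar' e i
    rw [← Om_relExpr_t, ← Om_relExpr_tinv]
    exact ⟨key e _, key e _⟩
  -- The projection to `(g, h)` has finite image, as the quotients are roots of unity of bounded
  -- order in a field, and it is injective on the fibre.
  refine Set.Finite.of_finite_image (f := fun p => (p.1, p.2.1)) ?_ ?_
  · refine ((finite_zpow_eq_one g (M := 4 ^ 15) (by norm_num)).prod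
      (finite_zpow_eq_one h (M := 4 ^ 15) (by norm_num))).subset ?_
    rintro _ ⟨p, hp, rfl⟩
    have := pow_eq_one_of_psi_eq hq0 hq4 N hN (ke hp true) (fun i => (kt hp i).1)
      (fun i => (kt hp i).2)
    exact ⟨fun k => (this k).1, fun k => (this k).2⟩
  · rintro ⟨g₁, h₁, ρ₁⟩ hp ⟨g₂, h₂, ρ₂⟩ hp' e
    obtain ⟨rfl, rfl⟩ := Prod.mk.inj e
    have e' := Eq.trans hp hp'.symm
    obtain rfl := rho_eq_of_psi_gval_eq hq0 N hN (ke e') (fun i => (kt e' i).1)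
      (fun i => (kt e' i).2)
    rfl

end fibres

end

end QuantumF4

theorem mainTheorem3 {K : Type u} [Field K] (q : K) (hq0 : q ≠ 0) (hq4 : q ^ 4 ≠ 1) :
    ∃ rel : Gen (Set.univ : Set (Fin 4)) → Expr K nodesB3,
      (∀ (s : Gen (Set.univ : Set (Fin 4))) (E : Expr K (Set.univ : Set (Fin 4))),
        IsRel q s E ↔ E = (rel s).toFull) ∧
      ∃ ρ : Uq q (Set.univ : Set (Fin 4)) →ₐ[K] Weyl15 q ⊗[K] Uq q nodesB3,
        (∀ s : Gen (Set.univ : Set (Fin 4)), ρ (gen q s) = Om q nodesB3 (rel s)) ∧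
        (∀ ρ' : Uq q (Set.univ : Set (Fin 4)) →ₐ[K] Weyl15 q ⊗[K] Uq q nodesB3,
          (∀ s : Gen (Set.univ : Set (Fin 4)), ρ' (gen q s) = Om q nodesB3 (rel s)) → ρ' = ρ) ∧
        ∀ (N : ℕ) [NeZero N] (hN : IsPrimitiveRoot q N),
          (∀ (g h : Fin 15 → Kˣ) (s : Gen (Set.univ : Set (Fin 4))),
            piHom ρ N hN.pow_eq_one g h (gen q s)
              = sigmaId q nodesB3 N hN.pow_eq_one g h (Om q nodesB3 (rel s))) ∧
          ∀ (V : Type v) [AddCommGroup V] [Module K V],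
            (∀ (g h : Fin 15 → Kˣ) (ρbar : Uq q nodesB3 →ₐ[K] Module.End K V)
              (s : Gen (Set.univ : Set (Fin 4))),
              piRep ρ N hN.pow_eq_one g h ρbar (gen q s)
                = idRep N ρbar
                    (sigmaId q nodesB3 N hN.pow_eq_one g h (Om q nodesB3 (rel s)))) ∧
            Module.rank K (Space K N ⊗[K] V)
              = (N : Cardinal) ^ 15 * Cardinal.lift.{u} (Module.rank K V) ∧
            (Nontrivial V →
              ∀ (g h : Fin 15 → Kˣ) (ρbar : Uq q nodesB3 →ₐ[K] Module.End K V),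
                {p : (Fin 15 → Kˣ) × (Fin 15 → Kˣ) × (Uq q nodesB3 →ₐ[K] Module.End K V) |
                  piRep ρ N hN.pow_eq_one p.1 p.2.1 p.2.2
                    = piRep ρ N hN.pow_eq_one g h ρbar}.Finite) := by
  refine ⟨relExpr q, isRel_iff q, rhoHom hq0 hq4, rhoHom_gen hq0 hq4, fun ρ' h => ?_, ?_⟩
  · exact Uq.algHom_ext fun s => (h s).trans (rhoHom_gen hq0 hq4 s).symm
  · intro N _ hN
    refine ⟨fun g h s => ?_, fun V _ _ => ⟨fun g h ρbar s => ?_, rank_space N V, fun _ g h ρbar => ?_⟩⟩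
    · rw [← rhoHom_gen hq0 hq4]
      rfl
    · rw [← rhoHom_gen hq0 hq4]
      rfl
    · exact finite_fibre hq0 hq4 N hN.pow_eq_one g h ρbar
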